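/- Let $\mathcal{D}$ be the set of two-rebit density matrices, i.e. of real symmetric positive semidefinite $4\times 4$ matrices $\rho$ with $\operatorname{Tr}\rho=1$, and let $\partial\mathcal{D}$ be the set of minimally degenerate ones, i.e. of those $\rho\in\mathcal{D}$ that have at least one eigenvalue equal to zero (the eight-dimensional boundary of the nine-dimensional body $\mathcal{D}$). For $\rho\in\mathcal{D}$ write $\rho=\begin{pmatrix}A&B\\ B^{T}&D\end{pmatrix}$ with $2\times2$ blocks and let $\rho^{PT}=\begin{pmatrix}A^{T}&B^{T}\\ B&D^{T}\end{pmatrix}$ be the partial transpose, in which each block is transposed in place; $|\rho^{PT}|$ denotes its determinant. Equip $\partial\mathcal{D}$ with the eight-dimensional surface area (Hausdorff) measure induced by the Hilbert–Schmidt metric $ds^{2}=\tfrac12\operatorname{Tr}[(d\rho)^{2}]$. This measure is finite and non-zero on $\partial\mathcal{D}$; let $\langle\cdot\rangle$ be the expectation with respect to the corresponding normalized probability measure on $\partial\mathcal{D}$. Then every power $|\rho^{PT}|^n$, $n\ge 0$, is integrable, and $$ \begin{aligned} \langle|\rho^{PT}|\rangle&=-\frac{5}{2376}, & \langle|\rho^{PT}|^{2}\rangle&=\frac{7}{380160},\\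 \langle|\rho^{PT}|^{3}\rangle&=-\frac{9}{34777600}, & \langle|\rho^{PT}|^{4}\rangle&=\frac{443}{89942261760},\\ \langle|\rho^{PT}|^{5}\rangle&=-\frac{461}{4032782401536}, & \langle|\rho^{PT}|^{6}\rangle&=\frac{5455}{1785064543223808},\\ \langle|\rho^{PT}|^{7}\rangle&=-\frac{631}{6948198442598400}, & \langle|\rho^{PT}|^{8}\rangle&=\frac{474017}{161763811601154048000},\\ \langle|\rho^{PT}|^{9}\rangle&=-\frac{4003573}{39645007353595350220800}, & \langle|\rho^{PT}|^{10}\rangle&=\frac{3397}{924892257224239349760}. \end{aligned} $$ -/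

import Mathlib

open MeasureTheory ProbabilityTheory
open scoped Matrix MeasureTheory

/-- Real `4 × 4` matrices, viewed as `2 × 2` block matrices with `2 × 2` blocks: the first
component of an index is the number of the block, the second one the position in the block. -/
abbrev RebitMatrix : Type := Matrix (Fin 2 × Fin 2) (Fin 2 × Fin 2) ℝ

/-- The partial transpose: each of the four `2 × 2` blocks is transposed in place. -/
def partialTranspose (ρ : RebitMatrix) : RebitMatrix :=
  Matrix.of fun i j => ρ (i.1, j.2) (j.1, i.2)

/-- Two-rebit density matrices: symmetric, nonnegative eigenvalues, unit trace. -/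
def twoRebitStates : Set RebitMatrix :=
  {ρ | ρ.PosSemidef ∧ ρ.trace = 1}

/-- Minimally degenerate two-rebit density matrices: at least one eigenvalue is zero. These are
the matrices that form the boundary of the set of all two-rebit density matrices inside the
nine-dimensional affine space of symmetric matrices of unit trace. -/
def minimallyDegenerateStates : Set RebitMatrix :=
  {ρ | ρ ∈ twoRebitStates ∧ ∃ v : Fin 2 × Fin 2 → ℝ, v ≠ 0 ∧ ρ *ᵥ v = 0}

/-- The space of real `4 × 4` matrices with the Hilbert-Schmidt (Frobenius) distance: the
Euclidean space of the sixteen matrix entries. -/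
abbrev HSSpace : Type := EuclideanSpace ℝ ((Fin 2 × Fin 2) × (Fin 2 × Fin 2))

/-- The matrix with given entries. -/
def HSSpace.toMatrix (x : HSSpace) : RebitMatrix :=
  Matrix.of fun i j => x (i, j)

/-- The norm of `HSSpace` is the Hilbert-Schmidt norm. -/
theorem HSSpace.norm_sq_eq (x : HSSpace) : ‖x‖ ^ 2 = (x.toMatrixᵀ * x.toMatrix).trace := by
  rw [EuclideanSpace.norm_sq_eq, Fintype.sum_prod_type_right]
  simp [Matrix.trace, Matrix.mul_apply, HSSpace.toMatrix, sq]

/-- The Hilbert-Schmidt probability distribution on the minimally degenerate two-rebit states: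
the eight-dimensional Hausdorff (surface area) measure of the Hilbert-Schmidt distance, restricted
to these states and normalized. A constant factor in the metric, such as the `1 / 2` in the line
element `1 / 2 * tr ((dρ) ^ 2)`, multiplies the surface area by a constant and does not change
the normalized measure. -/
noncomputable def hsBoundaryLaw : Measure HSSpace :=
  ProbabilityTheory.cond (Measure.hausdorffMeasure 8)
    {x : HSSpace | x.toMatrix ∈ minimallyDegenerateStates}

/-- The moment `⟨|ρ^PT| ^ n⟩` of the determinant of the partial transpose of a minimally
degenerate two-rebit state, with respect to the Hilbert-Schmidt distribution. -/
noncomputable def hsBoundaryMoment (n : ℕ) : ℝ :=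
  ∫ x : HSSpace, (partialTranspose x.toMatrix).det ^ n ∂hsBoundaryLaw

/-! Almost every boundary state is a singular matrix with positive definite upper left 3 × 3 block.
Its last diagonal entry is then a function of the other nine entries, and division by the first
entry gives a chart on an open subset of ℝ⁸ (`image_boundaryChart`,
`hausdorffMeasure_boundaryStates_diff`). The tangent space is orthogonal to the identity and to v
vᵀ, where v is the null vector with last coordinate 1; hence the area density is √192 |v|² τ⁻⁹, with
τ the trace before normalization (`normDet_chartDeriv`).

The factor |v|² would spoil the later substitutions. The diagonal of the adjugate is proportional to
the squares of the coordinates of v, and the exchange of the two blocks preserves both the area and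
|ρ^PT|. Inserting the weight (v₃² + v₄²)/|v|² therefore costs only a factor 2 and replaces |v|² by 1
+ v₃² (`lintegral_boundaryStates_eq_two_mul`).

Since |ρ^PT|ⁿ is homogeneous of degree 4n, a Gamma integral over the scale turns the surface
integral into an integral over the nine-dimensional cone of singular matrices with weight
exp(-trace), at the price of the factor (4n+8)! (`exists_lintegral_boundaryStates_eq_cone`).

On the cone put A = S², B = S W S, D = S (WᵀW + e eᵀ) S. Then |ρ^PT| = (det A)² det(WᵀW - W Wᵀ + e
eᵀ), in which only products of the rotation part and the reflection part of W occur, and the trace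
is quadratic in W and e. Rotation invariance removes one coordinate; a Cholesky factor of A and
completion of squares turn the trace into a sum of eight squares and |ρ^PT| into a polynomial
(`lintegral_cone_eq_gauss`).

The eight coordinates are now independent, with weights of the form t^k exp(-t²), whose moments are
ratios of Gamma values. Binomial expansion yields the rational number `meanPow n`. All remaining
constants are the same for every n and cancel against n = 0, so the moment is `meanPow n` ·
8!/(4n+8)! (`hsBoundaryMoment_eq`), which is evaluated exactly. -/

/-! ### Area formula for injective immersions, by linearization. -/

section AreaFormula

open Set Filter Topology
open scoped NNReal ENNReal

/-- A map whose distances are dominated by those of another map has an image of dominated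
Hausdorff measure. -/
theorem hausdorffMeasure_image_le_of_edist_le {X Y Z : Type*} [EMetricSpace Y] [EMetricSpace Z]
    [MeasurableSpace Y] [BorelSpace Y] [MeasurableSpace Z] [BorelSpace Z]
    {f : X → Y} {g : X → Z} {s : Set X} {C : ℝ≥0} {d : ℝ} (hd : 0 ≤ d)
    (h : ∀ x ∈ s, ∀ y ∈ s, edist (f x) (f y) ≤ C * edist (g x) (g y)) :
    μH[d] (f '' s) ≤ (C : ℝ≥0∞) ^ d * μH[d] (g '' s) := by
  rcases s.eq_empty_or_nonempty with rfl | ⟨x₀, hx₀⟩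
  · simp
  have : Nonempty X := ⟨x₀⟩
  set k : Z → Y := fun z => f (Function.invFunOn g s z) with hk
  have hmem : ∀ x ∈ s, Function.invFunOn g s (g x) ∈ s := fun x hx =>
    Function.invFunOn_mem ⟨x, hx, rfl⟩
  have heq : ∀ x ∈ s, g (Function.invFunOn g s (g x)) = g x := fun x hx =>
    Function.invFunOn_eq ⟨x, hx, rfl⟩
  -- Points with the same `g`-value have `f`-distance zero, so `f` factors through `g` by a map that
  -- is `C`-Lipschitz on the image.
  have hkg : ∀ x ∈ s, k (g x) = f x := by
    intro x hx
    have := h _ (hmem x hx) x hx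
    rw [heq x hx, edist_self, mul_zero, nonpos_iff_eq_zero, edist_eq_zero] at this
    exact this
  have hlip : LipschitzOnWith C k (g '' s) := by
    rintro _ ⟨x, hx, rfl⟩ _ ⟨y, hy, rfl⟩
    rw [hkg x hx, hkg y hy]
    exact h x hx y hy
  have himg : f '' s = k '' (g '' s) := by
    rw [image_image]
    exact image_congr fun x hx => (hkg x hx).symm
  rw [himg]
  exact hlip.hausdorffMeasure_image_le hd

variable {E V : Type*} [NormedAddCommGroup E] [InnerProductSpace ℝ E] [FiniteDimensional ℝ E]
  [MeasurableSpace E] [BorelSpace E]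
  [NormedAddCommGroup V] [InnerProductSpace ℝ V] [MeasurableSpace V] [BorelSpace V]

/-- Near a point of strict differentiability with injective derivative, the Hausdorff measure of
images is close to that of the images under the derivative. -/
theorem HasStrictFDerivAt.exists_nhds_hausdorffMeasure_image_le {f : E → V} {A : E →L[ℝ] V}
    {x : E} (hf : HasStrictFDerivAt f A x) (hA : Function.Injective A) {t : ℝ≥0} (ht : 1 < t)
    {d : ℝ} (hd : 0 ≤ d) :
    ∃ U ∈ 𝓝 x, ∀ S ⊆ U, μH[d] (f '' S) ≤ (t : ℝ≥0∞) ^ d * μH[d] (A '' S) ∧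
      μH[d] (A '' S) ≤ (t : ℝ≥0∞) ^ d * μH[d] (f '' S) := by
  obtain ⟨K, hK0, hK⟩ := LinearMap.exists_antilipschitzWith A.toLinearMap (LinearMap.ker_eq_bot.2 hA)
  have hK' : ∀ u v, ‖u - v‖ ≤ K * ‖A u - A v‖ := by
    intro u v
    have := hK.le_mul_dist u v
    rwa [dist_eq_norm, dist_eq_norm] at this
  have ht' : (1 : ℝ) < t := by exact_mod_cast ht
  have hKr : (0 : ℝ) < K := by exact_mod_cast hK0
  -- An error `c‖u - v‖` is at most `c K` times the length under `A`. The upper bound by the factor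
  -- `t` needs `1 + c K ≤ t`, the lower one needs `1 - c K ≥ 1 / t`; this `c` is the largest with
  -- the second property and also has the first.
  set c : ℝ≥0 := (t - 1) / (K * t) with hc
  have hcr : (c : ℝ) = (t - 1) / (K * t) := by
    rw [hc]; push_cast [NNReal.coe_sub ht.le]; rfl
  have hcpos : 0 < c := by
    rw [← NNReal.coe_pos, hcr]
    have : (0 : ℝ) < t - 1 := by linarith
    positivity
  have hcK : (c : ℝ) * K * t = t - 1 := by
    rw [hcr]; field_simp
  obtain ⟨U, hU, hUf⟩ := hf.approximates_deriv_on_nhds (c := c) (Or.inr hcpos)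
  have key : ∀ u ∈ U, ∀ v ∈ U, ‖f u - f v - (A u - A v)‖ ≤ c * K * ‖A u - A v‖ := by
    intro u hu v hv
    have h1 := hUf u hu v hv
    rw [map_sub] at h1
    calc _ ≤ c * ‖u - v‖ := h1
      _ ≤ c * (K * ‖A u - A v‖) := by gcongr; exact hK' u v
      _ = _ := by ring
  have hcK0 : (0 : ℝ) ≤ c * K := by positivity
  have hcK1 : (c : ℝ) * K ≤ t - 1 := by nlinarith
  refine ⟨U, hU, fun S hS => ⟨?_, ?_⟩⟩
  · refine hausdorffMeasure_image_le_of_edist_le hd fun u hu v hv => ?_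
    rw [edist_dist, edist_dist, ← ENNReal.ofReal_coe_nnreal, ← ENNReal.ofReal_mul t.coe_nonneg]
    refine ENNReal.ofReal_le_ofReal ?_
    rw [dist_eq_norm, dist_eq_norm]
    have h1 := key u (hS hu) v (hS hv)
    have h2 : ‖f u - f v‖ ≤ ‖f u - f v - (A u - A v)‖ + ‖A u - A v‖ := by
      simpa using norm_add_le (f u - f v - (A u - A v)) (A u - A v)
    nlinarith [norm_nonneg (A u - A v)]
  · refine hausdorffMeasure_image_le_of_edist_le hd fun u hu v hv => ?_
    rw [edist_dist, edist_dist, ← ENNReal.ofReal_coe_nnreal, ← ENNReal.ofReal_mul t.coe_nonneg]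
    refine ENNReal.ofReal_le_ofReal ?_
    rw [dist_eq_norm, dist_eq_norm]
    have h1 := key u (hS hu) v (hS hv)
    have h2 : ‖A u - A v‖ ≤ ‖f u - f v‖ + ‖f u - f v - (A u - A v)‖ := by
      have := norm_sub_le (f u - f v) (f u - f v - (A u - A v))
      simpa using this
    have h3 : ‖A u - A v‖ * t ≤ t * ‖f u - f v‖ + (t - 1) * ‖A u - A v‖ := by
      calc ‖A u - A v‖ * t ≤ (‖f u - f v‖ + c * K * ‖A u - A v‖) * t := by gcongr; linarith
        _ = t * ‖f u - f v‖ + (c * K * t) * ‖A u - A v‖ := by ring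
        _ = _ := by rw [hcK]
    linarith

/-- Two set functions that are countably additive on the measurable subsets of `Ω` and locally
comparable up to a factor `t` are comparable up to the factor `t`. -/
theorem measure_image_le_of_locally_le {E V : Type*} [NormedAddCommGroup E] [NormedSpace ℝ E]
    [FiniteDimensional ℝ E] [MeasurableSpace E] [BorelSpace E] [NormedAddCommGroup V]
    [MeasurableSpace V] [BorelSpace V] [CompleteSpace V] [SecondCountableTopology V]
    {f : E → V} {Ω : Set E}
    (hfc : ContinuousOn f Ω) (hinj : InjOn f Ω) (μ : Measure V) (ν : Measure E) {t : ℝ≥0∞}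
    (hloc : ∀ x ∈ Ω, ∃ U ∈ 𝓝 x, ∀ S ⊆ U ∩ Ω, MeasurableSet S →
      μ (f '' S) ≤ t * ν S ∧ ν S ≤ t * μ (f '' S))
    {S : Set E} (hS : MeasurableSet S) (hSΩ : S ⊆ Ω) :
    μ (f '' S) ≤ t * ν S ∧ ν S ≤ t * μ (f '' S) := by
  choose! U hU hUS using hloc
  obtain ⟨c, hcΩ, hc, hcover⟩ := TopologicalSpace.countable_cover_nhdsWithin
    (s := Ω) (f := fun x => interior (U x)) fun x hx =>
      mem_nhdsWithin_of_mem_nhds (interior_mem_nhds.2 (hU x hx))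
  rcases c.eq_empty_or_nonempty with rfl | hne
  · have : S = ∅ := by
      apply subset_empty_iff.1
      exact hSΩ.trans (by simpa using hcover)
    simp [this]
  obtain ⟨e, rfl⟩ := hc.exists_eq_range hne
  set D : ℕ → Set E := disjointed fun n => interior (U (e n)) with hD
  have hDm : ∀ n, MeasurableSet (D n) := fun n =>
    MeasurableSet.disjointed (fun n => isOpen_interior.measurableSet) n
  have hSU : S = ⋃ n, S ∩ D n := by
    rw [← inter_iUnion, hD, iUnion_disjointed, eq_comm, inter_eq_left]
    refine hSΩ.trans (hcover.trans ?_)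
    simp
  have hdisj : Pairwise (Function.onFun Disjoint fun n => S ∩ D n) := fun i j hij =>
    ((disjoint_disjointed _) hij).mono inter_subset_right inter_subset_right
  have hm : ∀ n, MeasurableSet (S ∩ D n) := fun n => hS.inter (hDm n)
  have hν : ν S = ∑' n, ν (S ∩ D n) := by
    conv_lhs => rw [hSU]
    exact measure_iUnion hdisj hm
  -- Injectivity keeps the images of the pieces disjoint, and injective continuous images of Borel
  -- sets are Borel.
  have hμ : μ (f '' S) = ∑' n, μ (f '' (S ∩ D n)) := by
    conv_lhs => rw [hSU, image_iUnion]
    refine measure_iUnion (fun i j hij => ?_) fun n => ?_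
    · exact (hdisj hij).image hinj (inter_subset_left.trans hSΩ) (inter_subset_left.trans hSΩ)
    · exact (hm n).image_of_continuousOn_injOn (hfc.mono (inter_subset_left.trans hSΩ))
        (hinj.mono (inter_subset_left.trans hSΩ))
  have hpiece : ∀ n, μ (f '' (S ∩ D n)) ≤ t * ν (S ∩ D n) ∧
      ν (S ∩ D n) ≤ t * μ (f '' (S ∩ D n)) := by
    intro n
    refine hUS (e n) (hcΩ (mem_range_self n)) _ (fun y hy => ⟨?_, hSΩ hy.1⟩) (hm n)
    exact interior_subset (disjointed_subset _ n hy.2)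
  rw [hν, hμ, ← ENNReal.tsum_mul_left, ← ENNReal.tsum_mul_left]
  exact ⟨ENNReal.tsum_le_tsum fun n => (hpiece n).1, ENNReal.tsum_le_tsum fun n => (hpiece n).2⟩

theorem ENNReal.le_of_forall_one_lt_pow_mul_le {a b : ℝ≥0∞} (k : ℕ)
    (h : ∀ t : ℝ≥0, 1 < t → a ≤ (t : ℝ≥0∞) ^ k * b) : a ≤ b := by
  have hlim : Tendsto (fun t : ℝ≥0 => (t : ℝ≥0∞) ^ k * b) (𝓝[>] 1) (𝓝 ((1 : ℝ≥0∞) ^ k * b)) := by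
    refine ENNReal.Tendsto.mul_const ?_ (Or.inl (by simp))
    have h1 : Continuous fun t : ℝ≥0 => (t : ℝ≥0∞) ^ k :=
      (ENNReal.continuous_pow k).comp ENNReal.continuous_coe
    simpa using (h1.tendsto 1).mono_left nhdsWithin_le_nhds
  rw [one_pow, one_mul] at hlim
  have : (𝓝[>] (1 : ℝ≥0)).NeBot := nhdsGT_neBot 1
  refine ge_of_tendsto hlim ?_
  filter_upwards [self_mem_nhdsWithin] with t ht using h t ht

/-- The area formula for injective immersions of an open subset of a Euclidean space. -/
theorem hausdorffMeasure_image_eq_lintegral_normDet [CompleteSpace V] [SecondCountableTopology V]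
    {d : ℕ} (hd : Module.finrank ℝ E = d)
    {f : E → V} {f' : E → E →L[ℝ] V} {Ω : Set E} (hΩ : IsOpen Ω)
    (hf : ∀ x ∈ Ω, HasStrictFDerivAt f (f' x) x) (hinj : InjOn f Ω)
    (hf' : ∀ x ∈ Ω, Function.Injective (f' x))
    (hJ : ContinuousOn (fun x => (f' x).toLinearMap.normDet) Ω)
    {S : Set E} (hS : MeasurableSet S) (hSΩ : S ⊆ Ω) :
    μH[d] (f '' S) = ∫⁻ x in S, ENNReal.ofReal (f' x).toLinearMap.normDet ∂μH[d] := by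
  set J : E → ℝ := fun x => (f' x).toLinearMap.normDet with hJdef
  have hJpos : ∀ x ∈ Ω, 0 < J x := fun x hx =>
    lt_of_le_of_ne (LinearMap.normDet_nonneg _) (Ne.symm fun h0 =>
      LinearMap.normDet_eq_zero_iff_ker_ne_bot.1 h0 (LinearMap.ker_eq_bot.2 (hf' x hx)))
  set ν : Measure E := (μH[d] : Measure E).withDensity fun x => ENNReal.ofReal (J x) with hν
  have hνS : ν S = ∫⁻ x in S, ENNReal.ofReal (J x) ∂μH[d] := withDensity_apply _ hS
  rw [← hνS]
  -- The distortion of lengths by `f` relative to its derivative costs `t ^ d`; the oscillation of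
  -- the density `J` near a point costs one more factor `t`.
  have main : ∀ t : ℝ≥0, 1 < t → μH[d] (f '' S) ≤ (t : ℝ≥0∞) ^ (d + 1) * ν S ∧
      ν S ≤ (t : ℝ≥0∞) ^ (d + 1) * μH[d] (f '' S) := by
    intro t ht
    have ht' : (1 : ℝ) < t := by exact_mod_cast ht
    refine measure_image_le_of_locally_le
      (fun x hx => (hf x hx).continuousAt.continuousWithinAt) hinj _ _ (fun x hx => ?_) hS hSΩ
    obtain ⟨U, hU, hUS⟩ := (hf x hx).exists_nhds_hausdorffMeasure_image_le (hf' x hx) ht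
      (d := (d : ℝ)) (by positivity)
    have hJx := hJpos x hx
    have hJc : ContinuousAt J x := hJ.continuousAt (hΩ.mem_nhds hx)
    have h1 : ∀ᶠ y in 𝓝 x, J y < t * J x :=
      hJc.eventually_lt_const (by nlinarith)
    have h2 : ∀ᶠ y in 𝓝 x, J x / t < J y :=
      hJc.eventually_const_lt (by rw [div_lt_iff₀ (by linarith)]; nlinarith)
    refine ⟨U ∩ {y | J y < t * J x ∧ J x / t < J y}, inter_mem hU (h1.and h2),
      fun T hT hTm => ?_⟩
    have hTU : T ⊆ U := fun y hy => (hT hy).1.1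
    have hνT : ν T = ∫⁻ y in T, ENNReal.ofReal (J y) ∂μH[d] := withDensity_apply _ hTm
    have hA : μH[d] (f' x '' T) = ENNReal.ofReal (J x) * μH[d] T := by
      have := LinearMap.hausdorffMeasure_image (f' x).toLinearMap T
      rw [hd] at this
      exact this
    have hub : ν T ≤ t * (ENNReal.ofReal (J x) * μH[d] T) := by
      rw [hνT, ← mul_assoc, ← ENNReal.ofReal_coe_nnreal, ← ENNReal.ofReal_mul t.coe_nonneg,
        ← setLIntegral_const]
      refine setLIntegral_mono measurable_const fun y hy => ENNReal.ofReal_le_ofReal ?_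
      exact (hT hy).1.2.1.le
    have hlb : ENNReal.ofReal (J x) * μH[d] T ≤ t * ν T := by
      have : ENNReal.ofReal (J x / t) * μH[d] T ≤ ν T := by
        rw [hνT, ← setLIntegral_const]
        refine setLIntegral_mono' hTm fun y hy => ENNReal.ofReal_le_ofReal ?_
        exact (hT hy).1.2.2.le
      calc ENNReal.ofReal (J x) * μH[d] T
          = t * (ENNReal.ofReal (J x / t) * μH[d] T) := by
            rw [← mul_assoc, ← ENNReal.ofReal_coe_nnreal, ← ENNReal.ofReal_mul t.coe_nonneg,
              mul_div_cancel₀ _ (by linarith : (t : ℝ) ≠ 0)]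
        _ ≤ _ := by gcongr
    obtain ⟨h3, h4⟩ := hUS T hTU
    rw [hA, ENNReal.rpow_natCast] at h3 h4
    constructor
    · calc _ ≤ (t : ℝ≥0∞) ^ d * (ENNReal.ofReal (J x) * μH[d] T) := h3
        _ ≤ (t : ℝ≥0∞) ^ d * (t * ν T) := by gcongr
        _ = _ := by rw [pow_succ, mul_assoc]
    · calc _ ≤ t * (ENNReal.ofReal (J x) * μH[d] T) := hub
        _ ≤ t * ((t : ℝ≥0∞) ^ d * μH[d] (f '' T)) := by gcongr
        _ = _ := by rw [pow_succ]; ring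
  exact le_antisymm (ENNReal.le_of_forall_one_lt_pow_mul_le (d + 1) fun t ht => (main t ht).1)
    (ENNReal.le_of_forall_one_lt_pow_mul_le (d + 1) fun t ht => (main t ht).2)

/-- The area formula for integrals over the image of an injective immersion. -/
theorem setLIntegral_image_hausdorffMeasure [CompleteSpace V] [SecondCountableTopology V]
    {d : ℕ} (hd : Module.finrank ℝ E = d)
    {f : E → V} {f' : E → E →L[ℝ] V} {Ω : Set E} (hΩ : IsOpen Ω)
    (hf : ∀ x ∈ Ω, HasStrictFDerivAt f (f' x) x) (hinj : InjOn f Ω)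
    (hf' : ∀ x ∈ Ω, Function.Injective (f' x))
    (hJ : ContinuousOn (fun x => (f' x).toLinearMap.normDet) Ω)
    {g : V → ℝ≥0∞} (hg : Measurable g) :
    ∫⁻ y in f '' Ω, g y ∂μH[d] =
      ∫⁻ x in Ω, ENNReal.ofReal (f' x).toLinearMap.normDet * g (f x) ∂μH[d] := by
  have hfc : ContinuousOn f Ω := fun x hx => (hf x hx).continuousAt.continuousWithinAt
  have hfm : AEMeasurable f ((μH[d] : Measure E).restrict Ω) :=
    hfc.aemeasurable hΩ.measurableSet
  have hJm : AEMeasurable (fun x => ENNReal.ofReal (f' x).toLinearMap.normDet)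
      ((μH[d] : Measure E).restrict Ω) :=
    (hJ.aemeasurable hΩ.measurableSet).ennreal_ofReal
  set ν : Measure E := ((μH[d] : Measure E).restrict Ω).withDensity
    fun x => ENNReal.ofReal (f' x).toLinearMap.normDet with hν
  have hfν : AEMeasurable f ν := hfm.mono_ac (withDensity_absolutelyContinuous _ _)
  have hmeas : (μH[d] : Measure V).restrict (f '' Ω) = ν.map f := by
    ext T hT
    rw [Measure.restrict_apply hT, Measure.map_apply_of_aemeasurable hfν hT]
    obtain ⟨k, hk, hke⟩ := hfm
    have hpre : MeasurableSet (Ω ∩ f ⁻¹' T) := by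
      have h0 : Continuous fun x : Ω => f x :=
        continuous_iff_continuousAt.2 fun x =>
          ((hf x x.2).continuousAt).comp continuous_subtype_val.continuousAt
      have h1 := hΩ.measurableSet.subtype_image (h0.measurable hT)
      rwa [show Subtype.val '' ((fun x : Ω => f x) ⁻¹' T) = Ω ∩ f ⁻¹' T by
        ext x; simp [and_comm]] at h1
    have h1 : T ∩ f '' Ω = f '' (Ω ∩ f ⁻¹' T) := by
      rw [inter_comm T, image_inter_preimage]
    have h2 : ν (f ⁻¹' T) = ν (Ω ∩ f ⁻¹' T) := by
      have h0 : ν Ωᶜ = 0 := by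
        refine withDensity_absolutelyContinuous _ _ ?_
        rw [Measure.restrict_apply hΩ.measurableSet.compl]; simp
      rw [inter_comm]
      exact (measure_inter_conull h0).symm
    rw [h1, h2, hausdorffMeasure_image_eq_lintegral_normDet hd hΩ hf hinj hf' hJ hpre
      inter_subset_left, withDensity_apply _ hpre, Measure.restrict_restrict hpre,
      inter_eq_left.2 inter_subset_left]
  rw [hmeas, lintegral_map' hg.aemeasurable hfν, hν]
  exact lintegral_withDensity_eq_lintegral_mul₀ hJm (hg.comp_aemeasurable hfm)

end AreaFormula

/-! ### Coordinates on symmetric 4 × 4 matrices. -/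

section SymmetricMatrices

/-- The coordinate of a symmetric matrix that sits at a given entry: the diagonal entries `(0, 0)`
of the first and `(1, 1)` of the last block are the coordinates `inr 0` and `inr 1`. -/
def symIndex (i j : Fin 2 × Fin 2) : Fin 8 ⊕ Fin 2 :=
  (![![![.inr 0, .inl 0, .inl 2, .inl 4], ![.inl 0, .inl 1, .inl 3, .inl 5]],
    ![![.inl 2, .inl 3, .inl 6, .inl 7], ![.inl 4, .inl 5, .inl 7, .inr 1]]] i.1 i.2)
    (![![0, 1], ![2, 3]] j.1 j.2)

/-- The symmetric matrix with given coordinates. -/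
noncomputable def symOf (c : Fin 8 ⊕ Fin 2 → ℝ) : HSSpace :=
  WithLp.toLp 2 fun p => c (symIndex p.1 p.2)

/-- The determinant of a symmetric `4 × 4` matrix. -/
def symDet (a11 a12 a22 b11 b21 b12 b22 d11 d12 d22 : ℝ) : ℝ :=
  a11 * a22 * d11 * d22 - a11 * a22 * d12 ^ 2 - a11 * b21 ^ 2 * d22 + 2 * a11 * b21 * b22 * d12
    - a11 * b22 ^ 2 * d11 - a12 ^ 2 * d11 * d22 + a12 ^ 2 * d12 ^ 2 + 2 * a12 * b11 * b21 * d22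
    - 2 * a12 * b12 * b21 * d12 - 2 * a12 * b11 * b22 * d12 + 2 * a12 * b12 * b22 * d11
    - a22 * b11 ^ 2 * d22 + 2 * a22 * b11 * b12 * d12 + b11 ^ 2 * b22 ^ 2
    - 2 * b11 * b12 * b21 * b22 - a22 * b12 ^ 2 * d11 + b12 ^ 2 * b21 ^ 2

/-- The diagonal blocks are symmetric, so partial transposition only exchanges the coordinates `inl
3` and `inl 4`, the off-diagonal entries of `B`. -/
theorem det_partialTranspose_symOf (c : Fin 8 ⊕ Fin 2 → ℝ) :
    (partialTranspose (symOf c).toMatrix).det =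
      symDet (c (.inr 0)) (c (.inl 0)) (c (.inl 1)) (c (.inl 2)) (c (.inl 4)) (c (.inl 3))
        (c (.inl 5)) (c (.inl 6)) (c (.inl 7)) (c (.inr 1)) := by
  set e : Fin 4 ≃ Fin 2 × Fin 2 := (finProdFinEquiv (m := 2) (n := 2)).symm
  have h0 : e 0 = (0, 0) := by decide
  have h1 : e 1 = (0, 1) := by decide
  have h2 : e 2 = (1, 0) := by decide
  have h3 : e 3 = (1, 1) := by decide
  have hm : (partialTranspose (symOf c).toMatrix).submatrix e e =
      !![c (.inr 0), c (.inl 0), c (.inl 2), c (.inl 3);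
        c (.inl 0), c (.inl 1), c (.inl 4), c (.inl 5);
        c (.inl 2), c (.inl 4), c (.inl 6), c (.inl 7);
        c (.inl 3), c (.inl 5), c (.inl 7), c (.inr 1)] := by
    ext i j
    fin_cases i <;> fin_cases j <;>
      simp [h0, h1, h2, h3, partialTranspose, HSSpace.toMatrix, symOf, symIndex]
  rw [← Matrix.det_submatrix_equiv_self e, hm]
  simp [Matrix.det_succ_row_zero, Fin.sum_univ_succ, Fin.succAbove, symDet]
  ring

/-- The quadratic form of a symmetric matrix with given coordinates. -/
def symForm (c : Fin 8 ⊕ Fin 2 → ℝ) (x1 x2 x3 x4 : ℝ) : ℝ :=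
  c (.inr 0) * x1 ^ 2 + c (.inl 1) * x2 ^ 2 + c (.inl 6) * x3 ^ 2 + c (.inr 1) * x4 ^ 2
    + 2 * (c (.inl 0) * x1 * x2 + c (.inl 2) * x1 * x3 + c (.inl 4) * x1 * x4
      + c (.inl 3) * x2 * x3 + c (.inl 5) * x2 * x4 + c (.inl 7) * x3 * x4)

theorem dotProduct_mulVec_symOf (c : Fin 8 ⊕ Fin 2 → ℝ) (x : Fin 2 × Fin 2 → ℝ) :
    x ⬝ᵥ ((symOf c).toMatrix *ᵥ x) = symForm c (x (0, 0)) (x (0, 1)) (x (1, 0)) (x (1, 1)) := by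
  simp [dotProduct, Matrix.mulVec, Fintype.sum_prod_type, HSSpace.toMatrix, symOf, symIndex,
    symForm]
  ring

theorem isHermitian_symOf (c : Fin 8 ⊕ Fin 2 → ℝ) : (symOf c).toMatrix.IsHermitian := by
  ext i j
  obtain ⟨i1, i2⟩ := i
  obtain ⟨j1, j2⟩ := j
  fin_cases i1 <;> fin_cases i2 <;> fin_cases j1 <;> fin_cases j2 <;>
    simp [HSSpace.toMatrix, symOf, symIndex]

theorem trace_symOf (c : Fin 8 ⊕ Fin 2 → ℝ) :
    (symOf c).toMatrix.trace = c (.inr 0) + c (.inl 1) + c (.inl 6) + c (.inr 1) := by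
  simp [Matrix.trace, Fintype.sum_prod_type, HSSpace.toMatrix, symOf, symIndex]
  ring

theorem exists_eq_symOf {x : HSSpace} (hx : x.toMatrix.IsHermitian) : ∃ c, x = symOf c := by
  have h : ∀ i j, x (i, j) = x (j, i) := fun i j => by
    simpa [HSSpace.toMatrix] using hx.apply j i
  refine ⟨Sum.elim ![x ((0, 0), (0, 1)), x ((0, 1), (0, 1)), x ((0, 0), (1, 0)),
    x ((0, 1), (1, 0)), x ((0, 0), (1, 1)), x ((0, 1), (1, 1)), x ((1, 0), (1, 0)),
    x ((1, 0), (1, 1))] ![x ((0, 0), (0, 0)), x ((1, 1), (1, 1))], ?_⟩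
  ext p
  obtain ⟨⟨i1, i2⟩, ⟨j1, j2⟩⟩ := p
  fin_cases i1 <;> fin_cases i2 <;> fin_cases j1 <;> fin_cases j2 <;>
    simp [symOf, symIndex] <;> rw [h]

/-- The Hilbert-Schmidt weights of the coordinates of a symmetric matrix. -/
def symWeight : Fin 8 ⊕ Fin 2 → ℝ := Sum.elim ![2, 1, 2, 2, 2, 2, 1, 2] ![1, 1]

theorem inner_symOf (c c' : Fin 8 ⊕ Fin 2 → ℝ) :
    inner ℝ (symOf c) (symOf c') = ∑ k, c k * symWeight k * c' k := by
  simp [PiLp.inner_apply, Fintype.sum_prod_type, symOf, symIndex, symWeight, Fin.sum_univ_eight]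
  ring

end SymmetricMatrices

/-! ### Singular matrices as a graph over the upper left 3 × 3 block and the last column. -/

section Chart

/-- The determinant of the first diagonal block; `s` is its upper left entry. -/
def blockDet (s : ℝ) (z : Fin 8 → ℝ) : ℝ := s * z 1 - z 0 ^ 2

/-- The upper left entry of the Schur complement of the first diagonal block. -/
noncomputable def schurDiag (s : ℝ) (z : Fin 8 → ℝ) : ℝ :=
  z 6 - (z 1 * z 2 ^ 2 - 2 * z 0 * z 2 * z 3 + s * z 3 ^ 2) / blockDet s z

/-- The off-diagonal entry of the Schur complement of the first diagonal block. -/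
noncomputable def schurOff (s : ℝ) (z : Fin 8 → ℝ) : ℝ :=
  z 7 - (z 1 * z 2 * z 4 - z 0 * (z 2 * z 5 + z 3 * z 4) + s * z 3 * z 5) / blockDet s z

/-- The value of the last diagonal entry that makes the matrix singular. -/
noncomputable def lastDiag (s : ℝ) (z : Fin 8 → ℝ) : ℝ :=
  (z 1 * z 4 ^ 2 - 2 * z 0 * z 4 * z 5 + s * z 5 ^ 2) / blockDet s z +
    schurOff s z ^ 2 / schurDiag s z

/-- The upper left `3 × 3` block is positive definite. -/
def MinorsPos (s : ℝ) (z : Fin 8 → ℝ) : Prop := 0 < s ∧ 0 < blockDet s z ∧ 0 < schurDiag s z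

/-- The coordinates of the singular matrix with given upper left `3 × 3` block and last column. -/
noncomputable def coneCoord (s : ℝ) (z : Fin 8 → ℝ) : Fin 8 ⊕ Fin 2 → ℝ :=
  Sum.elim z ![s, lastDiag s z]

/-- The trace of the singular matrix with given entries. -/
noncomputable def coneTrace (s : ℝ) (z : Fin 8 → ℝ) : ℝ := s + z 1 + z 6 + lastDiag s z

/-- The null vector of the singular matrix with last coordinate `1`. -/
noncomputable def nullVec (s : ℝ) (z : Fin 8 → ℝ) : Fin 4 → ℝ :=
  let v3 := -(schurOff s z / schurDiag s z)
  ![-((z 1 * (z 2 * v3 + z 4) - z 0 * (z 3 * v3 + z 5)) / blockDet s z),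
    -((-z 0 * (z 2 * v3 + z 4) + s * (z 3 * v3 + z 5)) / blockDet s z), v3, 1]

/-- Gaussian elimination. `MinorsPos` makes the first three pivots positive, so semidefiniteness and
singularity are decided by the last pivot `d - lastDiag s z`. -/
theorem symForm_eq_sum_sq {s : ℝ} {z : Fin 8 → ℝ} (h : MinorsPos s z) (d x1 x2 x3 x4 : ℝ) :
    symForm (Sum.elim z ![s, d]) x1 x2 x3 x4 =
      s * (x1 + (z 0 * x2 + z 2 * x3 + z 4 * x4) / s) ^ 2
        + blockDet s z / s * (x2 + ((s * z 3 - z 0 * z 2) * x3 + (s * z 5 - z 0 * z 4) * x4) /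
          blockDet s z) ^ 2
        + schurDiag s z * (x3 + schurOff s z / schurDiag s z * x4) ^ 2
        + (d - lastDiag s z) * x4 ^ 2 := by
  obtain ⟨h1, h2, h3⟩ := h
  have e1 : schurDiag s z * (x3 + schurOff s z / schurDiag s z * x4) ^ 2 =
      schurDiag s z * x3 ^ 2 + 2 * schurOff s z * x3 * x4
        + schurOff s z ^ 2 / schurDiag s z * x4 ^ 2 := by
    field_simp
    ring
  rw [e1, lastDiag]
  simp only [symForm, Sum.elim_inl, Sum.elim_inr, Matrix.cons_val_zero, Matrix.cons_val_one]
  rw [show schurDiag s z =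
      z 6 - (z 1 * z 2 ^ 2 - 2 * z 0 * z 2 * z 3 + s * z 3 ^ 2) / blockDet s z from rfl]
  set w := schurOff s z ^ 2 / _
  rw [show schurOff s z = z 7 - (z 1 * z 2 * z 4 - z 0 * (z 2 * z 5 + z 3 * z 4) + s * z 3 * z 5)
    / blockDet s z from rfl]
  have hz : z 1 = (blockDet s z + z 0 ^ 2) / s := by
    rw [blockDet]; field_simp; ring
  set D := blockDet s z
  rw [hz]
  field_simp
  ring

theorem symForm_coneCoord {s : ℝ} {z : Fin 8 → ℝ} (h : MinorsPos s z) (x1 x2 x3 x4 : ℝ) :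
    symForm (coneCoord s z) x1 x2 x3 x4 =
      s * (x1 + (z 0 * x2 + z 2 * x3 + z 4 * x4) / s) ^ 2
        + blockDet s z / s * (x2 + ((s * z 3 - z 0 * z 2) * x3 + (s * z 5 - z 0 * z 4) * x4) /
          blockDet s z) ^ 2
        + schurDiag s z * (x3 + schurOff s z / schurDiag s z * x4) ^ 2 := by
  rw [coneCoord, symForm_eq_sum_sq h]
  ring

theorem symForm_coneCoord_nonneg {s : ℝ} {z : Fin 8 → ℝ} (h : MinorsPos s z) (x1 x2 x3 x4 : ℝ) :
    0 ≤ symForm (coneCoord s z) x1 x2 x3 x4 := by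
  rw [symForm_coneCoord h]
  obtain ⟨h1, h2, h3⟩ := h
  positivity

/-- `nullVec` solves the triangular system that makes the three squares of `symForm_coneCoord`
vanish, starting from last coordinate 1. -/
theorem symForm_coneCoord_nullVec {s : ℝ} {z : Fin 8 → ℝ} (h : MinorsPos s z) :
    symForm (coneCoord s z) (nullVec s z 0) (nullVec s z 1) (nullVec s z 2) (nullVec s z 3) = 0 := by
  rw [symForm_coneCoord h]
  obtain ⟨h1, h2, h3⟩ := h
  have hz : z 1 = (blockDet s z + z 0 ^ 2) / s := by
    rw [blockDet]; field_simp; ring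
  have e1 : nullVec s z 2 + schurOff s z / schurDiag s z * nullVec s z 3 = 0 := by
    simp [nullVec]
  have e2 : nullVec s z 1 + ((s * z 3 - z 0 * z 2) * nullVec s z 2 +
      (s * z 5 - z 0 * z 4) * nullVec s z 3) / blockDet s z = 0 := by
    simp only [nullVec, Matrix.cons_val]
    ring
  have e3 : nullVec s z 0 + (z 0 * nullVec s z 1 + z 2 * nullVec s z 2 + z 4 * nullVec s z 3) / s
      = 0 := by
    simp only [nullVec, Matrix.cons_val]
    set D := blockDet s z
    set v := schurOff s z / schurDiag s z
    rw [hz]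
    field_simp
    ring
  rw [e1, e2, e3]
  ring

end Chart

/-! ### Homogeneity of the cone and the image of the chart. -/

section ChartImage

theorem coneTrace_pos {s : ℝ} {z : Fin 8 → ℝ} (h : MinorsPos s z) : 0 < coneTrace s z := by
  have h2 := symForm_coneCoord_nonneg h 0 1 0 0
  have h3 := symForm_coneCoord_nonneg h 0 0 1 0
  have h4 := symForm_coneCoord_nonneg h 0 0 0 1
  simp [symForm, coneCoord] at h2 h3 h4
  have := h.1
  rw [coneTrace]
  linarith

theorem blockDet_smul (t s : ℝ) (z : Fin 8 → ℝ) :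
    blockDet (t * s) (t • z) = t ^ 2 * blockDet s z := by
  simp [blockDet]; ring

theorem schurDiag_smul {t : ℝ} (ht : t ≠ 0) (s : ℝ) (z : Fin 8 → ℝ) :
    schurDiag (t * s) (t • z) = t * schurDiag s z := by
  rw [schurDiag, blockDet_smul, schurDiag]
  simp only [Pi.smul_apply, smul_eq_mul]
  by_cases h : blockDet s z = 0
  · simp [h]
  · field_simp

theorem schurOff_smul {t : ℝ} (ht : t ≠ 0) (s : ℝ) (z : Fin 8 → ℝ) :
    schurOff (t * s) (t • z) = t * schurOff s z := by
  rw [schurOff, blockDet_smul, schurOff]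
  simp only [Pi.smul_apply, smul_eq_mul]
  by_cases h : blockDet s z = 0
  · simp [h]
  · field_simp

theorem lastDiag_smul {t : ℝ} (ht : t ≠ 0) (s : ℝ) (z : Fin 8 → ℝ) :
    lastDiag (t * s) (t • z) = t * lastDiag s z := by
  rw [lastDiag, blockDet_smul, schurOff_smul ht, schurDiag_smul ht, lastDiag, mul_add]
  simp only [Pi.smul_apply, smul_eq_mul]
  congr 1
  · by_cases h : blockDet s z = 0
    · simp [h]
    · field_simp
  · by_cases h : schurDiag s z = 0
    · simp [h]
    · field_simp

theorem minorsPos_smul {t : ℝ} (ht : 0 < t) {s : ℝ} {z : Fin 8 → ℝ} :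
    MinorsPos (t * s) (t • z) ↔ MinorsPos s z := by
  rw [MinorsPos, MinorsPos, blockDet_smul, schurDiag_smul ht.ne', mul_pos_iff_of_pos_left ht,
    mul_pos_iff_of_pos_left ht, mul_pos_iff_of_pos_left (by positivity)]

theorem coneCoord_smul {t : ℝ} (ht : t ≠ 0) (s : ℝ) (z : Fin 8 → ℝ) :
    coneCoord (t * s) (t • z) = t • coneCoord s z := by
  rw [coneCoord, lastDiag_smul ht, coneCoord]
  ext k
  rcases k with k | k
  · simp
  · fin_cases k <;> simp

theorem coneTrace_smul {t : ℝ} (ht : t ≠ 0) (s : ℝ) (z : Fin 8 → ℝ) :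
    coneTrace (t * s) (t • z) = t * coneTrace s z := by
  rw [coneTrace, lastDiag_smul ht, coneTrace]
  simp only [Pi.smul_apply, smul_eq_mul]
  ring

theorem symOf_smul (t : ℝ) (c : Fin 8 ⊕ Fin 2 → ℝ) : symOf (t • c) = t • symOf c := rfl

/-- The singular states of unit trace, parametrized by the ratios of the entries to the first
diagonal entry. -/
noncomputable def boundaryChart (z : EuclideanSpace ℝ (Fin 8)) : HSSpace :=
  symOf ((coneTrace 1 z)⁻¹ • coneCoord 1 z)

/-- The domain of the chart of the singular states. -/
def chartDomain : Set (EuclideanSpace ℝ (Fin 8)) := {z | MinorsPos 1 z}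

/-- The minimally degenerate states as points of the Hilbert-Schmidt space. -/
def boundaryStates : Set HSSpace := {x : HSSpace | x.toMatrix ∈ minimallyDegenerateStates}

/-- The symmetric matrices with positive definite upper left `3 × 3` block. -/
def minorsPosSet : Set HSSpace :=
  {x | MinorsPos (x ((0, 0), (0, 0))) ![x ((0, 0), (0, 1)), x ((0, 1), (0, 1)),
    x ((0, 0), (1, 0)), x ((0, 1), (1, 0)), x ((0, 0), (1, 1)), x ((0, 1), (1, 1)),
    x ((1, 0), (1, 0)), x ((1, 0), (1, 1))]}

theorem symOf_mem_minorsPosSet {c : Fin 8 ⊕ Fin 2 → ℝ} :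
    symOf c ∈ minorsPosSet ↔ MinorsPos (c (.inr 0)) fun i => c (.inl i) := by
  simp [minorsPosSet, symOf, symIndex]
  rw [show (fun i => c (.inl i)) = ![c (.inl 0), c (.inl 1), c (.inl 2), c (.inl 3), c (.inl 4),
    c (.inl 5), c (.inl 6), c (.inl 7)] by ext i; fin_cases i <;> rfl]

theorem symOf_coneCoord_mem {s : ℝ} {z : Fin 8 → ℝ} (h : MinorsPos s z) (ht : coneTrace s z = 1) :
    symOf (coneCoord s z) ∈ boundaryStates := by
  refine ⟨⟨?_, ?_⟩, ?_⟩
  · refine .of_dotProduct_mulVec_nonneg (isHermitian_symOf _) fun x => ?_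
    rw [star_trivial, dotProduct_mulVec_symOf]
    exact symForm_coneCoord_nonneg h _ _ _ _
  · rw [trace_symOf, ← ht]
    simp [coneCoord, coneTrace]
  · set v : Fin 2 × Fin 2 → ℝ := fun i => nullVec s z (![![0, 1], ![2, 3]] i.1 i.2) with hv
    have hpsd : (symOf (coneCoord s z)).toMatrix.PosSemidef :=
      .of_dotProduct_mulVec_nonneg (isHermitian_symOf _) fun x => by
        rw [star_trivial, dotProduct_mulVec_symOf]
        exact symForm_coneCoord_nonneg h _ _ _ _
    refine ⟨v, fun h0 => ?_, ?_⟩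
    · have := congrFun h0 (1, 1)
      simp [hv, nullVec] at this
    · rw [← hpsd.dotProduct_mulVec_zero_iff, star_trivial, dotProduct_mulVec_symOf]
      simpa [hv] using symForm_coneCoord_nullVec h

/-- Evaluating the form at `nullVec` isolates the last pivot, which is therefore nonnegative. Were
it positive, all four pivots would be, and no nonzero null vector could exist. -/
theorem eq_coneCoord_of_mem {c : Fin 8 ⊕ Fin 2 → ℝ} (hc : symOf c ∈ boundaryStates)
    (h : MinorsPos (c (.inr 0)) fun i => c (.inl i)) :
    c = coneCoord (c (.inr 0)) fun i => c (.inl i) := by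
  set s := c (.inr 0) with hs
  set z : Fin 8 → ℝ := fun i => c (.inl i) with hz
  have hcs : c = Sum.elim z ![s, c (.inr 1)] := by
    ext k
    rcases k with k | k
    · rfl
    · fin_cases k <;> rfl
  obtain ⟨⟨hpsd, -⟩, w, hw, hw0⟩ := hc
  have hform := symForm_eq_sum_sq h (c (.inr 1))
  rw [← hcs] at hform
  have hge : lastDiag s z ≤ c (.inr 1) := by
    have h1 := hpsd.dotProduct_mulVec_nonneg
      fun i => nullVec s z (![![0, 1], ![2, 3]] i.1 i.2)
    rw [star_trivial, dotProduct_mulVec_symOf] at h1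
    have h2 := symForm_coneCoord_nullVec h
    rw [symForm_coneCoord h] at h2
    simp only [Matrix.cons_val_zero, Matrix.cons_val_one] at h1
    rw [hform, h2, zero_add] at h1
    simpa [nullVec] using h1
  have hle : ¬ lastDiag s z < c (.inr 1) := by
    intro hlt
    apply hw
    have h1 : w ⬝ᵥ ((symOf c).toMatrix *ᵥ w) = 0 := by rw [hw0, dotProduct_zero]
    rw [dotProduct_mulVec_symOf, hform] at h1
    obtain ⟨p1, p2, p3⟩ := h
    have p4 : 0 < c (.inr 1) - lastDiag s z := sub_pos.2 hlt
    have p5 : 0 < blockDet s z / s := div_pos p2 p1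
    have q1 := mul_nonneg p1.le (sq_nonneg (w (0, 0) +
      (z 0 * w (0, 1) + z 2 * w (1, 0) + z 4 * w (1, 1)) / s))
    have q2 := mul_nonneg p5.le (sq_nonneg (w (0, 1) + ((s * z 3 - z 0 * z 2) * w (1, 0) +
      (s * z 5 - z 0 * z 4) * w (1, 1)) / blockDet s z))
    have q3 := mul_nonneg p3.le (sq_nonneg (w (1, 0) + schurOff s z / schurDiag s z * w (1, 1)))
    have q4 := mul_nonneg p4.le (sq_nonneg (w (1, 1)))
    have r4 : w (1, 1) = 0 := by
      have : (c (.inr 1) - lastDiag s z) * w (1, 1) ^ 2 = 0 := by linarith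
      simpa [p4.ne'] using this
    have r3 : w (1, 0) = 0 := by
      have : schurDiag s z * (w (1, 0) + schurOff s z / schurDiag s z * w (1, 1)) ^ 2 = 0 := by
        linarith
      simpa [p3.ne', r4] using this
    have r2 : w (0, 1) = 0 := by
      have : blockDet s z / s * (w (0, 1) + ((s * z 3 - z 0 * z 2) * w (1, 0) +
        (s * z 5 - z 0 * z 4) * w (1, 1)) / blockDet s z) ^ 2 = 0 := by linarith
      simpa [p1.ne', p2.ne', r4, r3] using this
    have r1 : w (0, 0) = 0 := by
      have : s * (w (0, 0) + (z 0 * w (0, 1) + z 2 * w (1, 0) + z 4 * w (1, 1)) / s) ^ 2 = 0 := by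
        linarith
      simpa [p1.ne', r4, r3, r2] using this
    ext ⟨i, j⟩
    fin_cases i <;> fin_cases j <;> simp [r1, r2, r3, r4]
  calc c = Sum.elim z ![s, c (.inr 1)] := hcs
    _ = _ := by rw [le_antisymm (not_lt.1 hle) hge]; rfl

theorem boundaryChart_eq {z : EuclideanSpace ℝ (Fin 8)} (hz : z ∈ chartDomain) :
    boundaryChart z = symOf (coneCoord (coneTrace 1 z)⁻¹ ((coneTrace 1 z)⁻¹ • (z : Fin 8 → ℝ))) := by
  have h := inv_ne_zero (coneTrace_pos hz).ne'
  rw [boundaryChart, ← coneCoord_smul h, mul_one]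

/-- A state in the image is recovered by dividing by its first diagonal entry; unit trace then fixes
the scaling factor. -/
theorem image_boundaryChart : boundaryChart '' chartDomain = boundaryStates ∩ minorsPosSet := by
  ext x
  constructor
  · rintro ⟨z, hz, rfl⟩
    have hp := coneTrace_pos hz
    have h := inv_pos.2 hp
    have hpos : MinorsPos (coneTrace 1 z)⁻¹ ((coneTrace 1 z)⁻¹ • (z : Fin 8 → ℝ)) := by
      have := (minorsPos_smul h (s := 1) (z := z)).2 hz
      rwa [mul_one] at this
    rw [boundaryChart_eq hz]
    refine ⟨symOf_coneCoord_mem hpos ?_, ?_⟩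
    · have := coneTrace_smul h.ne' 1 z
      rwa [mul_one, inv_mul_cancel₀ hp.ne'] at this
    · rw [symOf_mem_minorsPosSet]
      exact hpos
  · rintro ⟨hx, hm⟩
    obtain ⟨c, rfl⟩ := exists_eq_symOf hx.1.1.1
    rw [symOf_mem_minorsPosSet] at hm
    have hc := eq_coneCoord_of_mem hx hm
    set s := c (.inr 0) with hs
    set z : Fin 8 → ℝ := fun i => c (.inl i) with hz
    have hs0 := hm.1
    have htr : coneTrace s z = 1 := by
      have := hx.1.2
      rw [trace_symOf, hc] at this
      simpa [coneCoord, coneTrace] using this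
    have hsz : coneTrace 1 (s⁻¹ • z) = s⁻¹ := by
      have := coneTrace_smul (inv_ne_zero hs0.ne') s z
      rwa [inv_mul_cancel₀ hs0.ne', htr, mul_one] at this
    have hdom : WithLp.toLp 2 (s⁻¹ • z) ∈ chartDomain := by
      have := (minorsPos_smul (inv_pos.2 hs0) (s := s) (z := z)).2 hm
      rwa [inv_mul_cancel₀ hs0.ne'] at this
    refine ⟨WithLp.toLp 2 (s⁻¹ • z), hdom, ?_⟩
    rw [boundaryChart_eq hdom]
    change symOf (coneCoord (coneTrace 1 (s⁻¹ • z))⁻¹ ((coneTrace 1 (s⁻¹ • z))⁻¹ • s⁻¹ • z)) = _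
    rw [hsz, inv_inv, smul_smul, mul_inv_cancel₀ hs0.ne', one_smul, ← hc]

end ChartImage

/-! ### Gram determinants from normal vectors. -/

section GramDeterminant

/-- The Gram determinant of columns `A` in terms of a basis of normal vectors `N` and any
complementary vectors `R`. -/
theorem det_transpose_mul_mul_of_normal {m n : Type*} [Fintype m] [DecidableEq m] [Fintype n]
    [DecidableEq n] (A : Matrix (m ⊕ n) m ℝ) (N R : Matrix (m ⊕ n) n ℝ)
    (W : Matrix (m ⊕ n) (m ⊕ n) ℝ) (hW : Wᵀ = W) (hN : Nᵀ * W * A = 0)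
    (hA : (Aᵀ * W * A).det ≠ 0) :
    (Aᵀ * W * A).det * (Nᵀ * W * R).det ^ 2 =
      (Nᵀ * W * N).det * W.det * (Matrix.fromCols A R).det ^ 2 := by
  have hN' : Aᵀ * W * N = 0 := by
    have := congrArg Matrix.transpose hN
    simpa [Matrix.transpose_mul, hW, Matrix.mul_assoc] using this
  -- Orthogonality makes one product block diagonal and the other block triangular. Together they
  -- eliminate the unknown determinant of the columns `A`, `N`.
  have h1 : (Matrix.fromCols A N)ᵀ * W * Matrix.fromCols A N =
      Matrix.fromBlocks (Aᵀ * W * A) 0 0 (Nᵀ * W * N) := by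
    rw [Matrix.transpose_fromCols, Matrix.fromRows_mul, Matrix.fromRows_mul_fromCols, hN, hN']
  have h2 : (Matrix.fromCols A N)ᵀ * W * Matrix.fromCols A R =
      Matrix.fromBlocks (Aᵀ * W * A) (Aᵀ * W * R) 0 (Nᵀ * W * R) := by
    rw [Matrix.transpose_fromCols, Matrix.fromRows_mul, Matrix.fromRows_mul_fromCols, hN]
  have d1 := congrArg Matrix.det h1
  have d2 := congrArg Matrix.det h2
  rw [Matrix.det_mul, Matrix.det_mul, Matrix.det_transpose, Matrix.det_fromBlocks_zero₂₁] at d1 d2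
  apply mul_left_cancel₀ hA
  calc _ = ((Aᵀ * W * A).det * (Nᵀ * W * R).det) ^ 2 := by ring
    _ = ((Matrix.fromCols A N).det * W.det * (Matrix.fromCols A N).det) * W.det *
        (Matrix.fromCols A R).det ^ 2 := by rw [← d2]; ring
    _ = _ := by rw [d1]; ring

end GramDeterminant

/-! ### The Jacobian of the chart. -/

section ChartDerivative

/-- The coordinates of the chart of the singular states. -/
noncomputable def chartCoord (z : EuclideanSpace ℝ (Fin 8)) : Fin 8 ⊕ Fin 2 → ℝ :=
  (coneTrace 1 z)⁻¹ • coneCoord 1 z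

theorem continuous_blockDet : Continuous fun z : EuclideanSpace ℝ (Fin 8) => blockDet 1 z := by
  unfold blockDet
  fun_prop

theorem contDiffAt_schurDiag {z : EuclideanSpace ℝ (Fin 8)} (hz : blockDet 1 z ≠ 0) :
    ContDiffAt ℝ 1 (fun z : EuclideanSpace ℝ (Fin 8) => schurDiag 1 z) z := by
  unfold schurDiag
  unfold blockDet at hz ⊢
  fun_prop (disch := assumption)

theorem contDiffAt_lastDiag {z : EuclideanSpace ℝ (Fin 8)} (hz : z ∈ chartDomain) :
    ContDiffAt ℝ 1 (fun z : EuclideanSpace ℝ (Fin 8) => lastDiag 1 z) z := by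
  have h1 := hz.2.1.ne'
  have h2 := hz.2.2.ne'
  have h3 := contDiffAt_schurDiag h1
  unfold lastDiag schurOff
  unfold blockDet at h1 ⊢
  fun_prop (disch := assumption)

theorem contDiffAt_coneTrace {z : EuclideanSpace ℝ (Fin 8)} (hz : z ∈ chartDomain) :
    ContDiffAt ℝ 1 (fun z : EuclideanSpace ℝ (Fin 8) => coneTrace 1 z) z := by
  have := contDiffAt_lastDiag hz
  unfold coneTrace
  fun_prop

theorem contDiffAt_chartCoord {z : EuclideanSpace ℝ (Fin 8)} (hz : z ∈ chartDomain) :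
    ContDiffAt ℝ 1 chartCoord z := by
  have h1 := contDiffAt_coneTrace hz
  have h2 := contDiffAt_lastDiag hz
  have h3 := (coneTrace_pos hz).ne'
  refine contDiffAt_pi.2 fun k => ?_
  rcases k with k | k
  · have : (fun z : EuclideanSpace ℝ (Fin 8) => chartCoord z (.inl k)) =
        fun z : EuclideanSpace ℝ (Fin 8) => (coneTrace 1 z)⁻¹ * z k := by
      ext; simp [chartCoord, coneCoord]
    rw [this]
    fun_prop (disch := assumption)
  · fin_cases k
    · have : (fun z : EuclideanSpace ℝ (Fin 8) => chartCoord z (.inr 0)) =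
          fun z : EuclideanSpace ℝ (Fin 8) => (coneTrace 1 z)⁻¹ := by
        ext; simp [chartCoord, coneCoord]
      simp only [Fin.zero_eta, this]
      fun_prop (disch := assumption)
    · have : (fun z : EuclideanSpace ℝ (Fin 8) => chartCoord z (.inr 1)) =
          fun z : EuclideanSpace ℝ (Fin 8) => (coneTrace 1 z)⁻¹ * lastDiag 1 z := by
        ext; simp [chartCoord, coneCoord]
      simp only [Fin.mk_one, this]
      fun_prop (disch := assumption)

theorem isOpen_chartDomain : IsOpen chartDomain := by
  rw [isOpen_iff_mem_nhds]
  rintro z ⟨h1, h2, h3⟩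
  have e2 : ∀ᶠ y : EuclideanSpace ℝ (Fin 8) in nhds z, 0 < blockDet 1 y :=
    continuous_blockDet.continuousAt.eventually_const_lt h2
  have e3 : ∀ᶠ y : EuclideanSpace ℝ (Fin 8) in nhds z, 0 < schurDiag 1 y :=
    (contDiffAt_schurDiag h2.ne').continuousAt.eventually_const_lt h3
  filter_upwards [e2, e3] with y h4 h5 using ⟨h1, h4, h5⟩

/-- The linear map from coordinates to symmetric matrices. -/
noncomputable def symOfL : (Fin 8 ⊕ Fin 2 → ℝ) →L[ℝ] HSSpace :=
  LinearMap.toContinuousLinearMap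
    { toFun := symOf
      map_add' := fun _ _ => rfl
      map_smul' := fun _ _ => rfl }

/-- The derivative of the chart. -/
noncomputable def chartDeriv (z : EuclideanSpace ℝ (Fin 8)) :
    EuclideanSpace ℝ (Fin 8) →L[ℝ] HSSpace :=
  symOfL.comp (fderiv ℝ chartCoord z)

theorem hasStrictFDerivAt_chartCoord {z : EuclideanSpace ℝ (Fin 8)} (hz : z ∈ chartDomain) :
    HasStrictFDerivAt chartCoord (fderiv ℝ chartCoord z) z :=
  (contDiffAt_chartCoord hz).hasStrictFDerivAt one_ne_zero

theorem hasStrictFDerivAt_boundaryChart {z : EuclideanSpace ℝ (Fin 8)} (hz : z ∈ chartDomain) :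
    HasStrictFDerivAt boundaryChart (chartDeriv z) z :=
  symOfL.hasStrictFDerivAt.comp z (hasStrictFDerivAt_chartCoord hz)

/-- The matrix of the derivative of the coordinates of the chart. -/
noncomputable def chartJacobian (z : EuclideanSpace ℝ (Fin 8)) :
    Matrix (Fin 8 ⊕ Fin 2) (Fin 8) ℝ :=
  Matrix.of fun k j => fderiv ℝ chartCoord z (EuclideanSpace.single j 1) k

/-- A linear functional of the coordinates that has a local minimum at a point of the chart
annihilates the derivative. -/
theorem sum_mul_chartJacobian_eq_zero {z : EuclideanSpace ℝ (Fin 8)} (hz : z ∈ chartDomain)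
    (a : Fin 8 ⊕ Fin 2 → ℝ)
    (hmin : ∀ y ∈ chartDomain, ∑ k, a k * chartCoord z k ≤ ∑ k, a k * chartCoord y k) (j : Fin 8) :
    ∑ k, a k * chartJacobian z k j = 0 := by
  have h := (hasStrictFDerivAt_chartCoord hz).hasFDerivAt
  have h1 : HasFDerivAt (fun y => ∑ k, a k * chartCoord y k)
      (∑ k, a k • (ContinuousLinearMap.proj k).comp (fderiv ℝ chartCoord z)) z :=
    HasFDerivAt.fun_sum fun k _ => ((hasFDerivAt_pi'.1 h) k).const_mul (a k)
  have h2 : IsLocalMin (fun y => ∑ k, a k * chartCoord y k) z := by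
    filter_upwards [isOpen_chartDomain.mem_nhds hz] with y hy using hmin y hy
  have h3 := h2.hasFDerivAt_eq_zero h1
  have h4 := congrArg (fun L : EuclideanSpace ℝ (Fin 8) →L[ℝ] ℝ => L (EuclideanSpace.single j 1)) h3
  simpa [sum_apply, chartJacobian] using h4

/-- Product rule for `chartCoord y (.inr 0) * y i`. Injectivity and the determinant of the Jacobian
follow from it, so the derivatives of the trace and of `lastDiag` never have to be computed. -/
theorem fderiv_chartCoord_inl {z : EuclideanSpace ℝ (Fin 8)} (hz : z ∈ chartDomain) (i : Fin 8)
    (v : EuclideanSpace ℝ (Fin 8)) :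
    fderiv ℝ chartCoord z v (.inl i) =
      (coneTrace 1 z)⁻¹ * v i + z i * fderiv ℝ chartCoord z v (.inr 0) := by
  have h := (hasStrictFDerivAt_chartCoord hz).hasFDerivAt
  have h0 := (hasFDerivAt_pi'.1 h) (.inr 0)
  have h1 := (hasFDerivAt_pi'.1 h) (.inl i)
  have h2 : HasFDerivAt (fun y : EuclideanSpace ℝ (Fin 8) => y i)
      (EuclideanSpace.proj i : EuclideanSpace ℝ (Fin 8) →L[ℝ] ℝ) z :=
    (EuclideanSpace.proj i : EuclideanSpace ℝ (Fin 8) →L[ℝ] ℝ).hasFDerivAt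
  have h3 := h0.mul h2
  have h4 : (fun y : EuclideanSpace ℝ (Fin 8) => chartCoord y (.inl i)) =
      fun y => chartCoord y (.inr 0) * y i := by
    ext; simp [chartCoord, coneCoord]
  rw [h4] at h1
  have h5 := h1.unique h3
  have h6 := congrArg (fun L : EuclideanSpace ℝ (Fin 8) →L[ℝ] ℝ => L v) h5
  have h7 : chartCoord z (.inr 0) = (coneTrace 1 z)⁻¹ := by simp [chartCoord, coneCoord]
  simpa [h7] using h6

theorem injective_chartDeriv {z : EuclideanSpace ℝ (Fin 8)} (hz : z ∈ chartDomain) :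
    Function.Injective (chartDeriv z) := by
  rw [injective_iff_map_eq_zero]
  intro v hv
  have hc : ∀ k, fderiv ℝ chartCoord z v k = 0 := by
    have h : ∀ i j, fderiv ℝ chartCoord z v (symIndex i j) = 0 := fun i j =>
      congrArg (fun x : HSSpace => x (i, j)) hv
    intro k
    rcases k with k | k
    · fin_cases k
      exacts [h (0, 0) (0, 1), h (0, 1) (0, 1), h (0, 0) (1, 0), h (0, 1) (1, 0), h (0, 0) (1, 1),
        h (0, 1) (1, 1), h (1, 0) (1, 0), h (1, 0) (1, 1)]
    · fin_cases k
      exacts [h (0, 0) (0, 0), h (1, 1) (1, 1)]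
  ext i
  have h1 := fderiv_chartCoord_inl hz i v
  rw [hc, hc, mul_zero, add_zero] at h1
  simpa [(coneTrace_pos hz).ne'] using h1.symm

/-- The coordinates of the identity matrix and of the projection to the null vector. -/
noncomputable def normalVecs (z : Fin 8 → ℝ) : Matrix (Fin 8 ⊕ Fin 2) (Fin 2) ℝ :=
  let v := nullVec 1 z
  Matrix.of fun k => ![(Sum.elim ![0, 1, 0, 0, 0, 0, 1, 0] ![1, 1] : Fin 8 ⊕ Fin 2 → ℝ) k,
    (Sum.elim ![v 0 * v 1, v 1 ^ 2, v 0 * v 2, v 1 * v 2, v 0 * v 3, v 1 * v 3, v 2 ^ 2, v 2 * v 3]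
      ![v 0 ^ 2, v 3 ^ 2] : Fin 8 ⊕ Fin 2 → ℝ) k]

/-- The radial direction and the direction of the last diagonal entry. -/
noncomputable def transversalVecs (z : EuclideanSpace ℝ (Fin 8)) : Matrix (Fin 8 ⊕ Fin 2) (Fin 2) ℝ :=
  Matrix.of fun k => ![chartCoord z k, (Sum.elim 0 ![0, 1] : Fin 8 ⊕ Fin 2 → ℝ) k]

/-- The squared norm of the null vector with last coordinate `1`. -/
noncomputable def nullNormSq (s : ℝ) (z : Fin 8 → ℝ) : ℝ := ∑ i, nullVec s z i ^ 2

theorem sum_normalVecs_zero (z : Fin 8 → ℝ) (c : Fin 8 ⊕ Fin 2 → ℝ) :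
    ∑ k, normalVecs z k 0 * symWeight k * c k =
      c (.inr 0) + c (.inl 1) + c (.inl 6) + c (.inr 1) := by
  simp [normalVecs, symWeight, Fin.sum_univ_eight]
  ring

theorem sum_normalVecs_one (z : Fin 8 → ℝ) (c : Fin 8 ⊕ Fin 2 → ℝ) :
    ∑ k, normalVecs z k 1 * symWeight k * c k =
      symForm c (nullVec 1 z 0) (nullVec 1 z 1) (nullVec 1 z 2) (nullVec 1 z 3) := by
  simp [normalVecs, symWeight, Fin.sum_univ_eight, symForm]
  ring

theorem sum_normalVecs_zero_chartCoord {z : EuclideanSpace ℝ (Fin 8)} (hz : z ∈ chartDomain)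
    (w : Fin 8 → ℝ) : ∑ k, normalVecs w k 0 * symWeight k * chartCoord z k = 1 := by
  rw [sum_normalVecs_zero]
  have := (coneTrace_pos hz).ne'
  simp only [chartCoord, coneCoord, Pi.smul_apply, Sum.elim_inr, Sum.elim_inl, smul_eq_mul,
    Matrix.cons_val_zero, Matrix.cons_val_one]
  rw [← mul_add, ← mul_add, ← mul_add, ← coneTrace, inv_mul_cancel₀ this]

theorem symForm_smul (t : ℝ) (c : Fin 8 ⊕ Fin 2 → ℝ) (x1 x2 x3 x4 : ℝ) :
    symForm (t • c) x1 x2 x3 x4 = t * symForm c x1 x2 x3 x4 := by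
  simp [symForm]; ring

/-- Pairing with the identity gives the trace, which is constant. Pairing with v vᵀ gives the
quadratic form at v, which is nonnegative on the whole chart and zero at the point itself. Both are
local minima there. -/
theorem normalVecs_mul_chartJacobian {z : EuclideanSpace ℝ (Fin 8)} (hz : z ∈ chartDomain) :
    (normalVecs z)ᵀ * Matrix.diagonal symWeight * chartJacobian z = 0 := by
  ext i j
  rw [Matrix.mul_apply]
  simp only [Matrix.mul_diagonal, Matrix.transpose_apply, Matrix.zero_apply]
  refine sum_mul_chartJacobian_eq_zero hz (fun k => normalVecs z k i * symWeight k)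
    (fun y hy => ?_) j
  fin_cases i
  · simp only [Fin.zero_eta]
    rw [sum_normalVecs_zero_chartCoord hz, sum_normalVecs_zero_chartCoord hy]
  · simp only [Fin.mk_one]
    rw [sum_normalVecs_one, sum_normalVecs_one, chartCoord, chartCoord, symForm_smul, symForm_smul,
      symForm_coneCoord_nullVec hz, mul_zero]
    exact mul_nonneg (inv_pos.2 (coneTrace_pos hy)).le (symForm_coneCoord_nonneg hy _ _ _ _)

/-- The inner products of the identity and v vᵀ are 4, |v|² and |v|⁴, and 4|v|⁴ - |v|⁴ = 3|v|⁴. -/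
theorem det_normalVecs (z : Fin 8 → ℝ) :
    ((normalVecs z)ᵀ * Matrix.diagonal symWeight * normalVecs z).det = 3 * nullNormSq 1 z ^ 2 := by
  have h (i j : Fin 2) : ((normalVecs z)ᵀ * Matrix.diagonal symWeight * normalVecs z) i j =
      ∑ k, normalVecs z k i * symWeight k * normalVecs z k j := by
    rw [Matrix.mul_apply]
    simp only [Matrix.mul_diagonal, Matrix.transpose_apply]
  rw [Matrix.det_fin_two, h, h, h, h, sum_normalVecs_zero, sum_normalVecs_zero, sum_normalVecs_one,
    sum_normalVecs_one]
  simp [normalVecs, symForm, nullNormSq, Fin.sum_univ_four]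
  ring

theorem det_normalVecs_transversalVecs {z : EuclideanSpace ℝ (Fin 8)} (hz : z ∈ chartDomain) :
    ((normalVecs z)ᵀ * Matrix.diagonal symWeight * transversalVecs z).det = 1 := by
  have h (i j : Fin 2) : ((normalVecs z)ᵀ * Matrix.diagonal symWeight * transversalVecs z) i j =
      ∑ k, normalVecs z k i * symWeight k * transversalVecs z k j := by
    rw [Matrix.mul_apply]
    simp only [Matrix.mul_diagonal, Matrix.transpose_apply]
  have h1 : ∑ k, normalVecs z k 1 * symWeight k * chartCoord z k = 0 := by
    rw [sum_normalVecs_one, chartCoord, symForm_smul, symForm_coneCoord_nullVec hz, mul_zero]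
  rw [Matrix.det_fin_two, h, h, h, h]
  have h2 : ∀ k, transversalVecs z k 0 = chartCoord z k := fun k => rfl
  simp only [h2]
  rw [sum_normalVecs_zero_chartCoord hz, h1, sum_normalVecs_one]
  simp [transversalVecs, symForm, nullVec]

/-- Row operations using the first diagonal coordinate leave τ⁻¹ times the identity in the eight
chart directions; the radial column contributes the ninth factor. -/
theorem det_fromCols_chartJacobian {z : EuclideanSpace ℝ (Fin 8)} (hz : z ∈ chartDomain) :
    (Matrix.fromCols (chartJacobian z) (transversalVecs z)).det = (coneTrace 1 z)⁻¹ ^ 9 := by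
  set τ := coneTrace 1 z with hτ
  set Z : Matrix (Fin 8) (Fin 2) ℝ := Matrix.of fun i => ![z i, 0] with hZ
  set A : Matrix (Fin 2) (Fin 8) ℝ := Matrix.of fun i j => chartJacobian z (.inr i) j with hA
  set R : Matrix (Fin 2) (Fin 2) ℝ := !![τ⁻¹, 0; τ⁻¹ * lastDiag 1 z, 1] with hR
  have h : Matrix.fromCols (chartJacobian z) (transversalVecs z) =
      Matrix.fromBlocks 1 Z 0 1 * Matrix.fromBlocks (τ⁻¹ • (1 : Matrix (Fin 8) (Fin 8) ℝ)) 0 A R := by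
    rw [Matrix.fromBlocks_multiply]
    ext k j
    rcases k with k | k <;> rcases j with j | j
    · have h1 := fderiv_chartCoord_inl hz k (EuclideanSpace.single j 1)
      simp only [Matrix.fromCols_apply_inl, Matrix.fromBlocks_apply₁₁, chartJacobian,
        Matrix.of_apply]
      rw [h1]
      simp [Matrix.mul_apply, hZ, hA, chartJacobian, Matrix.one_apply, hτ]
    · fin_cases j <;> simp [Matrix.mul_apply, hZ, hR, transversalVecs, chartCoord, coneCoord, hτ,
        mul_comm]
    · simp [hA]
    · fin_cases j <;> fin_cases k <;> simp [hR, transversalVecs, chartCoord, coneCoord, hτ]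
  rw [h, Matrix.det_mul, Matrix.det_fromBlocks_zero₂₁, Matrix.det_fromBlocks_zero₁₂]
  simp [hR]
  ring

theorem gram_chartDeriv (z : EuclideanSpace ℝ (Fin 8)) :
    Matrix.gram ℝ (fun j => (chartDeriv z).toLinearMap (EuclideanSpace.basisFun (Fin 8) ℝ j)) =
      (chartJacobian z)ᵀ * Matrix.diagonal symWeight * chartJacobian z := by
  ext i j
  rw [Matrix.mul_apply, Matrix.gram_apply]
  simp only [Matrix.mul_diagonal, Matrix.transpose_apply, EuclideanSpace.basisFun_apply]
  exact inner_symOf _ _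

/-- 192 = 3 · 64: the 3 comes from the normal Gram determinant, and 64 = 2⁶ from the six
off-diagonal entries, each counted twice in the Hilbert–Schmidt norm. -/
theorem normDet_chartDeriv {z : EuclideanSpace ℝ (Fin 8)} (hz : z ∈ chartDomain) :
    (chartDeriv z).toLinearMap.normDet =
      √192 * (nullNormSq 1 z * (coneTrace 1 z)⁻¹ ^ 9) := by
  have hsq := LinearMap.normDet_sq_eq_det_gram (chartDeriv z).toLinearMap
    (EuclideanSpace.basisFun (Fin 8) ℝ)
  rw [gram_chartDeriv] at hsq
  have hne : (chartDeriv z).toLinearMap.normDet ≠ 0 := fun h0 =>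
    LinearMap.normDet_eq_zero_iff_ker_ne_bot.1 h0
      (LinearMap.ker_eq_bot.2 (injective_chartDeriv hz))
  have hdet := det_transpose_mul_mul_of_normal (chartJacobian z) (normalVecs z) (transversalVecs z)
    (Matrix.diagonal symWeight) (Matrix.diagonal_transpose _) (normalVecs_mul_chartJacobian hz)
    (by rw [← hsq]; simpa using hne)
  have hw : (Matrix.diagonal symWeight).det = 64 := by
    rw [Matrix.det_diagonal]
    simp [symWeight, Fin.prod_univ_eight]
    norm_num
  rw [det_normalVecs_transversalVecs hz, det_normalVecs, det_fromCols_chartJacobian hz, hw,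
    ← hsq] at hdet
  have hn : 0 ≤ nullNormSq 1 z := Finset.sum_nonneg fun i _ => sq_nonneg _
  have hτ := inv_pos.2 (coneTrace_pos hz)
  rw [← sq_eq_sq₀ (LinearMap.normDet_nonneg _) (by positivity), mul_pow, Real.sq_sqrt (by norm_num)]
  simp at hdet
  rw [hdet]
  ring

theorem continuousOn_normDet_chartDeriv :
    ContinuousOn (fun z => (chartDeriv z).toLinearMap.normDet) chartDomain := by
  refine ContinuousOn.congr (f := fun z : EuclideanSpace ℝ (Fin 8) =>
    √192 * (nullNormSq 1 z * (coneTrace 1 z)⁻¹ ^ 9)) (fun z hz => ?_) fun z hz => normDet_chartDeriv hz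
  refine ContinuousAt.continuousWithinAt ?_
  have h1 := (contDiffAt_coneTrace hz).continuousAt
  have h2 := (contDiffAt_schurDiag hz.2.1.ne').continuousAt
  have h3 := continuous_blockDet.continuousAt (x := z)
  have h4 := hz.2.1.ne'
  have h5 := hz.2.2.ne'
  have h6 := (coneTrace_pos hz).ne'
  simp only [nullNormSq, nullVec, Fin.sum_univ_four, Matrix.cons_val]
  unfold schurOff
  fun_prop (disch := assumption)

end ChartDerivative

/-! ### States with singular upper left 3 × 3 block have area zero. -/

section NullSet

/-- If a vector is orthogonal to its vector of the Gram-Schmidt basis, all vectors are. -/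
theorem inner_gramSchmidtOrthonormalBasis_eq_zero_of_self {ι E : Type*} [LinearOrder ι] [Fintype ι]
    [LocallyFiniteOrderBot ι] [WellFoundedLT ι] [NormedAddCommGroup E] [InnerProductSpace ℝ E]
    [FiniteDimensional ℝ E] (h : Module.finrank ℝ E = Fintype.card ι) (f : ι → E) (i : ι)
    (hi : inner ℝ (InnerProductSpace.gramSchmidtOrthonormalBasis h f i) (f i) = 0) (j : ι) :
    inner ℝ (InnerProductSpace.gramSchmidtOrthonormalBasis h f i) (f j) = 0 := by
  refine InnerProductSpace.inner_gramSchmidtOrthonormalBasis_eq_zero h ?_ j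
  by_contra hne
  rw [InnerProductSpace.gramSchmidtOrthonormalBasis_apply h hne] at hi
  apply hne
  -- `f i` differs from its Gram–Schmidt vector by a combination of earlier, orthogonal ones. Hence
  -- a vanishing pairing forces that vector to be zero.
  have h1 : inner ℝ (InnerProductSpace.gramSchmidt ℝ f i) (f i) =
      inner ℝ (InnerProductSpace.gramSchmidt ℝ f i) (InnerProductSpace.gramSchmidt ℝ f i) := by
    conv_lhs => rw [InnerProductSpace.gramSchmidt_def'' ℝ f i]
    rw [inner_add_right, inner_sum, Finset.sum_eq_zero, add_zero]
    intro k hk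
    rw [inner_smul_right, InnerProductSpace.gramSchmidt_orthogonal ℝ f (Finset.mem_Iio.1 hk).ne',
      mul_zero]
  rw [InnerProductSpace.gramSchmidtNormed, inner_smul_left, h1] at hi
  rcases mul_eq_zero.1 hi with h2 | h2
  · simp at h2
    simp [InnerProductSpace.gramSchmidtNormed, h2]
  · rw [inner_self_eq_zero] at h2
    simp [InnerProductSpace.gramSchmidtNormed, h2]

open scoped MatrixOrder Matrix.Norms.L2Operator in
/-- Cholesky decomposition of a positive semidefinite symmetric `4 × 4` matrix. -/
theorem exists_cholesky {c : Fin 8 ⊕ Fin 2 → ℝ} (h : (symOf c).toMatrix.PosSemidef) :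
    ∃ l11 l21 l22 l31 l32 l33 l41 l42 l43 l44 : ℝ,
      c = Sum.elim ![l11 * l21, l21 ^ 2 + l22 ^ 2, l11 * l31, l21 * l31 + l22 * l32, l11 * l41,
        l21 * l41 + l22 * l42, l31 ^ 2 + l32 ^ 2 + l33 ^ 2, l31 * l41 + l32 * l42 + l33 * l43]
        ![l11 ^ 2, l41 ^ 2 + l42 ^ 2 + l43 ^ 2 + l44 ^ 2] ∧
      (l11 = 0 → l21 = 0 ∧ l31 = 0 ∧ l41 = 0) ∧ (l22 = 0 → l32 = 0 ∧ l42 = 0) ∧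
      (l33 = 0 → l43 = 0) := by
  -- The matrix is the Gram matrix of the columns of its square root; their coordinates in the
  -- Gram–Schmidt basis are the rows of the triangular factor.
  obtain ⟨B, hB⟩ : ∃ B : RebitMatrix, (symOf c).toMatrix = Bᴴ * B := by
    refine ⟨CFC.sqrt (symOf c).toMatrix, ?_⟩
    rw [(Matrix.nonneg_iff_posSemidef.1 (CFC.sqrt_nonneg (symOf c).toMatrix)).1.eq]
    exact (CFC.sqrt_mul_sqrt_self _ h.nonneg).symm
  set f : Fin 4 → EuclideanSpace ℝ (Fin 2 × Fin 2) := fun k =>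
    WithLp.toLp 2 fun i => B i ((![(0, 0), (0, 1), (1, 0), (1, 1)] : Fin 4 → Fin 2 × Fin 2) k) with hf
  have hcard : Module.finrank ℝ (EuclideanSpace ℝ (Fin 2 × Fin 2)) = Fintype.card (Fin 4) := by
    simp
  set b := InnerProductSpace.gramSchmidtOrthonormalBasis hcard f with hb
  have htri : ∀ i k : Fin 4, i < k → inner ℝ (b k) (f i) = 0 := fun i k hik =>
    InnerProductSpace.gramSchmidtOrthonormalBasis_inv_triangular hcard f hik
  have hentry : ∀ i j : Fin 4, c (symIndex ((![(0, 0), (0, 1), (1, 0), (1, 1)] :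
      Fin 4 → Fin 2 × Fin 2) i) ((![(0, 0), (0, 1), (1, 0), (1, 1)] : Fin 4 → Fin 2 × Fin 2) j)) =
      ∑ k, inner ℝ (b k) (f i) * inner ℝ (b k) (f j) := by
    intro i j
    have h1 := congrFun (congrFun hB ((![(0, 0), (0, 1), (1, 0), (1, 1)] :
      Fin 4 → Fin 2 × Fin 2) i)) ((![(0, 0), (0, 1), (1, 0), (1, 1)] : Fin 4 → Fin 2 × Fin 2) j)
    have h2 : inner ℝ (f i) (f j) = ∑ k, inner ℝ (b k) (f i) * inner ℝ (b k) (f j) := by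
      rw [← b.sum_inner_mul_inner]
      simp_rw [real_inner_comm]
    rw [← h2]
    refine (h1.trans ?_)
    simp only [Matrix.mul_apply, Matrix.conjTranspose_apply, star_trivial, PiLp.inner_apply,
      RCLike.inner_apply, conj_trivial, hf]
    simp_rw [mul_comm]
  refine ⟨inner ℝ (b 0) (f 0), inner ℝ (b 0) (f 1), inner ℝ (b 1) (f 1), inner ℝ (b 0) (f 2),
    inner ℝ (b 1) (f 2), inner ℝ (b 2) (f 2), inner ℝ (b 0) (f 3), inner ℝ (b 1) (f 3),
    inner ℝ (b 2) (f 3), inner ℝ (b 3) (f 3), ?_, fun h0 => ?_, fun h0 => ?_, fun h0 => ?_⟩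
  rotate_left
  · have := inner_gramSchmidtOrthonormalBasis_eq_zero_of_self hcard f 0 h0
    exact ⟨this 1, this 2, this 3⟩
  · have := inner_gramSchmidtOrthonormalBasis_eq_zero_of_self hcard f 1 h0
    exact ⟨this 2, this 3⟩
  · exact inner_gramSchmidtOrthonormalBasis_eq_zero_of_self hcard f 2 h0 3
  have z1 := htri 0 1 (by decide)
  have z2 := htri 0 2 (by decide)
  have z3 := htri 0 3 (by decide)
  have z4 := htri 1 2 (by decide)
  have z5 := htri 1 3 (by decide)
  have z6 := htri 2 3 (by decide)
  have e (i j : Fin 4) := hentry i j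
  simp only [Fin.sum_univ_four] at e
  ext k
  rcases k with k | k
  · fin_cases k
    · simpa [symIndex, z1, z2, z3] using e 0 1
    · simpa [symIndex, z4, z5, sq] using e 1 1
    · simpa [symIndex, z1, z2, z3] using e 0 2
    · simpa [symIndex, z4, z5] using e 1 2
    · simpa [symIndex, z1, z2, z3] using e 0 3
    · simpa [symIndex, z4, z5] using e 1 3
    · simpa [symIndex, z6, sq] using e 2 2
    · simpa [symIndex, z6] using e 2 3
  · fin_cases k
    · simpa [symIndex, z1, z2, z3, sq] using e 0 0
    · simpa [symIndex, sq] using e 3 3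

/-- A parametrization of the positive semidefinite matrices with singular upper left `3 × 3`
block. -/
noncomputable def degenerateParam (r : EuclideanSpace ℝ (Fin 8)) : Fin 8 ⊕ Fin 2 → ℝ :=
  Sum.elim ![r 0 * r 1, r 1 ^ 2 + r 2 ^ 2, r 0 * r 3, r 1 * r 3 + r 2 * r 4, r 0 * r 5,
    r 1 * r 5 + r 2 * r 6, r 3 ^ 2 + r 4 ^ 2, r 3 * r 5 + r 4 * r 6]
    ![r 0 ^ 2, r 5 ^ 2 + r 6 ^ 2 + r 7 ^ 2]

theorem contDiff_degenerateParam : ContDiff ℝ 1 degenerateParam := by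
  refine contDiff_pi.2 fun k => ?_
  rcases k with k | k
  · fin_cases k <;> simp [degenerateParam] <;> fun_prop
  · fin_cases k <;> simp [degenerateParam] <;> fun_prop

/-- A singular block means a zero pivot in the Cholesky factor, and then the column below it
vanishes as well. In each of the three cases the remaining entries can be shifted so that the first
three rows use only two columns. The sum of squares of the entries is the trace, hence the unit
sphere. -/
theorem boundaryStates_diff_subset :
    boundaryStates \ minorsPosSet ⊆
      (fun r => symOfL (degenerateParam r)) '' Metric.sphere (0 : EuclideanSpace ℝ (Fin 8)) 1 := by
  rintro x ⟨hx, hm⟩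
  obtain ⟨c, rfl⟩ := exists_eq_symOf hx.1.1.1
  have htr := hx.1.2
  rw [trace_symOf] at htr
  obtain ⟨l11, l21, l22, l31, l32, l33, l41, l42, l43, l44, rfl, k1, k2, k3⟩ := exists_cholesky hx.1.1
  simp only [Sum.elim_inl, Sum.elim_inr, Matrix.cons_val] at htr
  have hsph : ∀ r : Fin 8 → ℝ, ∑ i, r i ^ 2 = 1 →
      WithLp.toLp 2 r ∈ Metric.sphere (0 : EuclideanSpace ℝ (Fin 8)) 1 := by
    intro r hr
    rw [mem_sphere_zero_iff_norm, EuclideanSpace.norm_eq]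
    simp [hr]
  have hzero : l11 = 0 ∨ l22 = 0 ∨ l33 = 0 := by
    by_contra! hne
    obtain ⟨n1, n2, n3⟩ := hne
    apply hm
    rw [symOf_mem_minorsPosSet]
    have hb : blockDet (l11 ^ 2) ![l11 * l21, l21 ^ 2 + l22 ^ 2, l11 * l31, l21 * l31 + l22 * l32,
        l11 * l41, l21 * l41 + l22 * l42, l31 ^ 2 + l32 ^ 2 + l33 ^ 2,
        l31 * l41 + l32 * l42 + l33 * l43] = l11 ^ 2 * l22 ^ 2 := by
      simp [blockDet]; ring
    refine ⟨by simp; positivity, ?_, ?_⟩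
    · change 0 < blockDet (l11 ^ 2) ![_, _, _, _, _, _, _, _]
      rw [hb]; positivity
    · change 0 < schurDiag (l11 ^ 2) ![_, _, _, _, _, _, _, _]
      have : schurDiag (l11 ^ 2) ![l11 * l21, l21 ^ 2 + l22 ^ 2, l11 * l31, l21 * l31 + l22 * l32,
        l11 * l41, l21 * l41 + l22 * l42, l31 ^ 2 + l32 ^ 2 + l33 ^ 2,
        l31 * l41 + l32 * l42 + l33 * l43] = l33 ^ 2 := by
        rw [schurDiag, hb]
        simp
        field_simp
        ring
      rw [this]; positivity
  have hmem : ∀ r : Fin 8 → ℝ, ∑ i, r i ^ 2 = 1 → ∀ c, degenerateParam (WithLp.toLp 2 r) = c →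
      symOf c ∈ (fun r => symOfL (degenerateParam r)) ''
        Metric.sphere (0 : EuclideanSpace ℝ (Fin 8)) 1 := by
    rintro r hr c rfl
    exact ⟨_, hsph r hr, rfl⟩
  rcases hzero with rfl | rfl | rfl
  · obtain ⟨rfl, rfl, rfl⟩ := k1 rfl
    refine hmem ![0, l22, 0, l32, l33, l42, l43, l44] ?_ _ ?_
    · simp only [Fin.sum_univ_eight, Matrix.cons_val]
      linarith
    · ext k
      rcases k with k | k <;> fin_cases k <;> simp [degenerateParam]
  · obtain ⟨rfl, rfl⟩ := k2 rfl
    refine hmem ![l11, l21, 0, l31, l33, l41, l43, l44] ?_ _ ?_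
    · simp only [Fin.sum_univ_eight, Matrix.cons_val]
      linarith
    · ext k
      rcases k with k | k <;> fin_cases k <;> simp [degenerateParam]
  · obtain rfl := k3 rfl
    refine hmem ![l11, l21, l22, l31, l32, l41, l42, l44] ?_ _ ?_
    · simp only [Fin.sum_univ_eight, Matrix.cons_val]
      linarith
    · ext k
      rcases k with k | k <;> fin_cases k <;> simp [degenerateParam]

/-- Almost every minimally degenerate state has a positive definite upper left `3 × 3` block. -/
theorem hausdorffMeasure_boundaryStates_diff : μH[8] (boundaryStates \ minorsPosSet) = 0 := by
  refine measure_mono_null boundaryStates_diff_subset ?_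
  have hc : ContDiff ℝ 1 fun r : EuclideanSpace ℝ (Fin 8) => symOfL (degenerateParam r) :=
    symOfL.contDiff.comp contDiff_degenerateParam
  obtain ⟨K, hK⟩ := LocallyLipschitzOn.exists_lipschitzOnWith_of_compact
    (isCompact_sphere (0 : EuclideanSpace ℝ (Fin 8)) 1) hc.locallyLipschitz.locallyLipschitzOn
  -- The sphere is seven-dimensional, and a Lipschitz map cannot raise its eight-dimensional measure
  -- above zero.
  have h0 : (μH[8] : Measure (EuclideanSpace ℝ (Fin 8))) (Metric.sphere 0 1) = 0 := by
    have h := Measure.addHaar_sphere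
      (μH[Module.finrank ℝ (EuclideanSpace ℝ (Fin 8))] : Measure (EuclideanSpace ℝ (Fin 8))) 0 1
    simpa using h
  have h1 := hK.hausdorffMeasure_image_le (d := 8) (by norm_num)
  rw [h0, mul_zero] at h1
  exact le_antisymm h1 bot_le

end NullSet

/-! ### Surface integrals in the chart, symmetrized over the exchange of blocks. -/

section BoundaryIntegral

theorem injOn_boundaryChart : Set.InjOn boundaryChart chartDomain := by
  intro z hz w hw h
  have hc : ∀ i j, chartCoord z (symIndex i j) = chartCoord w (symIndex i j) := fun i j =>
    congrArg (fun x : HSSpace => x (i, j)) h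
  have h0 : (coneTrace 1 z)⁻¹ = (coneTrace 1 w)⁻¹ := by
    simpa [chartCoord, coneCoord, symIndex] using hc (0, 0) (0, 0)
  have hl : ∀ i : Fin 8, chartCoord z (.inl i) = chartCoord w (.inl i) := by
    intro i
    fin_cases i
    exacts [hc (0, 0) (0, 1), hc (0, 1) (0, 1), hc (0, 0) (1, 0), hc (0, 1) (1, 0),
      hc (0, 0) (1, 1), hc (0, 1) (1, 1), hc (1, 0) (1, 0), hc (1, 0) (1, 1)]
  ext i
  have := hl i
  simp only [chartCoord, coneCoord, Pi.smul_apply, Sum.elim_inl, smul_eq_mul, ← h0] at this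
  exact mul_left_cancel₀ (inv_ne_zero (coneTrace_pos hz).ne') this

theorem measurableSet_boundaryStates_inter : MeasurableSet (boundaryStates ∩ minorsPosSet) := by
  rw [← image_boundaryChart]
  exact isOpen_chartDomain.measurableSet.image_of_continuousOn_injOn
    (fun z hz => (hasStrictFDerivAt_boundaryChart hz).continuousAt.continuousWithinAt)
    injOn_boundaryChart

theorem boundaryStates_ae_eq :
    boundaryStates =ᵐ[μH[8]] (boundaryStates ∩ minorsPosSet : Set HSSpace) := by
  rw [ae_eq_set]
  refine ⟨?_, ?_⟩
  · rw [Set.sdiff_self_inter]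
    exact hausdorffMeasure_boundaryStates_diff
  · simp [Set.sdiff_eq_empty.2 Set.inter_subset_left]

/-- The determinant of the symmetric `3 × 3` matrix with upper triangle `a b c d e f`. -/
def det3 (a b c d e f : ℝ) : ℝ := a * (d * f - e ^ 2) - b * (b * f - e * c) + c * (b * e - d * c)

/-- The `3 × 3` principal minors of a symmetric matrix. -/
def principalMinor (x : HSSpace) : Fin 4 → ℝ :=
  let m : (Fin 2 × Fin 2) → (Fin 2 × Fin 2) → (Fin 2 × Fin 2) → ℝ := fun i j k =>
    det3 (x (i, i)) (x (i, j)) (x (i, k)) (x (j, j)) (x (j, k)) (x (k, k))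
  ![m (0, 1) (1, 0) (1, 1), m (0, 0) (1, 0) (1, 1), m (0, 0) (0, 1) (1, 1), m (0, 0) (0, 1) (1, 0)]

/-- The part of the sum of the principal minors that comes from the second block. -/
noncomputable def minorRatio (x : HSSpace) : ℝ :=
  (principalMinor x 2 + principalMinor x 3) / ∑ i, principalMinor x i

theorem measurable_minorRatio : Measurable minorRatio := by
  unfold minorRatio
  simp only [principalMinor, det3, Fin.sum_univ_four, Matrix.cons_val]
  fun_prop

/-- The adjugate of a symmetric matrix of corank one is a multiple of v vᵀ. As v has last coordinate
1, the multiple is the determinant of the upper left 3 × 3 block. -/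
theorem principalMinor_coneCoord {s : ℝ} {z : Fin 8 → ℝ} (h : MinorsPos s z) (i : Fin 4) :
    principalMinor (symOf (coneCoord s z)) i = blockDet s z * schurDiag s z * nullVec s z i ^ 2 := by
  obtain ⟨h1, h2, h3⟩ := h
  have hz1 : z 1 = (blockDet s z + z 0 ^ 2) / s := by
    rw [blockDet]; field_simp; ring
  have hz6 : z 6 = schurDiag s z +
      (z 1 * z 2 ^ 2 - 2 * z 0 * z 2 * z 3 + s * z 3 ^ 2) / blockDet s z := by
    rw [schurDiag]; ring
  have hz7 : z 7 = schurOff s z + (z 1 * z 2 * z 4 - z 0 * (z 2 * z 5 + z 3 * z 4)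
      + s * z 3 * z 5) / blockDet s z := by
    rw [schurOff]; ring
  fin_cases i <;>
  · simp [principalMinor, det3, symOf, symIndex, coneCoord, nullVec, lastDiag]
    generalize schurOff s z = O at *
    generalize schurDiag s z = E at *
    try rw [hz7]
    try rw [hz6]
    generalize blockDet s z = D at *
    rw [hz1]
    field_simp
    ring

theorem principalMinor_smul (t : ℝ) (x : HSSpace) (i : Fin 4) :
    principalMinor (t • x) i = t ^ 3 * principalMinor x i := by
  fin_cases i <;> simp [principalMinor, det3] <;> ring

theorem minorRatio_boundaryChart {z : EuclideanSpace ℝ (Fin 8)} (hz : z ∈ chartDomain) :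
    minorRatio (boundaryChart z) =
      (1 + (schurOff 1 z / schurDiag 1 z) ^ 2) / nullNormSq 1 z := by
  have hτ := coneTrace_pos hz
  have h2 := hz.2.1
  have h3 := hz.2.2
  have hn : nullNormSq 1 z ≠ 0 := by
    rw [nullNormSq, Fin.sum_univ_four]
    have : nullVec 1 z 3 = 1 := rfl
    rw [this]
    positivity
  rw [minorRatio, boundaryChart, symOf_smul]
  simp only [principalMinor_smul, principalMinor_coneCoord hz, ← Finset.mul_sum]
  rw [← nullNormSq]
  have e1 : nullVec 1 z 3 = 1 := rfl
  have e2 : nullVec 1 z 2 = -(schurOff 1 z / schurDiag 1 z) := rfl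
  rw [e1, e2]
  field_simp
  ring

/-- The permutation of the indices that exchanges the two blocks. -/
def blockPerm : Equiv.Perm (Fin 2 × Fin 2) := (Equiv.swap 0 1).prodCongr (Equiv.refl _)

theorem blockPerm_blockPerm (i : Fin 2 × Fin 2) : blockPerm (blockPerm i) = i := by
  revert i
  decide

theorem blockPerm_symm : blockPerm.symm = blockPerm :=
  Equiv.ext fun i => blockPerm.symm_apply_eq.2 (blockPerm_blockPerm i).symm

/-- The isometry that exchanges the two blocks. -/
noncomputable def blockSwap : HSSpace ≃ₗᵢ[ℝ] HSSpace :=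
  LinearIsometryEquiv.piLpCongrLeft 2 ℝ ℝ (blockPerm.prodCongr blockPerm)

theorem blockSwap_apply (x : HSSpace) (i j : Fin 2 × Fin 2) :
    blockSwap x (i, j) = x (blockPerm i, blockPerm j) := by
  simp [blockSwap, LinearIsometryEquiv.piLpCongrLeft_apply, Equiv.piCongrLeft'_apply,
    blockPerm_symm]

theorem toMatrix_blockSwap (x : HSSpace) :
    (blockSwap x).toMatrix = x.toMatrix.submatrix blockPerm blockPerm := by
  ext i j
  simp [HSSpace.toMatrix, blockSwap_apply]

theorem det_partialTranspose_blockSwap (x : HSSpace) :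
    (partialTranspose (blockSwap x).toMatrix).det = (partialTranspose x.toMatrix).det := by
  rw [← Matrix.det_submatrix_equiv_self blockPerm
    (partialTranspose x.toMatrix), toMatrix_blockSwap]
  rfl

theorem blockSwap_mem_boundaryStates {x : HSSpace} (hx : x ∈ boundaryStates) :
    blockSwap x ∈ boundaryStates := by
  obtain ⟨⟨h1, h2⟩, v, hv, hv0⟩ := hx
  refine ⟨⟨?_, ?_⟩, v ∘ blockPerm, ?_, ?_⟩
  · rw [toMatrix_blockSwap]
    exact h1.submatrix _
  · rw [toMatrix_blockSwap, ← h2]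
    exact Equiv.sum_comp _ fun i => x.toMatrix i i
  · intro h
    apply hv
    ext i
    have := congrFun h (blockPerm i)
    simpa [blockPerm_blockPerm] using this
  · rw [toMatrix_blockSwap, Matrix.submatrix_mulVec_equiv]
    ext i
    have h3 : (v ∘ blockPerm) ∘ blockPerm.symm = v := by
      rw [Function.comp_assoc, Equiv.self_comp_symm, Function.comp_id]
    rw [h3]
    exact congrFun hv0 (blockPerm i)

theorem blockSwap_preimage_boundaryStates : blockSwap ⁻¹' boundaryStates = boundaryStates := by
  ext x
  refine ⟨fun h => ?_, blockSwap_mem_boundaryStates⟩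
  have h2 : blockSwap (blockSwap x) = x := by
    ext p
    obtain ⟨i, j⟩ := p
    simp [blockSwap_apply, blockPerm_blockPerm]
  rw [← h2]
  exact blockSwap_mem_boundaryStates h

theorem principalMinor_blockSwap (x : HSSpace) (hx : x ∈ boundaryStates) :
    principalMinor (blockSwap x) = ![principalMinor x 2, principalMinor x 3, principalMinor x 0,
      principalMinor x 1] := by
  obtain ⟨c, rfl⟩ := exists_eq_symOf hx.1.1.1
  ext i
  fin_cases i <;>
  · simp [principalMinor, det3, blockSwap_apply, blockPerm, symOf, symIndex]
    try ring

theorem principalMinor_nonneg {x : HSSpace} (hx : x ∈ boundaryStates ∩ minorsPosSet) (i : Fin 4) :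
    0 ≤ principalMinor x i ∧ 0 < principalMinor x 3 := by
  rw [← image_boundaryChart] at hx
  obtain ⟨z, hz, rfl⟩ := hx
  have h1 := inv_pos.2 (coneTrace_pos hz)
  have h2 := hz.2.1
  have h3 := hz.2.2
  have e1 : nullVec 1 z 3 = 1 := rfl
  rw [boundaryChart, symOf_smul, principalMinor_smul, principalMinor_smul,
    principalMinor_coneCoord hz, principalMinor_coneCoord hz, e1]
  exact ⟨by positivity, by positivity⟩

theorem ofReal_minorRatio_add {x : HSSpace} (hx : x ∈ boundaryStates ∩ minorsPosSet) :
    ENNReal.ofReal (minorRatio x) + ENNReal.ofReal (minorRatio (blockSwap x)) = 1 := by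
  have h0 := (principalMinor_nonneg hx 0).1
  have h1 := (principalMinor_nonneg hx 1).1
  have h2 := (principalMinor_nonneg hx 2).1
  have h3 := (principalMinor_nonneg hx 3).2
  have e : minorRatio (blockSwap x) =
      (principalMinor x 0 + principalMinor x 1) / ∑ i, principalMinor x i := by
    rw [minorRatio, principalMinor_blockSwap x hx.1]
    simp only [Fin.sum_univ_four, Matrix.cons_val]
    congr 1
    ring
  rw [e, minorRatio, ← ENNReal.ofReal_add, ← add_div, Fin.sum_univ_four,
    ← ENNReal.ofReal_one]
  · congr 1
    rw [div_eq_one_iff_eq (by positivity)]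
    ring
  all_goals simp only [Fin.sum_univ_four]; positivity

/-- The determinant of the partial transpose as a function on the Hilbert-Schmidt space. -/
noncomputable def ptDet (x : HSSpace) : ℝ := (partialTranspose x.toMatrix).det

theorem continuous_ptDet : Continuous ptDet := by
  unfold ptDet
  refine Continuous.matrix_det (continuous_pi fun i => continuous_pi fun j => ?_)
  simp only [partialTranspose, HSSpace.toMatrix, Matrix.of_apply]
  fun_prop

/-- The shares of the two blocks in the sum of the minors add up to 1 almost everywhere, and the
block exchange, an isometry preserving `ptDet`, makes their integrals equal. -/
theorem lintegral_boundaryStates_eq_two_mul {φ : ℝ → ENNReal} (hφ : Measurable φ) :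
    ∫⁻ x in boundaryStates, φ (ptDet x) ∂μH[8] =
      2 * ∫⁻ x in boundaryStates, ENNReal.ofReal (minorRatio x) * φ (ptDet x) ∂μH[8] := by
  have hm : Measurable fun x : HSSpace => ENNReal.ofReal (minorRatio x) * φ (ptDet x) :=
    measurable_minorRatio.ennreal_ofReal.mul (hφ.comp continuous_ptDet.measurable)
  have hswap : ∫⁻ x in boundaryStates, ENNReal.ofReal (minorRatio (blockSwap x)) * φ (ptDet x) ∂μH[8] =
      ∫⁻ x in boundaryStates, ENNReal.ofReal (minorRatio x) * φ (ptDet x) ∂μH[8] := by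
    have h := (blockSwap.toIsometryEquiv.measurePreserving_hausdorffMeasure 8)
    have h2 := h.setLIntegral_comp_preimage_emb
      blockSwap.toIsometryEquiv.toHomeomorph.measurableEmbedding
      (fun x => ENNReal.ofReal (minorRatio x) * φ (ptDet x)) boundaryStates
    have h3 : (blockSwap.toIsometryEquiv : HSSpace → HSSpace) ⁻¹' boundaryStates = boundaryStates :=
      blockSwap_preimage_boundaryStates
    rw [h3] at h2
    rw [← h2]
    refine lintegral_congr fun x => ?_
    rw [← show ptDet (blockSwap x) = ptDet x from det_partialTranspose_blockSwap x]
    rfl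
  rw [two_mul]
  nth_rewrite 2 [← hswap]
  rw [← lintegral_add_left hm]
  rw [setLIntegral_congr boundaryStates_ae_eq, setLIntegral_congr boundaryStates_ae_eq]
  refine setLIntegral_congr_fun measurableSet_boundaryStates_inter fun x hx => ?_
  rw [← add_mul, ofReal_minorRatio_add hx, one_mul]

/-- The denominator |v|² of `minorRatio` cancels the factor |v|² of the area density. -/
theorem lintegral_boundaryStates_eq_chart {φ : ℝ → ENNReal} (hφ : Measurable φ) :
    ∫⁻ x in boundaryStates, φ (ptDet x) ∂μH[8] =
      2 * ENNReal.ofReal √192 * ∫⁻ z in chartDomain,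
        ENNReal.ofReal ((1 + (schurOff 1 z / schurDiag 1 z) ^ 2) * (coneTrace 1 z)⁻¹ ^ 9) *
          φ (ptDet (boundaryChart z)) ∂μH[8] := by
  rw [lintegral_boundaryStates_eq_two_mul hφ, setLIntegral_congr boundaryStates_ae_eq,
    ← image_boundaryChart]
  have hm : Measurable fun x : HSSpace => ENNReal.ofReal (minorRatio x) * φ (ptDet x) :=
    measurable_minorRatio.ennreal_ofReal.mul (hφ.comp continuous_ptDet.measurable)
  have h := setLIntegral_image_hausdorffMeasure (d := 8) (by simp) isOpen_chartDomain
    (fun z hz => hasStrictFDerivAt_boundaryChart hz) injOn_boundaryChart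
    (fun z hz => injective_chartDeriv hz) continuousOn_normDet_chartDeriv hm
  rw [Nat.cast_ofNat] at h
  rw [h, mul_assoc, ← lintegral_const_mul' _ _ ENNReal.ofReal_ne_top]
  congr 1
  refine setLIntegral_congr_fun isOpen_chartDomain.measurableSet fun z hz => ?_
  have hn : 0 < nullNormSq 1 z := by
    rw [nullNormSq, Fin.sum_univ_four]
    have : nullVec 1 z 3 = 1 := rfl
    rw [this]
    positivity
  have hτ := inv_pos.2 (coneTrace_pos hz)
  simp only
  rw [normDet_chartDeriv hz, minorRatio_boundaryChart hz, ← mul_assoc, ← mul_assoc (ENNReal.ofReal √192),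
    ← ENNReal.ofReal_mul (by positivity), ← ENNReal.ofReal_mul (by positivity)]
  congr 2
  field_simp

end BoundaryIntegral

/-! ### From unit trace to the cone with weight exp(-trace). -/

section ConeIntegral

/-- Linear substitution in a Lebesgue integral. -/
theorem lintegral_comp_mulVec {ι : Type*} [Fintype ι] [DecidableEq ι] (M : Matrix ι ι ℝ)
    (hM : M.det ≠ 0) (g : (ι → ℝ) → ENNReal) :
    ∫⁻ x, g x = ENNReal.ofReal |M.det| * ∫⁻ x, g (M *ᵥ x) := by
  have he : MeasurableEmbedding fun x : ι → ℝ => M *ᵥ x :=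
    (LinearEquiv.ofIsUnitDet (f := Matrix.toLin' M) (v := Pi.basisFun ℝ ι) (v' := Pi.basisFun ℝ ι)
      (by simpa using hM)).toContinuousLinearEquiv.toHomeomorph.measurableEmbedding
  have h := he.lintegral_map (μ := volume) g
  have h2 := Real.map_matrix_volume_pi_eq_smul_volume_pi hM
  rw [← h]
  change _ = _ * ∫⁻ a, g a ∂Measure.map (Matrix.toLin' M) volume
  rw [h2, lintegral_smul_measure, smul_eq_mul, ← mul_assoc, ← ENNReal.ofReal_mul (abs_nonneg _),
    ← abs_mul, mul_inv_cancel₀ hM]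
  simp

theorem lintegral_Ioi_pow_mul_exp_neg_mul (n : ℕ) {r : ℝ} (hr : 0 < r) :
    ∫⁻ s in Set.Ioi (0 : ℝ), ENNReal.ofReal (s ^ n * Real.exp (-(r * s))) =
      ENNReal.ofReal (n.factorial * r⁻¹ ^ (n + 1)) := by
  have h := Real.integral_rpow_mul_exp_neg_mul_Ioi (a := n + 1) (by positivity) hr
  have h2 : ∫ s in Set.Ioi (0 : ℝ), s ^ n * Real.exp (-(r * s)) = n.factorial * r⁻¹ ^ (n + 1) := by
    rw [mul_comm, ← Real.Gamma_nat_eq_factorial, ← one_div, ← Real.rpow_natCast (1 / r), Nat.cast_succ, ← h]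
    simp
  rw [← h2, ofReal_integral_eq_lintegral_ofReal]
  · by_contra hc
    have h3 := integral_undef hc
    rw [h2] at h3
    have : (0 : ℝ) < n.factorial * r⁻¹ ^ (n + 1) := by positivity
    exact this.ne' h3
  · exact (ae_restrict_mem measurableSet_Ioi).mono fun s hs =>
      mul_nonneg (pow_nonneg (le_of_lt hs) _) (Real.exp_pos _).le

/-- The determinant of the partial transpose of the singular matrix with given entries. -/
noncomputable def coneDet (s : ℝ) (z : Fin 8 → ℝ) : ℝ :=
  symDet s (z 0) (z 1) (z 2) (z 4) (z 3) (z 5) (z 6) (z 7) (lastDiag s z)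

theorem ptDet_symOf_coneCoord (s : ℝ) (z : Fin 8 → ℝ) :
    ptDet (symOf (coneCoord s z)) = coneDet s z := by
  rw [ptDet, det_partialTranspose_symOf]
  rfl

theorem coneDet_smul {t : ℝ} (ht : t ≠ 0) (s : ℝ) (z : Fin 8 → ℝ) :
    coneDet (t * s) (t • z) = t ^ 4 * coneDet s z := by
  rw [coneDet, lastDiag_smul ht, coneDet]
  simp only [symDet, Pi.smul_apply, smul_eq_mul]
  ring

theorem measurable_blockDet : Measurable fun p : ℝ × (Fin 8 → ℝ) => blockDet p.1 p.2 := by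
  unfold blockDet
  fun_prop

theorem measurable_schurDiag : Measurable fun p : ℝ × (Fin 8 → ℝ) => schurDiag p.1 p.2 := by
  unfold schurDiag blockDet
  fun_prop

theorem measurable_schurOff : Measurable fun p : ℝ × (Fin 8 → ℝ) => schurOff p.1 p.2 := by
  unfold schurOff blockDet
  fun_prop

theorem measurable_lastDiag : Measurable fun p : ℝ × (Fin 8 → ℝ) => lastDiag p.1 p.2 := by
  have h1 := measurable_schurOff
  have h2 := measurable_schurDiag
  unfold lastDiag blockDet
  fun_prop

theorem measurable_coneTrace : Measurable fun p : ℝ × (Fin 8 → ℝ) => coneTrace p.1 p.2 := by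
  have h1 := measurable_lastDiag
  unfold coneTrace
  fun_prop

theorem measurable_coneDet : Measurable fun p : ℝ × (Fin 8 → ℝ) => coneDet p.1 p.2 := by
  have h1 := measurable_lastDiag
  unfold coneDet symDet
  fun_prop

theorem measurableSet_minorsPos : MeasurableSet {p : ℝ × (Fin 8 → ℝ) | MinorsPos p.1 p.2} :=
  (measurableSet_lt measurable_const measurable_fst).inter
    ((measurableSet_lt measurable_const measurable_blockDet).inter
      (measurableSet_lt measurable_const measurable_schurDiag))

/-- The weight of the singular matrices in the sectional integral. -/
noncomputable def schurWeight (φ : ℝ → ENNReal) (s : ℝ) (z : Fin 8 → ℝ) : ENNReal :=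
  ENNReal.ofReal (1 + (schurOff s z / schurDiag s z) ^ 2) * φ (coneDet s z)

theorem measurable_schurWeight {φ : ℝ → ENNReal} (hφ : Measurable φ) :
    Measurable fun p : ℝ × (Fin 8 → ℝ) => schurWeight φ p.1 p.2 := by
  have h1 := measurable_schurOff
  have h2 := measurable_schurDiag
  have h3 := measurable_coneDet
  unfold schurWeight
  fun_prop

/-- The integrand of the integral over the cone of singular matrices. -/
noncomputable def coneIntegrand (φ : ℝ → ENNReal) (p : ℝ × (Fin 8 → ℝ)) : ENNReal :=
  {p : ℝ × (Fin 8 → ℝ) | MinorsPos p.1 p.2}.indicator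
    (fun p => ENNReal.ofReal (Real.exp (-coneTrace p.1 p.2)) * schurWeight φ p.1 p.2) p

theorem measurable_coneIntegrand {φ : ℝ → ENNReal} (hφ : Measurable φ) :
    Measurable (coneIntegrand φ) := by
  have h1 := measurable_schurWeight hφ
  have h2 := measurable_coneTrace
  exact Measurable.indicator (by fun_prop) measurableSet_minorsPos

theorem hausdorffMeasure_eq_smul_volume : ∃ c : ENNReal, c ≠ 0 ∧ c ≠ ⊤ ∧
    (μH[8] : Measure (EuclideanSpace ℝ (Fin 8))) = c • volume := by
  rw [show (8 : ℝ) = ((8 : ℕ) : ℝ) by norm_num]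
  have h := Measure.isAddLeftInvariant_eq_smul
    (μH[((8 : ℕ) : ℝ)] : Measure (EuclideanSpace ℝ (Fin 8))) volume
  refine ⟨_, ?_, ?_, h⟩
  · simpa using (Measure.addHaarScalarFactor_pos_of_isAddHaarMeasure
      (μH[((8 : ℕ) : ℝ)] : Measure (EuclideanSpace ℝ (Fin 8))) volume).ne'
  · exact ENNReal.coe_ne_top

/-- The section at `s` of the cone integrand, rescaled to the section at `1`. -/
noncomputable def sectionKernel (φ : ℝ → ENNReal) (d : ℕ) (s : ℝ) (z : Fin 8 → ℝ) : ENNReal :=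
  (Set.Ioi (0 : ℝ)).indicator
    (fun s => ENNReal.ofReal (s ^ (d + 8) * Real.exp (-(coneTrace 1 z * s)))) s *
      {z | MinorsPos 1 z}.indicator (fun z => schurWeight φ 1 z) z

theorem measurable_sectionKernel {φ : ℝ → ENNReal} (hφ : Measurable φ) (d : ℕ) :
    Measurable (Function.uncurry (sectionKernel φ d)) := by
  have hp : Measurable fun z : Fin 8 → ℝ => ((1 : ℝ), z) := measurable_prodMk_left
  have hw1 := (measurable_schurWeight hφ).comp hp
  have ht1 : Measurable fun z => coneTrace 1 z := measurable_coneTrace.comp hp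
  have hM1 : MeasurableSet {z | MinorsPos 1 z} :=
    measurableSet_minorsPos.preimage hp
  have h : (fun a : ℝ × (Fin 8 → ℝ) => (Set.Ioi (0 : ℝ)).indicator
      (fun s => ENNReal.ofReal (s ^ (d + 8) * Real.exp (-(coneTrace 1 a.2 * s)))) a.1) =
      (Prod.fst ⁻¹' Set.Ioi (0 : ℝ)).indicator
      (fun a => ENNReal.ofReal (a.1 ^ (d + 8) * Real.exp (-(coneTrace 1 a.2 * a.1)))) := by
    funext a
    simp only [Set.indicator, Set.mem_preimage]
  have h1 : Measurable fun a : ℝ × (Fin 8 → ℝ) => (Set.Ioi (0 : ℝ)).indicator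
      (fun s => ENNReal.ofReal (s ^ (d + 8) * Real.exp (-(coneTrace 1 a.2 * s)))) a.1 := by
    rw [h]
    exact Measurable.indicator (by fun_prop) (measurableSet_Ioi.preimage measurable_fst)
  exact h1.mul ((hw1.indicator hM1).comp measurable_snd)

/-- Substituting s z for z gives s⁸ from the volume and s^d from the homogeneity of `φ`; the ratio
of Schur entries is scale invariant. -/
theorem lintegral_coneIntegrand_eq {φ : ℝ → ENNReal} {d : ℕ}
    (hhom : ∀ t : ℝ, 0 < t → ∀ x, φ (t ^ 4 * x) = ENNReal.ofReal (t ^ d) * φ x) (s : ℝ) :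
    ∫⁻ z, coneIntegrand φ (s, z) = ∫⁻ z, sectionKernel φ d s z := by
  by_cases hs : 0 < s
  · have h := lintegral_comp_mulVec (s • (1 : Matrix (Fin 8) (Fin 8) ℝ))
      (by simp [hs.ne']) fun z => coneIntegrand φ (s, z)
    rw [h, ← lintegral_const_mul' _ _ ENNReal.ofReal_ne_top]
    refine lintegral_congr fun z => ?_
    have hM := minorsPos_smul hs (s := 1) (z := z)
    have ht := coneTrace_smul hs.ne' 1 z
    have hd := coneDet_smul hs.ne' 1 z
    have ho := schurOff_smul hs.ne' 1 z
    have he := schurDiag_smul hs.ne' 1 z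
    rw [mul_one] at hM ht hd ho he
    simp only [Matrix.smul_mulVec, Matrix.one_mulVec, sectionKernel, coneIntegrand]
    by_cases hz : MinorsPos 1 z
    · rw [Set.indicator_of_mem (by exact hM.2 hz), Set.indicator_of_mem (by exact hs),
        Set.indicator_of_mem (by exact hz)]
      simp only [schurWeight]
      rw [ht, hd, ho, he, mul_div_mul_left _ _ hs.ne', hhom s hs, pow_add,
        mul_right_comm (s ^ d), ENNReal.ofReal_mul (by positivity),
        ENNReal.ofReal_mul (by positivity)]
      simp only [Matrix.det_smul, Matrix.det_one, Fintype.card_fin, mul_one]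
      rw [abs_of_pos (by positivity), mul_comm s]
      ring
    · rw [Set.indicator_of_notMem (by exact fun h => hz (hM.1 h)),
        Set.indicator_of_notMem (s := {z | MinorsPos 1 z}) hz, mul_zero, mul_zero]
  · have h1 : ∀ z, coneIntegrand φ (s, z) = 0 := fun z =>
      Set.indicator_of_notMem (fun h => hs h.1) _
    have h2 : ∀ z, sectionKernel φ d s z = 0 := fun z => by simp [sectionKernel, hs]
    simp [h1, h2]

theorem lintegral_sectionKernel (φ : ℝ → ENNReal) (d : ℕ) (z : Fin 8 → ℝ) :
    ∫⁻ s, sectionKernel φ d s z = ((d + 8).factorial : ENNReal) * {z | MinorsPos 1 z}.indicator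
      (fun z => ENNReal.ofReal ((coneTrace 1 z)⁻¹ ^ (d + 9)) * schurWeight φ 1 z) z := by
  by_cases hz : MinorsPos 1 z
  · have hτ := coneTrace_pos hz
    simp only [sectionKernel]
    rw [lintegral_mul_const _ (Measurable.indicator (by fun_prop) measurableSet_Ioi),
      lintegral_indicator measurableSet_Ioi, lintegral_Ioi_pow_mul_exp_neg_mul _ hτ,
      Set.indicator_of_mem (by exact hz), Set.indicator_of_mem (by exact hz),
      ENNReal.ofReal_mul (by positivity), ENNReal.ofReal_natCast, mul_assoc]
  · have h0 : ∀ s, sectionKernel φ d s z = 0 := fun s => by simp [sectionKernel, hz]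
    simp [h0, hz]

theorem setLIntegral_chartDomain_eq (g : (Fin 8 → ℝ) → ENNReal) :
    ∫⁻ z : EuclideanSpace ℝ (Fin 8) in chartDomain, g z =
      ∫⁻ z, {z | MinorsPos 1 z}.indicator g z := by
  rw [← lintegral_indicator isOpen_chartDomain.measurableSet]
  have h := (PiLp.volume_preserving_ofLp (Fin 8)).lintegral_comp_emb
    (MeasurableEquiv.toLp 2 (Fin 8 → ℝ)).symm.measurableEmbedding
    ({z | MinorsPos 1 z}.indicator g)
  rw [← h]
  rfl

/-- Integration over the scale gives (d+8)! τ^(-(d+9)): nine powers of τ are the area density and d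
powers normalize the argument of `φ`. The constant is independent of `φ` and `d`, which lets it
cancel later. -/
theorem exists_lintegral_boundaryStates_eq_cone : ∃ C : ENNReal, C ≠ 0 ∧ C ≠ ⊤ ∧
    ∀ (φ : ℝ → ENNReal) (d : ℕ), Measurable φ →
      (∀ t : ℝ, 0 < t → ∀ x, φ (t ^ 4 * x) = ENNReal.ofReal (t ^ d) * φ x) →
      ((d + 8).factorial : ENNReal) * ∫⁻ x in boundaryStates, φ (ptDet x) ∂μH[8] =
        C * ∫⁻ s, ∫⁻ z, coneIntegrand φ (s, z) := by
  obtain ⟨c, hc0, hc1, hc⟩ := hausdorffMeasure_eq_smul_volume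
  refine ⟨2 * ENNReal.ofReal √192 * c, by simp [hc0], ?_, fun φ d hφ hhom => ?_⟩
  · exact ENNReal.mul_ne_top (ENNReal.mul_ne_top (by simp) (by simp)) hc1
  simp_rw [lintegral_coneIntegrand_eq hhom]
  rw [lintegral_lintegral_swap (measurable_sectionKernel hφ d).aemeasurable]
  simp_rw [lintegral_sectionKernel]
  rw [lintegral_const_mul' _ _ (ENNReal.natCast_ne_top _), lintegral_boundaryStates_eq_chart hφ, hc,
    Measure.restrict_smul, lintegral_smul_measure, smul_eq_mul]
  have hc : (∫⁻ z in chartDomain, ENNReal.ofReal ((1 + (schurOff 1 z / schurDiag 1 z) ^ 2) *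
      (coneTrace 1 z)⁻¹ ^ 9) * φ (ptDet (boundaryChart z))) =
      ∫⁻ z in chartDomain, ENNReal.ofReal ((coneTrace 1 z)⁻¹ ^ (d + 9)) * schurWeight φ 1 z := by
    refine setLIntegral_congr_fun isOpen_chartDomain.measurableSet fun z hz => ?_
    have hτ := inv_pos.2 (coneTrace_pos hz)
    simp only
    rw [boundaryChart_eq hz, ptDet_symOf_coneCoord]
    have h1 := coneDet_smul hτ.ne' 1 z
    rw [mul_one] at h1
    rw [h1, hhom _ hτ, schurWeight, ← mul_assoc, ← mul_assoc, ← ENNReal.ofReal_mul (by positivity),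
      ← ENNReal.ofReal_mul (by positivity)]
    congr 2
    ring
  rw [hc, setLIntegral_chartDomain_eq fun z =>
    ENNReal.ofReal ((coneTrace 1 z)⁻¹ ^ (d + 9)) * schurWeight φ 1 z]
  generalize ((d + 8).factorial : ENNReal) = k
  ring

end ConeIntegral

/-! ### Fubini on coordinate spaces and quadratic substitutions. -/

section Substitutions

theorem lintegral_fin_cons {n : ℕ} {g : (Fin (n + 1) → ℝ) → ENNReal} (hg : Measurable g) :
    ∫⁻ x, g x = ∫⁻ s, ∫⁻ z : Fin n → ℝ, g (Fin.cons s z) := by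
  have h := (volume_preserving_piFinSuccAbove (fun _ : Fin (n + 1) => ℝ) 0).symm
  rw [← h.lintegral_comp hg, Measure.volume_eq_prod, lintegral_prod]
  · simp [MeasurableEquiv.piFinSuccAbove, Fin.insertNthEquiv]
  · exact (hg.comp (MeasurableEquiv.measurable _)).aemeasurable

theorem lintegral_fin_append {m n : ℕ} {g : (Fin (m + n) → ℝ) → ENNReal} (hg : Measurable g) :
    ∫⁻ x, g x = ∫⁻ a : Fin m → ℝ, ∫⁻ b : Fin n → ℝ, g (Fin.append a b) := by
  have h1 := volume_measurePreserving_piCongrLeft (fun _ : Fin (m + n) => ℝ) finSumFinEquiv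
  have h2 := (volume_measurePreserving_sumPiEquivProdPi fun _ : Fin m ⊕ Fin n => ℝ).symm
  rw [← (h1.comp h2).lintegral_comp hg, Measure.volume_eq_prod, lintegral_prod]
  · refine lintegral_congr fun a => lintegral_congr fun b => ?_
    congr 1
    ext i
    obtain ⟨j, rfl⟩ := finSumFinEquiv.surjective i
    have h3 := Equiv.piCongrLeft_apply_apply (fun _ : Fin (m + n) => ℝ) finSumFinEquiv
      ((MeasurableEquiv.sumPiEquivProdPi fun _ : Fin m ⊕ Fin n => ℝ).symm (a, b)) j
    refine h3.trans ?_
    rcases j with j | j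
    · simp [MeasurableEquiv.sumPiEquivProdPi]
    · simp [MeasurableEquiv.sumPiEquivProdPi]
  · exact (hg.comp ((MeasurableEquiv.measurable _).comp (MeasurableEquiv.measurable _))).aemeasurable

theorem lintegral_fin_two {g : (Fin 2 → ℝ) → ENNReal} (hg : Measurable g) :
    ∫⁻ x, g x = ∫⁻ x, ∫⁻ y, g ![x, y] := by
  have h := (volume_preserving_finTwoArrow ℝ).symm
  rw [← h.lintegral_comp hg, Measure.volume_eq_prod, lintegral_prod]
  · rfl
  · exact (hg.comp (MeasurableEquiv.measurable _)).aemeasurable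

/-- Squaring covers the half line twice, which absorbs the factor 2 of the derivative 2t. -/
theorem setLIntegral_Ioi_eq_sq (g : ℝ → ENNReal) :
    ∫⁻ x in Set.Ioi (0 : ℝ), g x = ∫⁻ t, ENNReal.ofReal |t| * g (t ^ 2) := by
  have hd : ∀ s : Set ℝ, ∀ x ∈ s, HasDerivWithinAt (fun t : ℝ => t ^ 2) (2 * x) s x := fun s x _ => by
    simpa using (hasDerivAt_pow 2 x).hasDerivWithinAt
  have h1 := lintegral_image_eq_lintegral_abs_deriv_mul (s := Set.Ioi (0 : ℝ)) measurableSet_Ioi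
    (hd _) (fun x hx y hy h => by
      have hx : 0 < x := hx
      have hy : 0 < y := hy
      simp only at h
      rwa [sq_eq_sq₀ hx.le hy.le] at h) g
  have h2 := lintegral_image_eq_lintegral_abs_deriv_mul (s := Set.Iio (0 : ℝ)) measurableSet_Iio
    (hd _) (fun x hx y hy h => by
      have hx : x < 0 := hx
      have hy : y < 0 := hy
      simp only at h
      nlinarith [sq_eq_sq_iff_eq_or_eq_neg.1 h]) g
  have i1 : (fun t : ℝ => t ^ 2) '' Set.Ioi 0 = Set.Ioi 0 := by
    ext x
    constructor
    · rintro ⟨t, ht, rfl⟩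
      exact pow_pos (Set.mem_Ioi.1 ht) 2
    · intro hx
      exact ⟨√x, Real.sqrt_pos.2 hx, Real.sq_sqrt (le_of_lt hx)⟩
  have i2 : (fun t : ℝ => t ^ 2) '' Set.Iio 0 = Set.Ioi 0 := by
    ext x
    constructor
    · rintro ⟨t, ht, rfl⟩
      exact sq_pos_of_neg (Set.mem_Iio.1 ht)
    · intro hx
      exact ⟨-√x, by simpa using hx, by simp [Real.sq_sqrt (le_of_lt hx)]⟩
  rw [i1] at h1
  rw [i2] at h2
  have hsplit : ∫⁻ t, ENNReal.ofReal |t| * g (t ^ 2) =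
      (∫⁻ t in Set.Iio 0, ENNReal.ofReal |t| * g (t ^ 2)) +
        ∫⁻ t in Set.Ioi 0, ENNReal.ofReal |t| * g (t ^ 2) := by
    rw [← lintegral_add_compl _ (measurableSet_Iio (a := (0 : ℝ))), Set.compl_Iio,
      setLIntegral_congr Ioi_ae_eq_Ici]
  have hc : ∀ s : Set ℝ, ∫⁻ t in s, ENNReal.ofReal |2 * t| * g (t ^ 2) =
      2 * ∫⁻ t in s, ENNReal.ofReal |t| * g (t ^ 2) := by
    intro s
    rw [← lintegral_const_mul' _ _ (by simp)]
    refine lintegral_congr fun t => ?_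
    rw [abs_mul, ENNReal.ofReal_mul (abs_nonneg _), mul_assoc]
    simp
  rw [hc] at h1 h2
  rw [hsplit]
  apply (ENNReal.mul_right_inj (a := 2) (by simp) (by simp)).1
  rw [mul_add, ← h1, ← h2, two_mul]

theorem lintegral_eq_mul_comp_mul (g : ℝ → ENNReal) {t : ℝ} (ht : t ≠ 0) :
    ∫⁻ x, g x = ENNReal.ofReal |t| * ∫⁻ x, g (t * x) := by
  have h := (Homeomorph.mulLeft₀ t ht).measurableEmbedding.lintegral_map (μ := volume) g
  have h2 := Real.map_volume_mul_left ht
  rw [show ∫⁻ x, g (t * x) = ∫⁻ a, g a ∂Measure.map (t * ·) volume from h.symm, h2,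
    lintegral_smul_measure, smul_eq_mul, ← mul_assoc, ← ENNReal.ofReal_mul (abs_nonneg _),
    ← abs_mul, mul_inv_cancel₀ ht]
  simp

/-- The substitution `x = t ^ 2`, `y = t * u` on the half plane. -/
theorem lintegral_halfPlane {g : (Fin 2 → ℝ) → ENNReal} (hg : Measurable g)
    (h0 : ∀ x y, x ≤ 0 → g ![x, y] = 0) :
    ∫⁻ x, g x = ∫⁻ t : Fin 2 → ℝ, ENNReal.ofReal (t 0 ^ 2) * g ![t 0 ^ 2, t 0 * t 1] := by
  have hm : Measurable fun t : Fin 2 → ℝ => ENNReal.ofReal (t 0 ^ 2) * g ![t 0 ^ 2, t 0 * t 1] := by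
    refine Measurable.mul (by fun_prop) (hg.comp ?_)
    refine measurable_pi_iff.2 fun i => ?_
    fin_cases i <;> simp <;> fun_prop
  rw [lintegral_fin_two hg, lintegral_fin_two hm]
  have h1 : ∫⁻ x, ∫⁻ y, g ![x, y] = ∫⁻ x in Set.Ioi (0 : ℝ), ∫⁻ y, g ![x, y] := by
    rw [← lintegral_indicator measurableSet_Ioi]
    refine lintegral_congr fun x => ?_
    by_cases hx : 0 < x
    · simp [hx]
    · simp [hx, h0 x _ (not_lt.1 hx)]
  rw [h1, setLIntegral_Ioi_eq_sq]
  refine lintegral_congr_ae ?_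
  filter_upwards [Measure.ae_ne volume (0 : ℝ)] with t ht
  rw [lintegral_eq_mul_comp_mul _ ht, ← mul_assoc, ← ENNReal.ofReal_mul (abs_nonneg _),
    ← lintegral_const_mul' _ _ ENNReal.ofReal_ne_top]
  simp [← sq]

end Substitutions

/-! ### Congruence by the square root of the first block. -/

section Congruence

theorem det_symMatrix (a11 a12 a22 b11 b21 b12 b22 d11 d12 d22 : ℝ) :
    (!![a11, a12, b11, b12; a12, a22, b21, b22; b11, b21, d11, d12; b12, b22, d12, d22] :
      Matrix (Fin 4) (Fin 4) ℝ).det = symDet a11 a12 a22 b11 b21 b12 b22 d11 d12 d22 := by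
  simp [Matrix.det_succ_row_zero, Fin.sum_univ_succ, Fin.succAbove, symDet]
  ring

theorem det_blockScalar (p q r : ℝ) :
    (!![p, q, 0, 0; q, r, 0, 0; 0, 0, p, q; 0, 0, q, r] : Matrix (Fin 4) (Fin 4) ℝ).det =
      (p * r - q ^ 2) ^ 2 := by
  simp [Matrix.det_succ_row_zero, Fin.sum_univ_succ, Fin.succAbove]
  ring

/-- The entries `b11 b21 b12 b22` of the product `S * B * S`, where `S` has entries `p q r` and
`B` is given by its reflection part `w 0, w 1`, scalar part `w 2` and rotation part `w 3`. -/
def congruenceMatrix (p q r : ℝ) : Matrix (Fin 4) (Fin 4) ℝ :=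
  !![p ^ 2 - q ^ 2, 2 * p * q, p ^ 2 + q ^ 2, 0;
    p * q - q * r, p * r + q ^ 2, p * q + q * r, p * r - q ^ 2;
    p * q - q * r, p * r + q ^ 2, p * q + q * r, q ^ 2 - p * r;
    q ^ 2 - r ^ 2, 2 * q * r, q ^ 2 + r ^ 2, 0]

theorem det_congruenceMatrix (p q r : ℝ) :
    |(congruenceMatrix p q r).det| = 4 * (p * r - q ^ 2) ^ 4 := by
  have h : (congruenceMatrix p q r).det = 4 * (p * r - q ^ 2) ^ 4 := by
    simp only [congruenceMatrix]
    simp [Matrix.det_succ_row_zero, Fin.sum_univ_succ, Fin.succAbove]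
    ring
  rw [h]
  exact abs_of_nonneg (by positivity)

/-- The determinant of the reduced form of the partial transpose. -/
def reducedDet (w : Fin 4 → ℝ) (e : Fin 2 → ℝ) : ℝ :=
  (4 * w 3 * w 1 + e 0 ^ 2) * (-(4 * w 3 * w 1) + e 1 ^ 2) - (e 0 * e 1 - 4 * w 3 * w 0) ^ 2

/-- The determinant of a symmetric `2 × 2` matrix. -/
def formDet (A : Fin 3 → ℝ) : ℝ := A 0 * A 2 - A 1 ^ 2

/-- The quadratic form of a symmetric `2 × 2` matrix. -/
def formEval (A : Fin 3 → ℝ) (e : Fin 2 → ℝ) : ℝ :=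
  A 0 * e 0 ^ 2 + 2 * A 1 * e 0 * e 1 + A 2 * e 1 ^ 2

/-- The trace of a singular matrix in the reduced coordinates. -/
def reducedTrace (A : Fin 3 → ℝ) (w : Fin 4 → ℝ) (e : Fin 2 → ℝ) : ℝ :=
  A 0 + A 2 + (A 0 + A 2) * (w 0 ^ 2 + w 1 ^ 2 + w 2 ^ 2 + w 3 ^ 2)
    + 2 * w 2 * (w 0 * (A 0 - A 2) + 2 * w 1 * A 1)
    + 2 * w 3 * (w 1 * (A 0 - A 2) - 2 * w 0 * A 1) + formEval A e

/-- The entries of `Bᵀ * A⁻¹ * B`. -/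
noncomputable def schurPart (A : Fin 3 → ℝ) (B : Fin 4 → ℝ) : Fin 3 → ℝ :=
  ![(A 2 * B 0 ^ 2 - 2 * A 1 * B 0 * B 1 + A 0 * B 1 ^ 2) / formDet A,
    (A 2 * B 0 * B 2 - A 1 * (B 0 * B 3 + B 1 * B 2) + A 0 * B 1 * B 3) / formDet A,
    (A 2 * B 2 ^ 2 - 2 * A 1 * B 2 * B 3 + A 0 * B 3 ^ 2) / formDet A]

/-- The entries of `Bᵀ * B` for `B` given by reflection, scalar and rotation parts. -/
def gramPart (w : Fin 4 → ℝ) : Fin 3 → ℝ :=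
  ![(w 2 + w 0) ^ 2 + (w 1 + w 3) ^ 2, 2 * (w 2 * w 1 - w 3 * w 0),
    (w 1 - w 3) ^ 2 + (w 2 - w 0) ^ 2]

/-- With A = S² and B = S W S one has Bᵀ A⁻¹ B = S WᵀW S. -/
theorem schurPart_congruence (p q r : ℝ) (h : p * r - q ^ 2 ≠ 0) (w : Fin 4 → ℝ) :
    schurPart ![p ^ 2 + q ^ 2, q * (p + r), q ^ 2 + r ^ 2] (congruenceMatrix p q r *ᵥ w) =
      ![p ^ 2 * gramPart w 0 + 2 * p * q * gramPart w 1 + q ^ 2 * gramPart w 2,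
        p * q * gramPart w 0 + (p * r + q ^ 2) * gramPart w 1 + q * r * gramPart w 2,
        q ^ 2 * gramPart w 0 + 2 * q * r * gramPart w 1 + r ^ 2 * gramPart w 2] := by
  have hd : formDet ![p ^ 2 + q ^ 2, q * (p + r), q ^ 2 + r ^ 2] = (p * r - q ^ 2) ^ 2 := by
    simp [formDet]; ring
  have h2 : (p * r - q ^ 2) ^ 2 ≠ 0 := pow_ne_zero 2 h
  simp only [schurPart, hd, congruenceMatrix, Matrix.mulVec, dotProduct, Fin.sum_univ_four,
    gramPart]
  ext i
  fin_cases i <;> simp <;> rw [div_eq_iff h2] <;> ring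

/-- S is symmetric, so congruence by diag(S, S) commutes with partial transposition. What remains is
the matrix with blocks 1, Wᵀ, W, WᵀW + e eᵀ, of determinant det(WᵀW - W Wᵀ + e eᵀ); the scalar part
of W drops out. -/
theorem symDet_congruence (p q r : ℝ) (w : Fin 4 → ℝ) (e : Fin 2 → ℝ) :
    let B := congruenceMatrix p q r *ᵥ w
    symDet (p ^ 2 + q ^ 2) (q * (p + r)) (q ^ 2 + r ^ 2) (B 0) (B 2) (B 1) (B 3)
      (p ^ 2 * gramPart w 0 + 2 * p * q * gramPart w 1 + q ^ 2 * gramPart w 2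
        + (p * e 0 + q * e 1) ^ 2)
      (p * q * gramPart w 0 + (p * r + q ^ 2) * gramPart w 1 + q * r * gramPart w 2
        + (p * e 0 + q * e 1) * (q * e 0 + r * e 1))
      (q ^ 2 * gramPart w 0 + 2 * q * r * gramPart w 1 + r ^ 2 * gramPart w 2
        + (q * e 0 + r * e 1) ^ 2) =
      (p * r - q ^ 2) ^ 4 * reducedDet w e := by
  intro B
  have hN : symDet 1 0 1 (w 2 + w 0) (w 1 - w 3) (w 1 + w 3) (w 2 - w 0)
      (gramPart w 0 + e 0 ^ 2) (gramPart w 1 + e 0 * e 1) (gramPart w 2 + e 1 ^ 2) =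
      reducedDet w e := by
    simp [symDet, gramPart, reducedDet]
    ring
  rw [← hN, ← det_symMatrix, ← det_symMatrix]
  set S : Matrix (Fin 4) (Fin 4) ℝ := !![p, q, 0, 0; q, r, 0, 0; 0, 0, p, q; 0, 0, q, r] with hS
  set N : Matrix (Fin 4) (Fin 4) ℝ := !![1, 0, w 2 + w 0, w 1 + w 3; 0, 1, w 1 - w 3, w 2 - w 0;
    w 2 + w 0, w 1 - w 3, gramPart w 0 + e 0 ^ 2, gramPart w 1 + e 0 * e 1;
    w 1 + w 3, w 2 - w 0, gramPart w 1 + e 0 * e 1, gramPart w 2 + e 1 ^ 2] with hN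
  have hprod : (S * N * S).det = (p * r - q ^ 2) ^ 4 * N.det := by
    rw [Matrix.det_mul, Matrix.det_mul, hS, det_blockScalar]
    ring
  rw [← hprod]
  congr 1
  ext i j
  fin_cases i <;> fin_cases j <;>
    simp [B, hS, hN, Matrix.mul_apply, Fin.sum_univ_four, congruenceMatrix,
      dotProduct] <;> ring

/-- By Cayley–Hamilton the positive square root of a 2 × 2 matrix A is (A + δ)/√(tr A + 2δ) with δ =
√det A. -/
theorem exists_sqrt_form {A : Fin 3 → ℝ} (h0 : 0 < A 0) (hd : 0 < formDet A) :
    ∃ p q r : ℝ, A = ![p ^ 2 + q ^ 2, q * (p + r), q ^ 2 + r ^ 2] ∧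
      p * r - q ^ 2 = √(formDet A) := by
  set δ := √(formDet A) with hδ
  have hδ0 : 0 < δ := Real.sqrt_pos.2 hd
  have hδ2 : δ ^ 2 = A 0 * A 2 - A 1 ^ 2 := Real.sq_sqrt hd.le
  have h2 : 0 < A 2 := by
    by_contra h
    rw [formDet] at hd
    nlinarith [sq_nonneg (A 1), mul_nonneg h0.le (neg_nonneg.2 (not_lt.1 h))]
  set ρ := √(A 0 + A 2 + 2 * δ) with hρ
  have hρ0 : 0 < ρ := Real.sqrt_pos.2 (by positivity)
  have hρ2 : ρ ^ 2 = A 0 + A 2 + 2 * δ := Real.sq_sqrt (by positivity)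
  refine ⟨(A 0 + δ) / ρ, A 1 / ρ, (A 2 + δ) / ρ, ?_, ?_⟩
  · ext i
    fin_cases i
    · simp only [Fin.zero_eta, Matrix.cons_val_zero]
      field_simp
      rw [hρ2]
      linear_combination -hδ2
    · simp only [Fin.mk_one, Matrix.cons_val_one, Matrix.cons_val_zero]
      field_simp
      rw [hρ2]
      ring
    · simp only [Fin.reduceFinMk, Matrix.cons_val]
      field_simp
      rw [hρ2]
      linear_combination -hδ2
  · field_simp
    rw [hρ2]
    linear_combination -hδ2

end Congruence

/-! ### Integration over the off-diagonal and last blocks. -/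

section InnerIntegral

/-- The entries of a singular matrix from the entries of its blocks. -/
def coneEntries (A : Fin 3 → ℝ) (B : Fin 4 → ℝ) (D : Fin 2 → ℝ) : ℝ × (Fin 8 → ℝ) :=
  (A 0, ![A 1, A 2, B 0, B 1, B 2, B 3, D 0, D 1])

/-- The cone integrand in terms of the blocks and a factor of the Schur complement. -/
noncomputable def factoredIntegrand (φ : ℝ → ENNReal) (A : Fin 3 → ℝ) (B : Fin 4 → ℝ)
    (e : Fin 2 → ℝ) : ENNReal :=
  ENNReal.ofReal (Real.exp (-(A 0 + A 2 + (schurPart A B 0 + schurPart A B 2)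
    + (e 0 ^ 2 + e 1 ^ 2))) * (e 0 ^ 2 + e 1 ^ 2)) *
  φ (symDet (A 0) (A 1) (A 2) (B 0) (B 2) (B 1) (B 3) (schurPart A B 0 + e 0 ^ 2)
    (schurPart A B 1 + e 0 * e 1) (schurPart A B 2 + e 1 ^ 2))

/-- The Schur complement of A has rank one and is written as e eᵀ. The Jacobian e₀² turns the weight
1 + (e₁/e₀)² into |e|², which is rotation invariant. -/
theorem coneIntegrand_shift (φ : ℝ → ENNReal) {A : Fin 3 → ℝ} (h0 : 0 < A 0) (hd : 0 < formDet A)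
    (B : Fin 4 → ℝ) {e : Fin 2 → ℝ} (he : e 0 ≠ 0) :
    ENNReal.ofReal (e 0 ^ 2) * coneIntegrand φ (coneEntries A B
      ![schurPart A B 0 + e 0 ^ 2, schurPart A B 1 + e 0 * e 1]) = factoredIntegrand φ A B e := by
  set D : Fin 2 → ℝ := ![schurPart A B 0 + e 0 ^ 2, schurPart A B 1 + e 0 * e 1] with hD
  have k1 : blockDet (coneEntries A B D).1 (coneEntries A B D).2 = formDet A := by
    simp [blockDet, coneEntries, formDet]
  have k2 : schurDiag (coneEntries A B D).1 (coneEntries A B D).2 = e 0 ^ 2 := by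
    rw [schurDiag, k1]
    simp [coneEntries, hD, schurPart]
  have k3 : schurOff (coneEntries A B D).1 (coneEntries A B D).2 = e 0 * e 1 := by
    rw [schurOff, k1]
    simp [coneEntries, hD, schurPart]
  have k4 : lastDiag (coneEntries A B D).1 (coneEntries A B D).2 =
      schurPart A B 2 + e 1 ^ 2 := by
    rw [lastDiag, k1, k2, k3]
    simp [coneEntries, schurPart]
    field_simp
  have hmem : coneEntries A B D ∈ {p : ℝ × (Fin 8 → ℝ) | MinorsPos p.1 p.2} := by
    refine ⟨h0, ?_, ?_⟩
    · rw [k1]; exact hd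
    · rw [k2]; positivity
  rw [coneIntegrand, Set.indicator_of_mem hmem, schurWeight, k2, k3, factoredIntegrand, coneDet,
    coneTrace, k4, ← mul_assoc, ← mul_assoc, ← ENNReal.ofReal_mul (by positivity),
    ← ENNReal.ofReal_mul (by positivity)]
  congr 2
  · have : e 0 ^ 2 * (1 + (e 0 * e 1 / e 0 ^ 2) ^ 2) = e 0 ^ 2 + e 1 ^ 2 := by
      field_simp
    rw [mul_right_comm, this, mul_comm]
    congr 3
    simp [coneEntries, hD]
    ring

theorem coneIntegrand_eq_zero (φ : ℝ → ENNReal) {A : Fin 3 → ℝ} {B : Fin 4 → ℝ} {D : Fin 2 → ℝ}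
    (h : ¬ (0 < A 0 ∧ 0 < formDet A ∧ schurPart A B 0 < D 0)) :
    coneIntegrand φ (coneEntries A B D) = 0 := by
  refine Set.indicator_of_notMem (fun hm => h ?_) _
  have k1 : blockDet (coneEntries A B D).1 (coneEntries A B D).2 = formDet A := by
    simp [blockDet, coneEntries, formDet]
  have k2 : schurDiag (coneEntries A B D).1 (coneEntries A B D).2 = D 0 - schurPart A B 0 := by
    rw [schurDiag, k1]
    simp [coneEntries, schurPart]
  obtain ⟨m1, m2, m3⟩ := hm
  rw [k1] at m2
  rw [k2] at m3
  exact ⟨m1, m2, sub_pos.1 m3⟩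

theorem lintegral_coneEntries {φ : ℝ → ENNReal} (hφ : Measurable φ) {A : Fin 3 → ℝ}
    (h0 : 0 < A 0) (hd : 0 < formDet A) (B : Fin 4 → ℝ) :
    ∫⁻ D, coneIntegrand φ (coneEntries A B D) = ∫⁻ e, factoredIntegrand φ A B e := by
  have hm : Measurable fun D : Fin 2 → ℝ => coneIntegrand φ
      (coneEntries A B (D + ![schurPart A B 0, schurPart A B 1])) := by
    refine (measurable_coneIntegrand hφ).comp ?_
    refine Measurable.prodMk measurable_const (measurable_pi_iff.2 fun i => ?_)
    fin_cases i <;> simp <;> fun_prop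
  rw [← lintegral_add_right_eq_self _ ![schurPart A B 0, schurPart A B 1],
    lintegral_halfPlane hm fun x y hx => coneIntegrand_eq_zero φ fun h => by
      have := h.2.2
      simp at this
      linarith]
  refine lintegral_congr_ae ?_
  filter_upwards [Measure.ae_eval_ne (fun _ : Fin 2 => (volume : Measure ℝ)) 0 0] with e he
  rw [← coneIntegrand_shift φ h0 hd B he]
  simp [add_comm]

/-- The positive definite symmetric `2 × 2` matrices. -/
def posForms : Set (Fin 3 → ℝ) := {A | 0 < A 0 ∧ 0 < formDet A}

/-- The cone integrand in reduced coordinates. -/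
noncomputable def reducedIntegrand (φ : ℝ → ENNReal) (A : Fin 3 → ℝ) (w : Fin 4 → ℝ)
    (e : Fin 2 → ℝ) : ENNReal :=
  posForms.indicator (fun A =>
    ENNReal.ofReal (4 * √(formDet A) ^ 5 * (Real.exp (-reducedTrace A w e) * formEval A e)) *
      φ (formDet A ^ 2 * reducedDet w e)) A

/-- With δ = det S = √det A, the substitution for B contributes 4δ⁴ and the one for e contributes δ.
-/
theorem lintegral_factoredIntegrand (φ : ℝ → ENNReal) {A : Fin 3 → ℝ}
    (h0 : 0 < A 0) (hd : 0 < formDet A) :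
    ∫⁻ B, ∫⁻ e, factoredIntegrand φ A B e = ∫⁻ w, ∫⁻ e, reducedIntegrand φ A w e := by
  obtain ⟨p, q, r, hA, hδ⟩ := exists_sqrt_form h0 hd
  have hδ0 : 0 < p * r - q ^ 2 := hδ ▸ Real.sqrt_pos.2 hd
  have hM : (congruenceMatrix p q r).det ≠ 0 := by
    rw [← abs_pos, det_congruenceMatrix]
    positivity
  have hS : (!![p, q; q, r] : Matrix (Fin 2) (Fin 2) ℝ).det = p * r - q ^ 2 := by
    simp [Matrix.det_fin_two]; ring
  rw [lintegral_comp_mulVec _ hM, det_congruenceMatrix,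
    ← lintegral_const_mul' _ _ ENNReal.ofReal_ne_top]
  refine lintegral_congr fun w => ?_
  rw [lintegral_comp_mulVec !![p, q; q, r] (by rw [hS]; exact hδ0.ne'), hS, abs_of_pos hδ0,
    ← mul_assoc, ← ENNReal.ofReal_mul (by positivity),
    ← lintegral_const_mul' _ _ ENNReal.ofReal_ne_top]
  refine lintegral_congr fun e => ?_
  have hmem : A ∈ posForms := ⟨h0, hd⟩
  rw [reducedIntegrand, Set.indicator_of_mem hmem, ← hδ, factoredIntegrand]
  have hd2 : formDet A = (p * r - q ^ 2) ^ 2 := by rw [hδ, Real.sq_sqrt hd.le]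
  have hdet := symDet_congruence p q r w e
  have hse : !![p, q; q, r] *ᵥ e = ![p * e 0 + q * e 1, q * e 0 + r * e 1] := by
    ext i
    fin_cases i <;> simp [Matrix.mulVec, dotProduct]
  have hq : (p * e 0 + q * e 1) ^ 2 + (q * e 0 + r * e 1) ^ 2 = formEval A e := by
    rw [hA]
    simp [formEval]
    ring
  rw [hse, hd2]
  simp only [Matrix.cons_val_zero, Matrix.cons_val_one]
  rw [hq, ← mul_assoc, ← ENNReal.ofReal_mul (by positivity)]
  simp only at hdet
  have hsp : schurPart A (congruenceMatrix p q r *ᵥ w) = _ :=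
    hA ▸ schurPart_congruence p q r hδ0.ne' w
  rw [hsp]
  have e0 : A 0 = p ^ 2 + q ^ 2 := by rw [hA]; rfl
  have e1 : A 1 = q * (p + r) := by rw [hA]; rfl
  have e2 : A 2 = q ^ 2 + r ^ 2 := by rw [hA]; rfl
  simp only [Matrix.cons_val_zero, Matrix.cons_val_one, Matrix.cons_val]
  rw [e0, e1, e2, hdet, ← pow_mul]
  congr 2
  have ht : p ^ 2 + q ^ 2 + (q ^ 2 + r ^ 2)
      + (p ^ 2 * gramPart w 0 + 2 * p * q * gramPart w 1 + q ^ 2 * gramPart w 2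
        + (q ^ 2 * gramPart w 0 + 2 * q * r * gramPart w 1 + r ^ 2 * gramPart w 2))
      + formEval A e = reducedTrace A w e := by
    rw [reducedTrace, e0, e1, e2]
    simp only [gramPart, Matrix.cons_val]
    ring
  rw [ht]
  ring

end InnerIntegral

/-! ### Invariance under simultaneous rotation. -/

section Rotation

theorem measurable_fin_append {m n : ℕ} :
    Measurable fun p : (Fin m → ℝ) × (Fin n → ℝ) => Fin.append p.1 p.2 := by
  refine measurable_pi_iff.2 fun i => ?_
  refine Fin.addCases (fun i => ?_) (fun i => ?_) i
  · simp only [Fin.append_left]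
    fun_prop
  · simp only [Fin.append_right]
    fun_prop

theorem lintegral_eq_lintegral_coneEntries {G : ℝ × (Fin 8 → ℝ) → ENNReal} (hG : Measurable G) :
    ∫⁻ s, ∫⁻ z, G (s, z) = ∫⁻ A, ∫⁻ B, ∫⁻ D, G (coneEntries A B D) := by
  have hm : Measurable fun y : Fin 9 → ℝ => G (y 0, Fin.tail y) :=
    hG.comp (Measurable.prodMk (by fun_prop) (measurable_pi_iff.2 fun i => by
      simp only [Fin.tail]; fun_prop))
  have h1 := lintegral_fin_cons (n := 8) hm
  simp only [Fin.cons_zero, Fin.tail_cons] at h1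
  rw [← h1, lintegral_fin_append (m := 3) (n := 6) hm]
  refine lintegral_congr fun A => ?_
  have hp : Measurable fun b : Fin 6 → ℝ => (A, b) := measurable_prodMk_left
  have h2 := hm.comp ((measurable_fin_append (m := 3) (n := 6)).comp hp)
  refine (lintegral_fin_append (m := 4) (n := 2) h2).trans ?_
  refine lintegral_congr fun B => lintegral_congr fun D => ?_
  simp only [Function.comp_apply]
  congr 1
  refine Prod.ext rfl ?_
  ext i
  fin_cases i <;> rfl

theorem measurable_formDet : Measurable formDet := by
  unfold formDet
  fun_prop

theorem measurableSet_posForms : MeasurableSet posForms :=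
  (measurableSet_lt measurable_const (measurable_pi_apply 0)).inter
    (measurableSet_lt measurable_const measurable_formDet)

theorem measurable_reducedIntegrand {φ : ℝ → ENNReal} (hφ : Measurable φ) :
    Measurable fun p : (Fin 3 → ℝ) × (Fin 4 → ℝ) × (Fin 2 → ℝ) =>
      reducedIntegrand φ p.1 p.2.1 p.2.2 := by
  have h : (fun p : (Fin 3 → ℝ) × (Fin 4 → ℝ) × (Fin 2 → ℝ) =>
      reducedIntegrand φ p.1 p.2.1 p.2.2) =
      (Prod.fst ⁻¹' posForms).indicator fun p =>
        ENNReal.ofReal (4 * √(formDet p.1) ^ 5 *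
          (Real.exp (-reducedTrace p.1 p.2.1 p.2.2) * formEval p.1 p.2.2)) *
          φ (formDet p.1 ^ 2 * reducedDet p.2.1 p.2.2) := by
    funext p
    by_cases hp : p.1 ∈ posForms <;> simp [reducedIntegrand, hp]
  rw [h]
  refine Measurable.indicator ?_ (measurableSet_posForms.preimage measurable_fst)
  unfold formDet reducedTrace formEval reducedDet
  fun_prop

theorem lintegral_cone_eq_reduced {φ : ℝ → ENNReal} (hφ : Measurable φ) :
    ∫⁻ s, ∫⁻ z, coneIntegrand φ (s, z) = ∫⁻ A, ∫⁻ w, ∫⁻ e, reducedIntegrand φ A w e := by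
  rw [lintegral_eq_lintegral_coneEntries (measurable_coneIntegrand hφ)]
  refine lintegral_congr fun A => ?_
  by_cases h : 0 < A 0 ∧ 0 < formDet A
  · rw [← lintegral_factoredIntegrand φ h.1 h.2]
    exact lintegral_congr fun B => lintegral_coneEntries hφ h.1 h.2 B
  · have h1 : ∀ B D, coneIntegrand φ (coneEntries A B D) = 0 := fun B D =>
      coneIntegrand_eq_zero φ fun h2 => h ⟨h2.1, h2.2.1⟩
    have h2 : ∀ w e, reducedIntegrand φ A w e = 0 := fun w e =>
      Set.indicator_of_notMem (s := posForms) h _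
    simp [h1, h2]

/-- The action of a rotation on the entries of a symmetric matrix. -/
def rotationForm (c s : ℝ) : Matrix (Fin 3) (Fin 3) ℝ :=
  !![c ^ 2, -(2 * c * s), s ^ 2; c * s, c ^ 2 - s ^ 2, -(c * s); s ^ 2, 2 * c * s, c ^ 2]

theorem det_rotationForm (c s : ℝ) : (rotationForm c s).det = (c ^ 2 + s ^ 2) ^ 3 := by
  simp [rotationForm, Matrix.det_fin_three]
  ring

/-- A and W are conjugated by a rotation and e is rotated. The reflection part of W turns by twice
the angle; its scalar and rotation parts commute with rotations. -/
theorem reducedIntegrand_rotation (φ : ℝ → ENNReal) {c s : ℝ} (h : c ^ 2 + s ^ 2 = 1)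
    (A : Fin 3 → ℝ) (r x y : ℝ) (e : Fin 2 → ℝ) :
    reducedIntegrand φ (rotationForm c s *ᵥ A) ![r * (c ^ 2 - s ^ 2), r * (2 * c * s), x, y]
      (!![c, -s; s, c] *ᵥ e) = reducedIntegrand φ A ![r, 0, x, y] e := by
  have hA : rotationForm c s *ᵥ A = ![c ^ 2 * A 0 - 2 * c * s * A 1 + s ^ 2 * A 2,
      c * s * A 0 + (c ^ 2 - s ^ 2) * A 1 - c * s * A 2,
      s ^ 2 * A 0 + 2 * c * s * A 1 + c ^ 2 * A 2] := by
    ext i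
    fin_cases i <;> simp [rotationForm, Matrix.mulVec, dotProduct, Fin.sum_univ_three] <;> ring
  have he : !![c, -s; s, c] *ᵥ e = ![c * e 0 - s * e 1, s * e 0 + c * e 1] := by
    ext i
    fin_cases i <;> (simp [Matrix.mulVec, dotProduct]; try ring)
  have h1 : formDet (rotationForm c s *ᵥ A) = formDet A := by
    have : formDet (rotationForm c s *ᵥ A) = (c ^ 2 + s ^ 2) ^ 2 * formDet A := by
      rw [hA]; simp [formDet]; ring
    rw [this, h]; ring
  have h2 : formEval (rotationForm c s *ᵥ A) (!![c, -s; s, c] *ᵥ e) = formEval A e := by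
    have : formEval (rotationForm c s *ᵥ A) (!![c, -s; s, c] *ᵥ e) =
        (c ^ 2 + s ^ 2) ^ 2 * formEval A e := by
      rw [hA, he]; simp [formEval]; ring
    rw [this, h]; ring
  have h3 : reducedTrace (rotationForm c s *ᵥ A) ![r * (c ^ 2 - s ^ 2), r * (2 * c * s), x, y]
      (!![c, -s; s, c] *ᵥ e) = reducedTrace A ![r, 0, x, y] e := by
    have : reducedTrace (rotationForm c s *ᵥ A) ![r * (c ^ 2 - s ^ 2), r * (2 * c * s), x, y]
        (!![c, -s; s, c] *ᵥ e) = (c ^ 2 + s ^ 2) * (A 0 + A 2)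
          + (c ^ 2 + s ^ 2) * (A 0 + A 2) * ((c ^ 2 + s ^ 2) ^ 2 * r ^ 2 + x ^ 2 + y ^ 2)
          + (c ^ 2 + s ^ 2) ^ 2 * (2 * x * (r * (A 0 - A 2)) + 2 * y * (-(2 * r * A 1)))
          + formEval A e := by
      rw [reducedTrace, h2, hA]
      simp
      ring
    rw [this, h, reducedTrace]
    simp
    ring
  have h4 : reducedDet ![r * (c ^ 2 - s ^ 2), r * (2 * c * s), x, y] (!![c, -s; s, c] *ᵥ e) =
      reducedDet ![r, 0, x, y] e := by
    have : reducedDet ![r * (c ^ 2 - s ^ 2), r * (2 * c * s), x, y] (!![c, -s; s, c] *ᵥ e) =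
        -(16 * y ^ 2 * r ^ 2 * (c ^ 2 + s ^ 2) ^ 2) + 8 * y * r * (c ^ 2 + s ^ 2) ^ 2 * e 0 * e 1 := by
      rw [he]; simp [reducedDet]; ring
    rw [this, h]
    simp [reducedDet]
    ring
  have hmem : rotationForm c s *ᵥ A ∈ posForms ↔ A ∈ posForms := by
    change 0 < _ ∧ 0 < formDet _ ↔ 0 < A 0 ∧ 0 < formDet A
    rw [h1]
    refine and_congr_left fun hd => ?_
    have hprod : (rotationForm c s *ᵥ A) 0 * A 0 = (c * A 0 - s * A 1) ^ 2 + s ^ 2 * formDet A := by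
      rw [hA]; simp [formDet]; ring
    have hA0 : A 0 ≠ 0 := fun h0 => by
      rw [formDet, h0] at hd
      nlinarith [sq_nonneg (A 1)]
    have hpos : 0 < (rotationForm c s *ᵥ A) 0 * A 0 := by
      rw [hprod]
      rcases eq_or_ne s 0 with rfl | hs
      · have hc : c ≠ 0 := fun h0 => by simp [h0] at h
        have : (c * A 0 - 0 * A 1) ^ 2 = (c * A 0) ^ 2 := by ring
        rw [this]
        positivity
      · positivity
    rw [← pos_iff_pos_of_mul_pos hpos]
  rw [reducedIntegrand, reducedIntegrand]
  by_cases hp : A ∈ posForms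
  · rw [Set.indicator_of_mem (hmem.2 hp), Set.indicator_of_mem hp, h1, h2, h3, h4]
  · rw [Set.indicator_of_notMem (fun h => hp (hmem.1 h)), Set.indicator_of_notMem hp]

end Rotation

/-! ### Polar coordinates for the reflection part. -/

section Polar

theorem lintegral_reducedIntegrand_rotation (φ : ℝ → ENNReal) (r θ x y : ℝ) :
    ∫⁻ A, ∫⁻ e, reducedIntegrand φ A ![r * Real.cos θ, r * Real.sin θ, x, y] e =
      ∫⁻ A, ∫⁻ e, reducedIntegrand φ A ![r, 0, x, y] e := by
  have h : Real.cos (θ / 2) ^ 2 + Real.sin (θ / 2) ^ 2 = 1 := Real.cos_sq_add_sin_sq _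
  have h1 := reducedIntegrand_rotation φ h
  have hc : Real.cos θ = Real.cos (θ / 2) ^ 2 - Real.sin (θ / 2) ^ 2 := by
    rw [← Real.cos_two_mul', mul_div_cancel₀ _ two_ne_zero]
  have hs : Real.sin θ = 2 * Real.cos (θ / 2) * Real.sin (θ / 2) := by
    have := Real.sin_two_mul (θ / 2)
    rw [mul_div_cancel₀ _ two_ne_zero] at this
    rw [this]; ring
  generalize Real.cos (θ / 2) = c at *
  generalize Real.sin (θ / 2) = s at *
  have d1 : (rotationForm c s).det = 1 := by rw [det_rotationForm, h]; norm_num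
  have d2 : (!![c, -s; s, c] : Matrix (Fin 2) (Fin 2) ℝ).det = 1 := by
    rw [← h, Matrix.det_fin_two_of]; ring
  rw [lintegral_comp_mulVec (rotationForm c s) (by rw [d1]; exact one_ne_zero), d1]
  simp only [abs_one, ENNReal.ofReal_one, one_mul]
  refine lintegral_congr fun A => ?_
  rw [lintegral_comp_mulVec !![c, -s; s, c] (by rw [d2]; exact one_ne_zero), d2, hc, hs]
  simp only [abs_one, ENNReal.ofReal_one, one_mul]
  exact lintegral_congr fun e => h1 A r x y e

theorem lintegral_fin_two_polar {f : (Fin 2 → ℝ) → ENNReal} (hf : Measurable f)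
    (hrot : ∀ r θ, f ![r * Real.cos θ, r * Real.sin θ] = f ![r, 0]) :
    ∫⁻ x, f x = ENNReal.ofReal (2 * Real.pi) * ∫⁻ r, ENNReal.ofReal r * f ![r, 0] := by
  have h := (volume_preserving_finTwoArrow ℝ).symm
  have hm : Measurable fun r : ℝ => ENNReal.ofReal r * f ![r, 0] := by
    refine Measurable.mul (by fun_prop) (hf.comp (measurable_pi_iff.2 fun i => ?_))
    fin_cases i <;> (simp; try fun_prop)
  rw [← h.lintegral_comp hf, ← lintegral_comp_polarCoord_symm]
  have hm2 : Measurable fun p : ℝ × ℝ => ENNReal.ofReal p.1 * f ![p.1, 0] := hm.comp measurable_fst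
  have h1 : ∀ p : ℝ × ℝ, ENNReal.ofReal p.1 • f ((MeasurableEquiv.finTwoArrow (α := ℝ)).symm
      (polarCoord.symm p)) = ENNReal.ofReal p.1 * f ![p.1, 0] := by
    intro p
    rw [smul_eq_mul, ← hrot p.1 p.2]
    rfl
  simp only [h1]
  rw [polarCoord_target, Measure.volume_eq_prod, ← Measure.prod_restrict,
    lintegral_prod _ hm2.aemeasurable]
  simp only [lintegral_const, Measure.restrict_apply_univ, Real.volume_Ioo]
  rw [lintegral_mul_const _ hm, mul_comm, ← lintegral_indicator measurableSet_Ioi]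
  congr 1
  · congr 1; ring
  · refine lintegral_congr fun r => ?_
    by_cases hr : 0 < r
    · simp [hr]
    · simp [hr, ENNReal.ofReal_of_nonpos (not_lt.1 hr)]

/-- Rotation invariance holds only after A and e are integrated out, hence the two interchanges of
integrals. -/
theorem lintegral_eq_polar {K : (Fin 3 → ℝ) → (Fin 4 → ℝ) → (Fin 2 → ℝ) → ENNReal}
    (hK : Measurable fun p : (Fin 3 → ℝ) × (Fin 4 → ℝ) × (Fin 2 → ℝ) => K p.1 p.2.1 p.2.2)
    (hrot : ∀ r θ x y, ∫⁻ A, ∫⁻ e, K A ![r * Real.cos θ, r * Real.sin θ, x, y] e =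
      ∫⁻ A, ∫⁻ e, K A ![r, 0, x, y] e) :
    ∫⁻ A, ∫⁻ w, ∫⁻ e, K A w e = ENNReal.ofReal (2 * Real.pi) * ∫⁻ A, ∫⁻ w : Fin 3 → ℝ, ∫⁻ e,
        ENNReal.ofReal (w 0) * K A ![w 0, 0, w 1, w 2] e := by
  have hF : Measurable fun p : (Fin 3 → ℝ) × (Fin 4 → ℝ) => ∫⁻ e, K p.1 p.2 e :=
    Measurable.lintegral_prod_right' (f := fun q : ((Fin 3 → ℝ) × (Fin 4 → ℝ)) × (Fin 2 → ℝ) =>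
      K q.1.1 q.1.2 q.2) (hK.comp MeasurableEquiv.prodAssoc.measurable)
  have hF1 : Measurable fun w => ∫⁻ A, ∫⁻ e, K A w e := Measurable.lintegral_prod_left' hF
  rw [lintegral_lintegral_swap hF.aemeasurable]
  rw [lintegral_fin_append (m := 2) (n := 2) hF1]
  have hF2 : Measurable fun β : Fin 2 → ℝ => ∫⁻ v : Fin 2 → ℝ, ∫⁻ A, ∫⁻ e,
      K A (Fin.append β v) e :=
    Measurable.lintegral_prod_right' (f := fun q : (Fin 2 → ℝ) × (Fin 2 → ℝ) =>
      ∫⁻ A, ∫⁻ e, K A (Fin.append q.1 q.2) e) (hF1.comp measurable_fin_append)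
  have happ : ∀ (x y : ℝ) (v : Fin 2 → ℝ), Fin.append ![x, y] v = ![x, y, v 0, v 1] := by
    intro x y v
    ext i
    fin_cases i <;> rfl
  rw [lintegral_fin_two_polar hF2 fun r θ => by
    refine lintegral_congr fun v => ?_
    rw [happ, happ]
    exact hrot r θ _ _]
  congr 1
  have hw : Measurable fun w : Fin 3 → ℝ => (![w 0, 0, w 1, w 2] : Fin 4 → ℝ) :=
    measurable_pi_iff.2 fun i => by fin_cases i <;> simp <;> fun_prop
  have hG : Measurable fun q : (Fin 3 → ℝ) × (Fin 3 → ℝ) =>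
      ∫⁻ e, ENNReal.ofReal (q.2 0) * K q.1 ![q.2 0, 0, q.2 1, q.2 2] e := by
    refine Measurable.lintegral_prod_right' (f := fun q : ((Fin 3 → ℝ) × (Fin 3 → ℝ)) × (Fin 2 → ℝ) =>
      ENNReal.ofReal (q.1.2 0) * K q.1.1 ![q.1.2 0, 0, q.1.2 1, q.1.2 2] q.2) ?_
    refine Measurable.mul (by fun_prop) (hK.comp (measurable_fst.fst.prodMk
      ((hw.comp measurable_fst.snd).prodMk measurable_snd)))
  rw [lintegral_lintegral_swap hG.aemeasurable]
  rw [lintegral_fin_cons (Measurable.lintegral_prod_left' hG)]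
  refine lintegral_congr fun r => ?_
  rw [← lintegral_const_mul' _ _ ENNReal.ofReal_ne_top]
  refine lintegral_congr fun v => ?_
  rw [happ]
  simp_rw [lintegral_const_mul' _ _ ENNReal.ofReal_ne_top]
  rfl

end Polar

/-! ### Cholesky coordinates and completion of squares. -/

section Gaussian

theorem lintegral_fin_three {f : (Fin 3 → ℝ) → ENNReal} (hf : Measurable f) :
    ∫⁻ A, f A = ∫⁻ x : Fin 2 → ℝ, ∫⁻ y, f ![x 0, x 1, y] := by
  rw [lintegral_fin_append (m := 2) (n := 1) hf]
  refine lintegral_congr fun x => ?_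
  have h := (volume_preserving_funUnique (Fin 1) ℝ)
  rw [← h.lintegral_comp_emb (MeasurableEquiv.measurableEmbedding _)]
  refine lintegral_congr fun b => ?_
  congr 1
  ext i
  fin_cases i <;> rfl

/-- The entries of the product of a lower triangular matrix with its transpose. -/
def cholForm (t : Fin 3 → ℝ) : Fin 3 → ℝ := ![t 0 ^ 2, t 0 * t 1, t 1 ^ 2 + t 2 ^ 2]

theorem measurable_cons_three {α : Type*} [MeasurableSpace α] {a b c : α → ℝ} (ha : Measurable a)
    (hb : Measurable b) (hc : Measurable c) : Measurable fun x => ![a x, b x, c x] :=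
  measurable_pi_iff.2 fun i => by fin_cases i <;> simpa

theorem measurable_cholForm : Measurable cholForm := by
  unfold cholForm
  exact measurable_cons_three (by fun_prop) (by fun_prop) (by fun_prop)

theorem formDet_cholForm (t : Fin 3 → ℝ) : formDet (cholForm t) = (t 0 * t 2) ^ 2 := by
  simp [formDet, cholForm]; ring

/-- All signs of the diagonal entries of the factor are allowed; the resulting fourfold covering
cancels the factors 2 of the two squarings. -/
theorem lintegral_eq_cholForm {f : (Fin 3 → ℝ) → ENNReal} (hf : Measurable f)
    (h0 : ∀ A, A ∉ posForms → f A = 0) :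
    ∫⁻ A, f A = ∫⁻ t : Fin 3 → ℝ, ENNReal.ofReal (t 0 ^ 2 * |t 2|) * f (cholForm t) := by
  have hm1 : Measurable fun q : (Fin 2 → ℝ) × ℝ => f ![q.1 0, q.1 1, q.2] :=
    hf.comp (measurable_cons_three (by fun_prop) (by fun_prop) (by fun_prop))
  have hm2 : Measurable fun x : Fin 2 → ℝ => ∫⁻ y, f ![x 0, x 1, y] := hm1.lintegral_prod_right'
  rw [lintegral_fin_three hf, lintegral_halfPlane hm2 fun x y hx => by
    have : ∀ z, f ![x, y, z] = 0 := fun z => h0 _ fun h => not_lt.2 hx h.1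
    simp [this]]
  have hm3 : Measurable fun t : Fin 3 → ℝ => ENNReal.ofReal (t 0 ^ 2 * |t 2|) * f (cholForm t) :=
    Measurable.mul (by fun_prop) (hf.comp measurable_cholForm)
  rw [lintegral_fin_three hm3]
  refine lintegral_congr fun x => ?_
  simp only [Matrix.cons_val_zero, Matrix.cons_val_one, Matrix.cons_val]
  rcases eq_or_ne (x 0) 0 with hx | hx
  · simp [hx]
  have h1 : ∫⁻ y, f ![x 0 ^ 2, x 0 * x 1, y] =
      ∫⁻ y in Set.Ioi (0 : ℝ), f ![x 0 ^ 2, x 0 * x 1, x 1 ^ 2 + y] := by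
    rw [← lintegral_add_left_eq_self _ (x 1 ^ 2), ← lintegral_indicator measurableSet_Ioi]
    refine lintegral_congr fun y => ?_
    by_cases hy : 0 < y
    · simp [hy]
    · simp only [Set.mem_Ioi, hy, not_false_eq_true, Set.indicator_of_notMem]
      refine h0 _ fun h => ?_
      have h2 := h.2
      simp only [formDet, Matrix.cons_val_zero, Matrix.cons_val_one, Matrix.cons_val] at h2
      have h3 : x 0 ^ 2 * (x 1 ^ 2 + y) - (x 0 * x 1) ^ 2 = x 0 ^ 2 * y := by ring
      rw [h3] at h2
      exact hy (pos_of_mul_pos_right h2 (sq_nonneg _))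
  rw [h1, setLIntegral_Ioi_eq_sq, ← lintegral_const_mul' _ _ ENNReal.ofReal_ne_top]
  refine lintegral_congr fun y => ?_
  rw [← mul_assoc, ← ENNReal.ofReal_mul (by positivity)]
  rfl

/-- The Gaussian weight in the final coordinates. -/
noncomputable def gaussWeight (t y : Fin 3 → ℝ) (e : Fin 2 → ℝ) : ℝ :=
  t 0 ^ 4 * |t 2| ^ 3 * max (y 0) 0 * (e 0 ^ 2 + e 1 ^ 2) *
    Real.exp (-(t 0 ^ 2 + t 1 ^ 2 + t 2 ^ 2 + (y 0 ^ 2 + y 1 ^ 2 + y 2 ^ 2) + (e 0 ^ 2 + e 1 ^ 2)))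

/-- The determinant of the partial transpose in the final coordinates. -/
def gaussDet (t y : Fin 3 → ℝ) (e : Fin 2 → ℝ) : ℝ :=
  4 * t 0 ^ 2 * ((y 2 * t 2 + t 1 * y 0) * y 0) *
    (e 1 * (t 2 * e 0 - t 1 * e 1) - (y 2 * t 2 + t 1 * y 0) * y 0)

/-- The substitution that turns the trace into a sum of squares. -/
noncomputable def squareMatrix (t : Fin 3 → ℝ) : Matrix (Fin 3) (Fin 3) ℝ :=
  let a := t 0 ^ 2 + t 1 ^ 2 + t 2 ^ 2
  let k := √a / (2 * |t 0 * t 2|)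
  !![k, 0, 0;
    -(k * ((t 0 ^ 2 - (t 1 ^ 2 + t 2 ^ 2)) / a)), (√a)⁻¹, 0;
    k * (2 * t 0 * t 1 / a), 0, |t 0 * t 2| / (t 0 * t 2) * (√a)⁻¹]

/-- Let A = L Lᵀ, a = tr A and r the polar radius. The reduced trace is quadratic in the scalar and
rotation parts of W with leading coefficient a. Completing both squares leaves 4 r² det A / a, which
becomes `y 0 ^ 2`, and e is replaced by L⁻ᵀ e. -/
theorem reducedIntegrand_gauss (φ : ℝ → ENNReal) {t : Fin 3 → ℝ} (h0 : t 0 ≠ 0) (h2 : t 2 ≠ 0) :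
    ENNReal.ofReal (t 0 ^ 2 * |t 2|) * ∫⁻ w : Fin 3 → ℝ, ∫⁻ e,
        ENNReal.ofReal (w 0) * reducedIntegrand φ (cholForm t) ![w 0, 0, w 1, w 2] e =
      ∫⁻ y, ∫⁻ e, ENNReal.ofReal (gaussWeight t y e) * φ (gaussDet t y e) := by
  set a := t 0 ^ 2 + t 1 ^ 2 + t 2 ^ 2 with ha
  have ha0 : 0 < a := by positivity
  set ρ := √a with hρ
  have hρ0 : 0 < ρ := Real.sqrt_pos.2 ha0
  have hρ2 : ρ ^ 2 = a := Real.sq_sqrt ha0.le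
  set T := |t 0 * t 2| with hT
  have hT0 : 0 < T := abs_pos.2 (mul_ne_zero h0 h2)
  have hT2 : T ^ 2 = (t 0 * t 2) ^ 2 := sq_abs _
  -- This sign goes into the rotation part so that its product with the radius is free of absolute
  -- values.
  set ε := T / (t 0 * t 2) with hε
  have hε2 : ε ^ 2 = 1 := by
    rw [hε, div_pow, hT2, div_self (pow_ne_zero 2 (mul_ne_zero h0 h2))]
  have hdet : |(squareMatrix t).det| = (2 * T * ρ)⁻¹ := by
    have : (squareMatrix t).det = ρ / (2 * T) * ρ⁻¹ * (ε * ρ⁻¹) := by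
      simp [squareMatrix, Matrix.det_fin_three, ← ha, ← hρ, ← hT, ← hε]
    have h1 : |ε| = 1 := by rw [← sq_eq_sq₀ (abs_nonneg _) zero_le_one, sq_abs, hε2, one_pow]
    rw [this, abs_mul, abs_mul, abs_mul, h1, abs_of_pos (by positivity), abs_of_pos (by positivity)]
    field_simp
  have hsq : ∀ y, squareMatrix t *ᵥ y = ![ρ / (2 * T) * y 0,
      -(ρ / (2 * T) * ((t 0 ^ 2 - (t 1 ^ 2 + t 2 ^ 2)) / a)) * y 0 + ρ⁻¹ * y 1,
      ρ / (2 * T) * (2 * t 0 * t 1 / a) * y 0 + ε * ρ⁻¹ * y 2] := by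
    intro y
    ext i
    fin_cases i <;> simp [squareMatrix, Matrix.mulVec, dotProduct, Fin.sum_univ_three, ← ha, ← hρ,
      ← hT, ← hε]
  have hdet0 : (squareMatrix t).det ≠ 0 := by
    rw [← abs_pos, hdet]; positivity
  set S : Matrix (Fin 2) (Fin 2) ℝ := !![(t 0)⁻¹, -(t 1 / (t 0 * t 2)); 0, (t 2)⁻¹] with hS
  have hSdet : |S.det| = T⁻¹ := by
    rw [hS, Matrix.det_fin_two_of, hT, ← abs_inv, mul_inv]; simp
  have hSdet0 : S.det ≠ 0 := by
    rw [← abs_pos, hSdet]; positivity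
  have hSe : ∀ e, S *ᵥ e = ![(t 0)⁻¹ * e 0 - t 1 / (t 0 * t 2) * e 1, (t 2)⁻¹ * e 1] := by
    intro e
    ext i
    fin_cases i
    · simp [hS, Matrix.mulVec, dotProduct]; ring
    · simp [hS, Matrix.mulVec, dotProduct]
  rw [lintegral_comp_mulVec _ hdet0, hdet, ← mul_assoc, ← ENNReal.ofReal_mul (by positivity),
    ← lintegral_const_mul' _ _ ENNReal.ofReal_ne_top]
  refine lintegral_congr fun y => ?_
  rw [lintegral_comp_mulVec S hSdet0, hSdet, ← mul_assoc, ← ENNReal.ofReal_mul (by positivity),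
    ← lintegral_const_mul' _ _ ENNReal.ofReal_ne_top]
  refine lintegral_congr fun e => ?_
  have hmem : cholForm t ∈ posForms := by
    refine ⟨by simp [cholForm]; positivity, ?_⟩
    rw [formDet_cholForm]; positivity
  have hev : formEval (cholForm t) (S *ᵥ e) = e 0 ^ 2 + e 1 ^ 2 := by
    rw [hSe]
    simp [formEval, cholForm]
    field_simp
    ring
  rw [hsq, reducedIntegrand, Set.indicator_of_mem hmem, formDet_cholForm, hev]
  have hD : √((t 0 * t 2) ^ 2) = T := Real.sqrt_sq_eq_abs _
  rw [hD]
  simp only [Matrix.cons_val_zero, Matrix.cons_val_one, Matrix.cons_val]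
  have htr : reducedTrace (cholForm t) ![ρ / (2 * T) * y 0, 0,
      -(ρ / (2 * T) * ((t 0 ^ 2 - (t 1 ^ 2 + t 2 ^ 2)) / a)) * y 0 + ρ⁻¹ * y 1,
      ρ / (2 * T) * (2 * t 0 * t 1 / a) * y 0 + ε * ρ⁻¹ * y 2] (S *ᵥ e) =
      t 0 ^ 2 + t 1 ^ 2 + t 2 ^ 2 + (y 0 ^ 2 + y 1 ^ 2 + y 2 ^ 2) + (e 0 ^ 2 + e 1 ^ 2) := by
    rw [reducedTrace, hev]
    simp only [cholForm, Matrix.cons_val_zero, Matrix.cons_val_one, Matrix.cons_val]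
    set u := t 0 ^ 2 - (t 1 ^ 2 + t 2 ^ 2) with hu
    -- The discriminant identity (A₀ - A₂)² + 4A₁² = (tr A)² - 4 det A.
    have hu2 : u ^ 2 + (2 * t 0 * t 1) ^ 2 = a ^ 2 - 4 * T ^ 2 := by
      rw [hu, ha, hT2]; ring
    rw [show t 0 ^ 2 + (t 1 ^ 2 + t 2 ^ 2) = a by rw [ha]; ring]
    set k := ρ / (2 * T) with hk
    have hk2 : k ^ 2 * (4 * T ^ 2) = a := by
      rw [hk, ← hρ2]; field_simp; ring
    have h3 : a * (ρ⁻¹ * y 1) ^ 2 = y 1 ^ 2 := by rw [← hρ2]; field_simp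
    have h4 : a * (ε * ρ⁻¹ * y 2) ^ 2 = y 2 ^ 2 := by
      rw [← hρ2, mul_pow, mul_pow, hε2]; field_simp
    have h5 : a * (-(k * (u / a)) * y 0 + ρ⁻¹ * y 1) ^ 2
        + 2 * (-(k * (u / a)) * y 0 + ρ⁻¹ * y 1) * (k * y 0 * u) =
        a * (ρ⁻¹ * y 1) ^ 2 - k ^ 2 * u ^ 2 * y 0 ^ 2 / a := by
      field_simp
      ring
    have h6 : a * (k * (2 * t 0 * t 1 / a) * y 0 + ε * ρ⁻¹ * y 2) ^ 2
        - 2 * (k * (2 * t 0 * t 1 / a) * y 0 + ε * ρ⁻¹ * y 2) * (2 * (k * y 0) * (t 0 * t 1)) =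
        a * (ε * ρ⁻¹ * y 2) ^ 2 - k ^ 2 * (2 * t 0 * t 1) ^ 2 * y 0 ^ 2 / a := by
      field_simp
      ring
    have h7 : a * (k * y 0) ^ 2 - k ^ 2 * u ^ 2 * y 0 ^ 2 / a
        - k ^ 2 * (2 * t 0 * t 1) ^ 2 * y 0 ^ 2 / a = y 0 ^ 2 := by
      have : a * (k * y 0) ^ 2 - k ^ 2 * u ^ 2 * y 0 ^ 2 / a
        - k ^ 2 * (2 * t 0 * t 1) ^ 2 * y 0 ^ 2 / a =
          k ^ 2 * y 0 ^ 2 * (a ^ 2 - (u ^ 2 + (2 * t 0 * t 1) ^ 2)) / a := by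
        field_simp
        ring
      rw [this, hu2, div_eq_iff ha0.ne']
      linear_combination y 0 ^ 2 * hk2
    rw [h3] at h5
    rw [h4] at h6
    linear_combination h5 + h6 + h7
  have hdd : ((t 0 * t 2) ^ 2) ^ 2 * reducedDet ![ρ / (2 * T) * y 0, 0,
      -(ρ / (2 * T) * ((t 0 ^ 2 - (t 1 ^ 2 + t 2 ^ 2)) / a)) * y 0 + ρ⁻¹ * y 1,
      ρ / (2 * T) * (2 * t 0 * t 1 / a) * y 0 + ε * ρ⁻¹ * y 2] (S *ᵥ e) = gaussDet t y e := by
    rw [hSe]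
    set b := ρ / (2 * T) * (2 * t 0 * t 1 / a) * y 0 + ε * ρ⁻¹ * y 2 with hb
    have hbB : b * (ρ / (2 * T) * y 0) =
        y 0 * (y 2 * t 2 + t 1 * y 0) / (2 * t 0 * t 2 ^ 2) := by
      have h3 : b * (ρ / (2 * T) * y 0) = ρ ^ 2 / (4 * T ^ 2) * (2 * t 0 * t 1 / a) * y 0 ^ 2
          + y 0 * y 2 / (2 * (t 0 * t 2)) := by
        rw [hb, hε]
        field_simp
        ring
      rw [h3, hρ2, hT2]
      field_simp
      ring
    simp only [reducedDet, gaussDet, Matrix.cons_val_zero, Matrix.cons_val_one, Matrix.cons_val]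
    rw [mul_assoc 4 b (ρ / (2 * T) * y 0), hbB]
    field_simp
    ring
  -- `ENNReal.ofReal` cuts the polar radius off at zero; `max` moves this cutoff into the real
  -- weight.
  have hmax : ENNReal.ofReal (ρ / (2 * T) * y 0) = ENNReal.ofReal (ρ / (2 * T) * max (y 0) 0) := by
    rw [ENNReal.ofReal_mul (by positivity), ENNReal.ofReal_mul (by positivity)]
    congr 1
    rcases le_total (y 0) 0 with h | h
    · rw [max_eq_right h, ENNReal.ofReal_of_nonpos h, ENNReal.ofReal_zero]
    · rw [max_eq_left h]
  have hw : 0 ≤ ρ / (2 * T) * max (y 0) 0 := mul_nonneg (by positivity) (le_max_right _ _)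
  have hTabs : T = |t 0| * |t 2| := abs_mul _ _
  rw [htr, hdd, hmax, ← mul_assoc, ← mul_assoc, ← ENNReal.ofReal_mul (by positivity),
    ← ENNReal.ofReal_mul (mul_nonneg (by positivity) hw)]
  congr 2
  rw [gaussWeight]
  generalize Real.exp _ = E
  -- In order: the Cholesky Jacobian, the determinants of `squareMatrix` and `S`, the polar radius
  -- per unit of `y 0`, and the factor 4δ⁵ of the reduced integrand.
  have h3 : t 0 ^ 2 * |t 2| * (2 * T * ρ)⁻¹ * T⁻¹ * (ρ / (2 * T)) * (4 * T ^ 5) =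
      t 0 ^ 4 * |t 2| ^ 3 := by
    have : t 0 ^ 2 * |t 2| * (2 * T * ρ)⁻¹ * T⁻¹ * (ρ / (2 * T)) * (4 * T ^ 5) =
        t 0 ^ 2 * |t 2| * T ^ 2 := by
      field_simp
      ring
    rw [this, hTabs, mul_pow, sq_abs]
    ring
  rw [← h3]
  ring

theorem lintegral_lintegral_eq_cholForm {K : (Fin 3 → ℝ) → (Fin 4 → ℝ) → (Fin 2 → ℝ) → ENNReal}
    (hK : Measurable fun p : (Fin 3 → ℝ) × (Fin 4 → ℝ) × (Fin 2 → ℝ) => K p.1 p.2.1 p.2.2)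
    (h0 : ∀ A, A ∉ posForms → ∀ w e, K A w e = 0) :
    ∫⁻ A, ∫⁻ w : Fin 3 → ℝ, ∫⁻ e, ENNReal.ofReal (w 0) * K A ![w 0, 0, w 1, w 2] e =
      ∫⁻ t : Fin 3 → ℝ, ENNReal.ofReal (t 0 ^ 2 * |t 2|) * ∫⁻ w : Fin 3 → ℝ, ∫⁻ e,
        ENNReal.ofReal (w 0) * K (cholForm t) ![w 0, 0, w 1, w 2] e := by
  have hw : Measurable fun w : Fin 3 → ℝ => (![w 0, 0, w 1, w 2] : Fin 4 → ℝ) :=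
    measurable_pi_iff.2 fun i => by fin_cases i <;> simp <;> fun_prop
  have h1 : Measurable fun q : ((Fin 3 → ℝ) × (Fin 3 → ℝ)) × (Fin 2 → ℝ) =>
      ENNReal.ofReal (q.1.2 0) * K q.1.1 ![q.1.2 0, 0, q.1.2 1, q.1.2 2] q.2 :=
    Measurable.mul (by fun_prop) (hK.comp (measurable_fst.fst.prodMk
      ((hw.comp measurable_fst.snd).prodMk measurable_snd)))
  refine lintegral_eq_cholForm h1.lintegral_prod_right'.lintegral_prod_right' fun A hA => ?_
  simp [h0 A hA]

theorem lintegral_cone_eq_gauss {φ : ℝ → ENNReal} (hφ : Measurable φ) :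
    ∫⁻ s, ∫⁻ z, coneIntegrand φ (s, z) = ENNReal.ofReal (2 * Real.pi) * ∫⁻ t, ∫⁻ y, ∫⁻ e,
      ENNReal.ofReal (gaussWeight t y e) * φ (gaussDet t y e) := by
  have hK := measurable_reducedIntegrand hφ
  rw [lintegral_cone_eq_reduced hφ, lintegral_eq_polar hK fun r θ x y =>
    lintegral_reducedIntegrand_rotation φ r θ x y, lintegral_lintegral_eq_cholForm hK
    fun A hA w e => Set.indicator_of_notMem hA _]
  congr 1
  refine lintegral_congr_ae ?_
  filter_upwards [Measure.ae_eval_ne (fun _ : Fin 3 => (volume : Measure ℝ)) 0 0,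
    Measure.ae_eval_ne (fun _ : Fin 3 => (volume : Measure ℝ)) 2 0] with t h0 h2
  exact reducedIntegrand_gauss φ h0 h2

end Gaussian

/-! ### Moments of the one-variable weights. -/

section OneVariable

theorem integrable_pow_mul_exp_neg_sq (n : ℕ) :
    Integrable fun x : ℝ => x ^ n * Real.exp (-x ^ 2) := by
  have h := integrable_rpow_mul_exp_neg_mul_sq one_pos (s := n) (by
    have : (0 : ℝ) ≤ n := n.cast_nonneg
    linarith)
  simpa using h

theorem integral_Ioi_pow_mul_exp_neg_sq (n : ℕ) :
    ∫ x in Set.Ioi (0 : ℝ), x ^ n * Real.exp (-x ^ 2) = Real.Gamma ((n + 1) / 2) / 2 := by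
  have h := integral_rpow_mul_exp_neg_rpow (p := 2) (q := n) two_pos (by
    have : (0 : ℝ) ≤ n := n.cast_nonneg
    linarith)
  simp only [Real.rpow_natCast, Real.rpow_ofNat] at h
  rw [h]
  ring

/-- The weights of the final coordinates. -/
noncomputable def coordWeight (i : Fin 8) (t : ℝ) : ℝ :=
  (![t ^ 4, 1, |t| ^ 3, max t 0, 1, 1, 1, 1] : Fin 8 → ℝ) i * Real.exp (-t ^ 2)

/-- The order of vanishing of the weights at the origin. -/
def coordOrder : Fin 8 → ℕ := ![4, 0, 3, 1, 0, 0, 0, 0]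

theorem coordWeight_of_pos (i : Fin 8) {t : ℝ} (ht : 0 < t) :
    coordWeight i t = t ^ coordOrder i * Real.exp (-t ^ 2) := by
  fin_cases i <;> simp [coordWeight, coordOrder, abs_of_pos ht, max_eq_left ht.le]

theorem coordWeight_neg {i : Fin 8} (hi : i ≠ 3) (t : ℝ) : coordWeight i (-t) = coordWeight i t := by
  fin_cases i <;> simp [coordWeight] at hi ⊢
  ring

theorem coordWeight_nonneg (i : Fin 8) (t : ℝ) : 0 ≤ coordWeight i t := by
  refine mul_nonneg ?_ (Real.exp_pos _).le
  fin_cases i <;> (simp; try positivity)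

theorem integrable_coordWeight (i : Fin 8) (p : ℕ) : Integrable fun t => coordWeight i t * t ^ p := by
  have h := (integrable_pow_mul_exp_neg_sq (coordOrder i + p)).norm
  refine h.mono' ?_ (Filter.Eventually.of_forall fun t => ?_)
  · refine Continuous.aestronglyMeasurable ?_
    fin_cases i <;> simp [coordWeight] <;> fun_prop
  · have hle : ∀ a b c d : ℝ, |a| ≤ |b| → |a * c * d| ≤ |b * d * c| := by
      intro a b c d hab
      rw [abs_mul, abs_mul, abs_mul, abs_mul, mul_right_comm]
      gcongr
    rw [pow_add]
    refine hle _ _ _ _ ?_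
    fin_cases i <;> simp [coordOrder]
    rw [abs_of_nonneg (le_max_right _ _)]
    exact max_le (le_abs_self t) (abs_nonneg t)

theorem setIntegral_Ioi_coordWeight (i : Fin 8) (p : ℕ) :
    ∫ t in Set.Ioi (0 : ℝ), coordWeight i t * t ^ p =
      Real.Gamma ((coordOrder i + p + 1) / 2) / 2 := by
  have h := integral_Ioi_pow_mul_exp_neg_sq (coordOrder i + p)
  rw [Nat.cast_add] at h
  rw [← h]
  refine setIntegral_congr_fun measurableSet_Ioi fun t ht => ?_
  rw [coordWeight_of_pos i ht]
  ring

theorem integral_coordWeight_odd {i : Fin 8} (hi : i ≠ 3) {p : ℕ} (hp : Odd p) :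
    ∫ t, coordWeight i t * t ^ p = 0 := by
  have h := integral_neg_eq_self (fun t => coordWeight i t * t ^ p) volume
  simp only [coordWeight_neg hi, hp.neg_pow, mul_neg, integral_neg] at h
  linarith

/-- The multiplicity of the half line integral in the integral over the line. -/
noncomputable def coordMult (i : Fin 8) : ℝ := if i = 3 then 1 / 2 else 1

theorem integral_coordWeight_even (i : Fin 8) {p : ℕ} (hp : Even p) :
    ∫ t, coordWeight i t * t ^ p =
      coordMult i * Real.Gamma ((coordOrder i + p + 1) / 2) := by
  have h := setIntegral_Ioi_coordWeight i p
  by_cases hi : i = 3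
  · rw [coordMult, if_pos hi]
    have h1 : ∫ t, coordWeight i t * t ^ p = ∫ t in Set.Ioi (0 : ℝ), coordWeight i t * t ^ p := by
      refine (setIntegral_eq_integral_of_forall_compl_eq_zero fun t ht => ?_).symm
      have : t ≤ 0 := not_lt.1 ht
      subst hi
      simp [coordWeight, max_eq_right this]
    rw [h1, h]
    ring
  · rw [coordMult, if_neg hi, one_mul]
    have h1 := integral_comp_abs (f := fun t => coordWeight i t * t ^ p)
    rw [h] at h1
    have h2 : ∀ t : ℝ, coordWeight i |t| * |t| ^ p = coordWeight i t * t ^ p := by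
      intro t
      rw [hp.pow_abs]
      rcases abs_choice t with h | h <;> rw [h]
      rw [coordWeight_neg hi]
    simp only [h2] at h1
    rw [h1]
    ring

/-- The ratio of the moment of order `p` to the total mass of an even weight. -/
def risingRatio (c : ℚ) (p : ℕ) : ℚ := if Even p then ∏ i ∈ Finset.range (p / 2), (c + i) else 0

theorem Gamma_add_natCast_eq_prod {c : ℝ} (hc : 0 < c) (q : ℕ) :
    Real.Gamma (c + q) = (∏ i ∈ Finset.range q, (c + i)) * Real.Gamma c := by
  induction q with
  | zero => simp
  | succ q ih =>
    rw [Nat.cast_succ, ← add_assoc, Real.Gamma_add_one (by positivity), ih, Finset.prod_range_succ]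
    ring

/-- The half integers that describe the moments of the weights. -/
def coordShape : Fin 8 → ℚ := ![5 / 2, 1 / 2, 2, 1, 1 / 2, 1 / 2, 1 / 2, 1 / 2]

theorem coordShape_eq (i : Fin 8) : ((coordShape i : ℚ) : ℝ) = (coordOrder i + 1) / 2 := by
  fin_cases i <;> simp [coordShape, coordOrder] <;> norm_num

/-- The total mass of a weight. -/
noncomputable def coordMass (i : Fin 8) : ℝ := coordMult i * Real.Gamma (coordShape i)

theorem coordMass_pos (i : Fin 8) : 0 < coordMass i := by
  refine mul_pos ?_ (Real.Gamma_pos_of_pos ?_)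
  · unfold coordMult; split_ifs <;> norm_num
  · rw [coordShape_eq]; positivity

/-- The weight with index 3 lives on a half line, so its odd moments do not vanish and must be
excluded. -/
theorem integral_coordWeight (i : Fin 8) {p : ℕ} (hp : i = 3 → Even p) :
    ∫ t, coordWeight i t * t ^ p = coordMass i * (risingRatio (coordShape i) p : ℚ) := by
  rcases Nat.even_or_odd p with h | h
  · rw [integral_coordWeight_even i h, coordMass, risingRatio, if_pos h, coordShape_eq]
    obtain ⟨q, rfl⟩ := h
    have h1 : ((coordOrder i + (q + q : ℕ) + 1) / 2 : ℝ) = (coordOrder i + 1) / 2 + q := by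
      push_cast; ring
    rw [h1, Gamma_add_natCast_eq_prod (by positivity)]
    have h2 : (q + q) / 2 = q := by omega
    rw [h2]
    push_cast
    rw [coordShape_eq]
    ring
  · have hi : i ≠ 3 := fun h3 => (Nat.not_even_iff_odd.2 h) (hp h3)
    rw [integral_coordWeight_odd hi h, risingRatio, if_neg (Nat.not_even_iff_odd.2 h)]
    simp

end OneVariable

/-! ### Expansion of the powers of the determinant into monomials. -/

section Moments

/-- The product of the weights. -/
noncomputable def totalWeight (x : Fin 8 → ℝ) : ℝ := ∏ i, coordWeight i (x i)

theorem totalWeight_nonneg (x : Fin 8 → ℝ) : 0 ≤ totalWeight x :=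
  Finset.prod_nonneg fun i _ => coordWeight_nonneg i (x i)

/-- The total mass of the product of the weights. -/
noncomputable def totalMass : ℝ := ∏ i, coordMass i

theorem totalMass_pos : 0 < totalMass := Finset.prod_pos fun i _ => coordMass_pos i

/-- The function is integrable with respect to the product of the weights, with normalized
integral `r`. -/
def HasMean (f : (Fin 8 → ℝ) → ℝ) (r : ℝ) : Prop :=
  Integrable (fun x => totalWeight x * f x) ∧ ∫ x, totalWeight x * f x = totalMass * r

theorem HasMean.add {f g : (Fin 8 → ℝ) → ℝ} {r s : ℝ} (hf : HasMean f r) (hg : HasMean g s) :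
    HasMean (fun x => f x + g x) (r + s) := by
  refine ⟨?_, ?_⟩
  · simp_rw [mul_add]
    exact hf.1.add hg.1
  · simp_rw [mul_add]
    rw [integral_add hf.1 hg.1, hf.2, hg.2]

theorem HasMean.const_mul {f : (Fin 8 → ℝ) → ℝ} {r : ℝ} (hf : HasMean f r) (c : ℝ) :
    HasMean (fun x => c * f x) (c * r) := by
  refine ⟨?_, ?_⟩
  · simp_rw [mul_left_comm _ c]
    exact hf.1.const_mul c
  · simp_rw [mul_left_comm _ c]
    rw [integral_const_mul, hf.2]

theorem HasMean.sum {ι : Type*} (s : Finset ι) {f : ι → (Fin 8 → ℝ) → ℝ} {r : ι → ℝ}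
    (h : ∀ i ∈ s, HasMean (f i) (r i)) : HasMean (fun x => ∑ i ∈ s, f i x) (∑ i ∈ s, r i) := by
  refine ⟨?_, ?_⟩
  · simp_rw [Finset.mul_sum]
    exact integrable_finsetSum _ fun i hi => (h i hi).1
  · simp_rw [Finset.mul_sum]
    rw [integral_finsetSum _ fun i hi => (h i hi).1]
    exact Finset.sum_congr rfl fun i hi => (h i hi).2

/-- By the parity assumption an odd power of the half-line variable comes with an odd power of `x
5`, whose weight is even, so the integral vanishes as `risingRatio` predicts. -/
theorem hasMean_monomial {p : Fin 8 → ℕ} (hp : Even (p 3 + p 5)) :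
    HasMean (fun x => ∏ i, x i ^ p i) ((∏ i, risingRatio (coordShape i) (p i) : ℚ) : ℝ) := by
  have h : ∀ x : Fin 8 → ℝ, totalWeight x * ∏ i, x i ^ p i =
      ∏ i, coordWeight i (x i) * x i ^ p i := fun x => Finset.prod_mul_distrib.symm
  refine ⟨?_, ?_⟩
  · simp_rw [h]
    exact Integrable.fintype_prod_dep (f := fun i t => coordWeight i t * t ^ p i)
      fun i => integrable_coordWeight i (p i)
  · simp_rw [h]
    rw [integral_fintype_prod_volume_eq_prod fun i t => coordWeight i t * t ^ p i]
    by_cases h5 : Even (p 5)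
    · have h3 : Even (p 3) := (Nat.even_add.1 hp).2 h5
      rw [Finset.prod_congr rfl fun i _ => integral_coordWeight i (p := p i) fun hi => hi ▸ h3,
        Finset.prod_mul_distrib, totalMass]
      push_cast
      rfl
    · have h6 : risingRatio (coordShape 5) (p 5) = 0 := if_neg h5
      have h7 := integral_coordWeight_odd (i := 5) (by decide) (Nat.not_even_iff_odd.1 h5)
      rw [Finset.prod_eq_zero (Finset.mem_univ 5) h7, Finset.prod_eq_zero (Finset.mem_univ 5) h6]
      simp

/-- The exponents of the monomials in the expansion of the powers of the determinant. -/
def termExponent (n j l i e1 e2 : ℕ) : Fin 8 → ℕ :=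
  ![2 * n, i + l, n + (n - j) - i + (j - l), n + (n - j) + i, 0, n + (n - j) - i, j - l + e1,
    j + l + e2]

/-- The normalized integrals of the monomials. -/
def termMean (n j l i e1 e2 : ℕ) : ℚ :=
  if Even (i + l) ∧ Even (n + (n - j) - i) then
    risingRatio (5 / 2) (2 * n) * risingRatio (1 / 2) (i + l) *
      risingRatio 2 (n + (n - j) - i + (j - l)) * risingRatio 1 (n + (n - j) + i) *
      risingRatio (1 / 2) (n + (n - j) - i) * risingRatio (1 / 2) (j - l + e1) *
      risingRatio (1 / 2) (j + l + e2)
  else 0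

/-- The guard in `termMean` discards only terms in which `risingRatio` vanishes at an odd exponent.
-/
theorem prod_risingRatio_termExponent (n j l i e1 e2 : ℕ) :
    ∏ k, risingRatio (coordShape k) (termExponent n j l i e1 e2 k) = termMean n j l i e1 e2 := by
  have h0 : risingRatio (1 / 2) 0 = 1 := by simp [risingRatio]
  simp only [Fin.prod_univ_eight, coordShape, termExponent, termMean, Matrix.cons_val, h0]
  split_ifs with h
  · ring
  · rcases not_and_or.1 h with h1 | h1
    · have h2 : risingRatio (1 / 2) (i + l) = 0 := if_neg h1
      rw [h2]
      ring
    · have h2 : risingRatio (1 / 2) (n + (n - j) - i) = 0 := if_neg h1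
      rw [h2]
      ring

theorem hasMean_term {n j l i e1 e2 : ℕ} (hi : i < n + (n - j) + 1) :
    HasMean (fun x => ∏ k, x k ^ termExponent n j l i e1 e2 k) (termMean n j l i e1 e2 : ℚ) := by
  rw [← prod_risingRatio_termExponent]
  refine hasMean_monomial ?_
  simp only [termExponent, Matrix.cons_val]
  exact ⟨n + (n - j), by omega⟩

/-- The coefficients of the monomials. -/
def termCoeff (n j l i : ℕ) : ℚ :=
  (-1) ^ (n - j) * (-1) ^ l * n.choose j * j.choose l * (n + (n - j)).choose i

/-- The normalized integral of a power of the determinant. -/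
def meanPow (n : ℕ) : ℚ :=
  4 ^ n * ∑ j ∈ Finset.range (n + 1), ∑ l ∈ Finset.range (j + 1),
    ∑ i ∈ Finset.range (n + (n - j) + 1),
      termCoeff n j l i * (termMean n j l i 2 0 + termMean n j l i 0 2)

/-- The determinant of the partial transpose as a function of the final coordinates. -/
def finalDet (x : Fin 8 → ℝ) : ℝ :=
  4 * x 0 ^ 2 * ((x 5 * x 2 + x 1 * x 3) * x 3) *
    (x 7 * (x 2 * x 6 - x 1 * x 7) - (x 5 * x 2 + x 1 * x 3) * x 3)

/-- Three nested binomial expansions: `j` for the outer difference, `l` for the factor `k`, `i` for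
the powers of `g`. -/
theorem finalDet_pow (n : ℕ) (x : Fin 8 → ℝ) :
    (x 6 ^ 2 + x 7 ^ 2) * finalDet x ^ n = 4 ^ n * ∑ j ∈ Finset.range (n + 1),
      ∑ l ∈ Finset.range (j + 1), ∑ i ∈ Finset.range (n + (n - j) + 1),
        ((termCoeff n j l i : ℚ) : ℝ) * (∏ k, x k ^ termExponent n j l i 2 0 k +
          ∏ k, x k ^ termExponent n j l i 0 2 k) := by
  set g := x 5 * x 2 + x 1 * x 3 with hg
  set k := x 2 * x 6 - x 1 * x 7 with hk
  have h1 : finalDet x ^ n = 4 ^ n * ∑ j ∈ Finset.range (n + 1),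
      (x 0 ^ (2 * n) * (-1) ^ (n - j) * n.choose j * x 7 ^ j * x 3 ^ (n + (n - j))) *
        (k ^ j * g ^ (n + (n - j))) := by
    have : finalDet x = 4 * (x 0 ^ 2 * (g * x 3) * (x 7 * k + -(g * x 3))) := by
      rw [finalDet]; ring
    rw [this, mul_pow, mul_pow, add_pow, Finset.mul_sum]
    congr 1
    refine Finset.sum_congr rfl fun j hj => ?_
    rw [neg_pow, mul_pow (x 0 ^ 2), ← pow_mul, mul_pow g, mul_pow g, mul_pow (x 7), pow_add, pow_add]
    ring
  have h2 : ∀ j, k ^ j = ∑ l ∈ Finset.range (j + 1),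
      (-1) ^ l * j.choose l * (x 1 ^ l * x 7 ^ l * x 2 ^ (j - l) * x 6 ^ (j - l)) := by
    intro j
    have : k = -(x 1 * x 7) + x 2 * x 6 := by rw [hk]; ring
    rw [this, add_pow]
    refine Finset.sum_congr rfl fun l hl => ?_
    rw [neg_pow, mul_pow, mul_pow]
    ring
  have h3 : ∀ N, g ^ N = ∑ i ∈ Finset.range (N + 1),
      (N.choose i) * (x 1 ^ i * x 3 ^ i * x 5 ^ (N - i) * x 2 ^ (N - i)) := by
    intro N
    have : g = x 1 * x 3 + x 5 * x 2 := by rw [hg]; ring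
    rw [this, add_pow]
    refine Finset.sum_congr rfl fun i hi => ?_
    rw [mul_pow, mul_pow]
    ring
  rw [h1, mul_left_comm, Finset.mul_sum]
  congr 1
  refine Finset.sum_congr rfl fun j hj => ?_
  rw [h2, h3, Finset.sum_mul_sum, Finset.mul_sum, Finset.mul_sum]
  refine Finset.sum_congr rfl fun l hl => ?_
  rw [Finset.mul_sum, Finset.mul_sum]
  refine Finset.sum_congr rfl fun i hi => ?_
  simp only [termCoeff, termExponent, Fin.prod_univ_eight, Matrix.cons_val]
  push_cast
  generalize n + (n - j) = N
  generalize N - i = M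
  generalize j - l = L
  ring

theorem hasMean_finalDet_pow (n : ℕ) :
    HasMean (fun x => (x 6 ^ 2 + x 7 ^ 2) * finalDet x ^ n) (meanPow n : ℚ) := by
  have h : HasMean (fun x => 4 ^ n * ∑ j ∈ Finset.range (n + 1),
      ∑ l ∈ Finset.range (j + 1), ∑ i ∈ Finset.range (n + (n - j) + 1),
        ((termCoeff n j l i : ℚ) : ℝ) * (∏ k, x k ^ termExponent n j l i 2 0 k +
          ∏ k, x k ^ termExponent n j l i 0 2 k))
      (4 ^ n * ∑ j ∈ Finset.range (n + 1), ∑ l ∈ Finset.range (j + 1),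
        ∑ i ∈ Finset.range (n + (n - j) + 1), ((termCoeff n j l i : ℚ) : ℝ) *
          ((termMean n j l i 2 0 : ℚ) + (termMean n j l i 0 2 : ℚ))) :=
    (HasMean.sum _ fun j _ => HasMean.sum _ fun l _ => HasMean.sum _ fun i hi =>
      ((hasMean_term (Finset.mem_range.1 hi)).add
        (hasMean_term (Finset.mem_range.1 hi))).const_mul _).const_mul _
  have e : ((meanPow n : ℚ) : ℝ) = 4 ^ n * ∑ j ∈ Finset.range (n + 1),
      ∑ l ∈ Finset.range (j + 1), ∑ i ∈ Finset.range (n + (n - j) + 1),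
        ((termCoeff n j l i : ℚ) : ℝ) *
          ((termMean n j l i 2 0 : ℚ) + (termMean n j l i 0 2 : ℚ)) := by
    rw [meanPow]
    push_cast
    rfl
  rw [e]
  convert h using 2 with x
  exact finalDet_pow n x

end Moments

/-! ### Normalization and evaluation. -/

section Expectation

theorem lintegral_gauss_eq {φ : ℝ → ENNReal} (hφ : Measurable φ) :
    ∫⁻ t, ∫⁻ y, ∫⁻ e, ENNReal.ofReal (gaussWeight t y e) * φ (gaussDet t y e) =
      ∫⁻ x, ENNReal.ofReal (totalWeight x * (x 6 ^ 2 + x 7 ^ 2)) * φ (finalDet x) := by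
  have hw : Measurable totalWeight := by
    unfold totalWeight coordWeight
    simp only [Fin.prod_univ_eight, Matrix.cons_val]
    fun_prop
  have hm : Measurable fun x : Fin 8 → ℝ =>
      ENNReal.ofReal (totalWeight x * (x 6 ^ 2 + x 7 ^ 2)) * φ (finalDet x) := by
    refine Measurable.mul (by fun_prop) (hφ.comp ?_)
    unfold finalDet
    fun_prop
  rw [lintegral_fin_append (m := 3) (n := 5) hm]
  refine lintegral_congr fun t => ?_
  have hp : Measurable fun b : Fin 5 → ℝ => (t, b) := measurable_prodMk_left
  have h2 := hm.comp ((measurable_fin_append (m := 3) (n := 5)).comp hp)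
  refine Eq.trans ?_ (lintegral_fin_append (m := 3) (n := 2) h2).symm
  refine lintegral_congr fun y => lintegral_congr fun e => ?_
  simp only [Function.comp_apply]
  have happ : Fin.append t (Fin.append y e) = ![t 0, t 1, t 2, y 0, y 1, y 2, e 0, e 1] := by
    ext i
    fin_cases i <;> rfl
  rw [happ]
  congr 2
  simp only [gaussWeight, totalWeight, coordWeight, Fin.prod_univ_eight, Matrix.cons_val]
  have hexp : Real.exp (-(t 0 ^ 2 + t 1 ^ 2 + t 2 ^ 2 + (y 0 ^ 2 + y 1 ^ 2 + y 2 ^ 2)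
      + (e 0 ^ 2 + e 1 ^ 2))) = Real.exp (-t 0 ^ 2) * Real.exp (-t 1 ^ 2) * Real.exp (-t 2 ^ 2) *
      Real.exp (-y 0 ^ 2) * Real.exp (-y 1 ^ 2) * Real.exp (-y 2 ^ 2) * Real.exp (-e 0 ^ 2) *
      Real.exp (-e 1 ^ 2) := by
    simp only [← Real.exp_add]
    congr 1
    ring
  rw [hexp]
  ring

theorem exists_lintegral_boundaryStates_eq : ∃ C : ENNReal, C ≠ 0 ∧ C ≠ ⊤ ∧
    ∀ (φ : ℝ → ENNReal) (d : ℕ), Measurable φ →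
      (∀ t : ℝ, 0 < t → ∀ x, φ (t ^ 4 * x) = ENNReal.ofReal (t ^ d) * φ x) →
      ((d + 8).factorial : ENNReal) * ∫⁻ x in boundaryStates, φ (ptDet x) ∂μH[8] =
        C * ∫⁻ x, ENNReal.ofReal (totalWeight x * (x 6 ^ 2 + x 7 ^ 2)) * φ (finalDet x) := by
  obtain ⟨C, hC0, hC1, hC⟩ := exists_lintegral_boundaryStates_eq_cone
  refine ⟨C * ENNReal.ofReal (2 * Real.pi), by simp [hC0, Real.pi_pos],
    ENNReal.mul_ne_top hC1 ENNReal.ofReal_ne_top, fun φ d hφ hhom => ?_⟩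
  rw [hC φ d hφ hhom, lintegral_cone_eq_gauss hφ, lintegral_gauss_eq hφ, mul_assoc]

/-- Comparison of Bochner integrals from a comparison of the integrals of the positive and negative
parts. -/
theorem integral_eq_of_lintegral_ofReal_eq {α β : Type*} [MeasurableSpace α] [MeasurableSpace β]
    {μ : Measure α} {ν : Measure β} {f : α → ℝ} {g : β → ℝ} {N C : ENNReal} (hN0 : N ≠ 0)
    (hC1 : C ≠ ⊤) (hf : AEStronglyMeasurable f μ) (hg : Integrable g ν)
    (hpos : N * ∫⁻ x, ENNReal.ofReal (f x) ∂μ = C * ∫⁻ y, ENNReal.ofReal (g y) ∂ν)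
    (hneg : N * ∫⁻ x, ENNReal.ofReal (-f x) ∂μ = C * ∫⁻ y, ENNReal.ofReal (-g y) ∂ν) :
    Integrable f μ ∧ N.toReal * ∫ x, f x ∂μ = C.toReal * ∫ y, g y ∂ν := by
  have fin1 : ∫⁻ x, ENNReal.ofReal (f x) ∂μ ≠ ⊤ := fun h => by
    rw [h, ENNReal.mul_top hN0] at hpos
    exact ENNReal.mul_ne_top hC1 hg.lintegral_lt_top.ne hpos.symm
  have fin2 : ∫⁻ x, ENNReal.ofReal (-f x) ∂μ ≠ ⊤ := fun h => by
    rw [h, ENNReal.mul_top hN0] at hneg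
    exact ENNReal.mul_ne_top hC1 hg.neg.lintegral_lt_top.ne hneg.symm
  have hint : Integrable f μ := by
    refine ⟨hf, ?_⟩
    rw [hasFiniteIntegral_iff_enorm]
    have : ∀ x, ‖f x‖ₑ = ENNReal.ofReal (f x) + ENNReal.ofReal (-f x) := by
      intro x
      rw [← ofReal_norm, Real.norm_eq_abs]
      rcases le_total 0 (f x) with h | h
      · rw [abs_of_nonneg h, ENNReal.ofReal_of_nonpos (neg_nonpos.2 h), add_zero]
      · rw [abs_of_nonpos h, ENNReal.ofReal_of_nonpos h, zero_add]
    simp_rw [this]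
    rw [lintegral_add_left' hf.aemeasurable.ennreal_ofReal]
    exact ENNReal.add_lt_top.2 ⟨fin1.lt_top, fin2.lt_top⟩
  refine ⟨hint, ?_⟩
  have h1 := congrArg ENNReal.toReal hpos
  have h2 := congrArg ENNReal.toReal hneg
  rw [ENNReal.toReal_mul, ENNReal.toReal_mul] at h1 h2
  rw [integral_eq_lintegral_pos_part_sub_lintegral_neg_part hint,
    integral_eq_lintegral_pos_part_sub_lintegral_neg_part hg, mul_sub, mul_sub, h1, h2]

/-- The comparison of Lebesgue integrals is applied to the positive and negative parts of xⁿ, both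
homogeneous; finiteness on the Gaussian side gives integrability on the boundary. -/
theorem exists_integral_boundaryStates_eq : ∃ C : ℝ, 0 < C ∧ ∀ n : ℕ,
    Integrable (fun x => ptDet x ^ n) (μH[8].restrict boundaryStates) ∧
      ((4 * n + 8).factorial : ℝ) * ∫ x in boundaryStates, ptDet x ^ n ∂μH[8] = C * meanPow n := by
  obtain ⟨C, hC0, hC1, hC⟩ := exists_lintegral_boundaryStates_eq
  refine ⟨C.toReal * totalMass, mul_pos (ENNReal.toReal_pos hC0 hC1) totalMass_pos, fun n => ?_⟩
  have hpull : ∀ x : Fin 8 → ℝ, 0 ≤ totalWeight x * (x 6 ^ 2 + x 7 ^ 2) := fun x =>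
    mul_nonneg (totalWeight_nonneg x) (by positivity)
  have hscale : ∀ (c : ℝ) (t : ℝ), 0 < t → ∀ x : ℝ, ENNReal.ofReal (c * (t ^ 4 * x) ^ n) =
      ENNReal.ofReal (t ^ (4 * n)) * ENNReal.ofReal (c * x ^ n) := by
    intro c t ht x
    rw [← ENNReal.ofReal_mul (by positivity), mul_pow, ← pow_mul, mul_left_comm]
  have key : ∀ c : ℝ, ((4 * n + 8).factorial : ENNReal) *
      ∫⁻ x in boundaryStates, ENNReal.ofReal (c * ptDet x ^ n) ∂μH[8] =
        C * ∫⁻ x, ENNReal.ofReal (c * (totalWeight x * ((x 6 ^ 2 + x 7 ^ 2) * finalDet x ^ n))) := by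
    intro c
    rw [hC (fun x => ENNReal.ofReal (c * x ^ n)) (4 * n) (by fun_prop) (hscale c)]
    congr 1
    refine lintegral_congr fun x => ?_
    rw [← ENNReal.ofReal_mul (hpull x)]
    congr 1
    ring
  obtain ⟨hint, hval⟩ := hasMean_finalDet_pow n
  have hpos := key 1
  have hneg := key (-1)
  simp only [one_mul, neg_one_mul] at hpos hneg
  obtain ⟨h1, h2⟩ := integral_eq_of_lintegral_ofReal_eq
    (N := ((4 * n + 8).factorial : ENNReal)) (by simp [Nat.factorial_ne_zero])
    hC1 (continuous_ptDet.pow n).aestronglyMeasurable hint hpos hneg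
  refine ⟨h1, ?_⟩
  rw [ENNReal.toReal_natCast] at h2
  exact h2.trans (by rw [hval, mul_assoc])

theorem meanPow_zero : meanPow 0 = 1 := by decide +kernel

/-- The case n = 0: integrability of the constant 1 gives finite area, and `meanPow 0 = 1` with `C >
0` gives nonzero area. -/
theorem hausdorffMeasure_boundaryStates : μH[8] boundaryStates ≠ 0 ∧ μH[8] boundaryStates ≠ ⊤ := by
  obtain ⟨C, hC, h⟩ := exists_integral_boundaryStates_eq
  obtain ⟨h1, h2⟩ := h 0
  simp only [pow_zero] at h1 h2
  have hfin : μH[8] boundaryStates ≠ ⊤ := by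
    rw [integrable_const_iff] at h1
    simpa [isFiniteMeasure_restrict] using h1
  refine ⟨fun h0 => ?_, hfin⟩
  rw [Measure.restrict_eq_zero.2 h0, meanPow_zero] at h2
  simp at h2
  exact hC.ne h2

theorem hsBoundaryLaw_eq :
    hsBoundaryLaw = (μH[8] boundaryStates)⁻¹ • μH[8].restrict boundaryStates := rfl

theorem integrable_ptDet_pow (n : ℕ) : Integrable (fun x => ptDet x ^ n) hsBoundaryLaw := by
  obtain ⟨C, -, h⟩ := exists_integral_boundaryStates_eq
  have hc : (μH[8] boundaryStates)⁻¹ ≠ ⊤ :=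
    ENNReal.inv_ne_top.2 hausdorffMeasure_boundaryStates.1
  rw [hsBoundaryLaw_eq]
  exact (h n).1.smul_measure hc

/-- Division by the case n = 0 removes the constant `C` and leaves the ratio of the factorials 8!
and (4n+8)!. -/
theorem hsBoundaryMoment_eq (n : ℕ) :
    hsBoundaryMoment n = ((meanPow n * Nat.factorial 8 / Nat.factorial (4 * n + 8) : ℚ) : ℝ) := by
  obtain ⟨C, hC, h⟩ := exists_integral_boundaryStates_eq
  have h0 := (h 0).2
  have hn := (h n).2
  rw [meanPow_zero] at h0
  simp only [pow_zero, integral_const, Measure.real, Measure.restrict_apply_univ, smul_eq_mul,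
    mul_one, mul_zero, zero_add, Rat.cast_one] at h0
  rw [hsBoundaryMoment, hsBoundaryLaw_eq, integral_smul_measure, ENNReal.toReal_inv, smul_eq_mul]
  change _ * ∫ x in boundaryStates, ptDet x ^ n ∂μH[8] = _
  have hv : 0 < (μH[8] boundaryStates).toReal :=
    ENNReal.toReal_pos hausdorffMeasure_boundaryStates.1 hausdorffMeasure_boundaryStates.2
  have hf : (0 : ℝ) < (4 * n + 8).factorial := by positivity
  push_cast
  rw [← h0] at hn
  field_simp
  linear_combination hn

/-- The moments as rational numbers. -/
def rationalMoment (n : ℕ) : ℚ := meanPow n * Nat.factorial 8 / Nat.factorial (4 * n + 8)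

theorem hsBoundaryMoment_eq_of_rationalMoment_eq {n : ℕ} {q : ℚ} {r : ℝ}
    (h : rationalMoment n = q) (hr : (q : ℝ) = r) : hsBoundaryMoment n = r := by
  rw [hsBoundaryMoment_eq, ← hr, ← h, rationalMoment]

theorem rationalMoment_values : rationalMoment 1 = -5 / 2376 ∧
    rationalMoment 2 = 7 / 380160 ∧
    rationalMoment 3 = -9 / 34777600 ∧
    rationalMoment 4 = 443 / 89942261760 ∧
    rationalMoment 5 = -461 / 4032782401536 ∧
    rationalMoment 6 = 5455 / 1785064543223808 ∧
    rationalMoment 7 = -631 / 6948198442598400 ∧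
    rationalMoment 8 = 474017 / 161763811601154048000 ∧
    rationalMoment 9 = -4003573 / 39645007353595350220800 ∧
    rationalMoment 10 = 3397 / 924892257224239349760 := by
  decide +kernel

end Expectation

theorem mainTheorem8 :
    IsProbabilityMeasure hsBoundaryLaw ∧
    (∀ n : ℕ, Integrable (fun x : HSSpace => (partialTranspose x.toMatrix).det ^ n) hsBoundaryLaw) ∧
    hsBoundaryMoment 1 = -5 / 2376 ∧
    hsBoundaryMoment 2 = 7 / 380160 ∧
    hsBoundaryMoment 3 = -9 / 34777600 ∧
    hsBoundaryMoment 4 = 443 / 89942261760 ∧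
    hsBoundaryMoment 5 = -461 / 4032782401536 ∧
    hsBoundaryMoment 6 = 5455 / 1785064543223808 ∧
    hsBoundaryMoment 7 = -631 / 6948198442598400 ∧
    hsBoundaryMoment 8 = 474017 / 161763811601154048000 ∧
    hsBoundaryMoment 9 = -4003573 / 39645007353595350220800 ∧
    hsBoundaryMoment 10 = 3397 / 924892257224239349760 := by
  obtain ⟨h1, h2, h3, h4, h5, h6, h7, h8, h9, h10⟩ := rationalMoment_values
  refine ⟨cond_isProbabilityMeasure_of_finite hausdorffMeasure_boundaryStates.1
    hausdorffMeasure_boundaryStates.2, integrable_ptDet_pow,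
    hsBoundaryMoment_eq_of_rationalMoment_eq h1 (by norm_num),
    hsBoundaryMoment_eq_of_rationalMoment_eq h2 (by norm_num),
    hsBoundaryMoment_eq_of_rationalMoment_eq h3 (by norm_num),
    hsBoundaryMoment_eq_of_rationalMoment_eq h4 (by norm_num),
    hsBoundaryMoment_eq_of_rationalMoment_eq h5 (by norm_num),
    hsBoundaryMoment_eq_of_rationalMoment_eq h6 (by norm_num),
    hsBoundaryMoment_eq_of_rationalMoment_eq h7 (by norm_num),
    hsBoundaryMoment_eq_of_rationalMoment_eq h8 (by norm_num),
    hsBoundaryMoment_eq_of_rationalMoment_eq h9 (by norm_num),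
    hsBoundaryMoment_eq_of_rationalMoment_eq h10 (by norm_num)⟩
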